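/- Let $\mathcal G$ be a second-countable locally compact Hausdorff étale groupoid with unit space $\mathcal G^{(0)}$, and let $c\colon\mathcal G\to\mathbb R$ be a continuous 1-cocycle. Let $C^*(\mathcal G)$ be the full groupoid C*-algebra, with the time evolution $\sigma^c$ determined by $\sigma^c_t(f)(\gamma)=e^{itc(\gamma)}f(\gamma)$ for $f\in C_c(\mathcal G)$, and let $\Phi\colon C^*(\mathcal G)\to C_0(\mathcal G^{(0)})$ be the canonical conditional expectation, extending the restriction $f\mapsto f|_{\mathcal G^{(0)}}$. Let $\beta>0$, let $x\in\mathcal G^{(0)}$ have trivial isotropy, $\mathcal G_x^x=\{x\}$, and let $O=\mathcal Gx=r(s^{-1}(x))$ be its orbit. For $z\in O$ let $\gamma_z$ be an arrow with source $x$ and range $z$, and put $l_x(z)=e^{-c(\gamma_z)}$. Suppose that $O$ is $\beta$-summable, i.e. $\sum_{z\in O}l_x(z)^\beta<\infty$. Let $\beta_O=\inf\{b\in\mathbb R:\sum_{z\in O}l_x(z)^b<\infty\}\in[-\infty,\infty)$, let $m_O=\big(\sum_{z\in O}l_x(z)^\beta\big)^{-1}\sum_{z\in O}l_x(z)^\beta\delta_z$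 and let $\varphi_O=m_O\circ\Phi$. Then: 1. The minimum $\lambda_1=\min\{c(\gamma_z):z\in O\}$ exists. There is exactly one representation $\pi_O$ of $C^*(\mathcal G)$ on $\ell^2(O)$ with $\pi_O(f)\delta_z=\sum_{s(\gamma)=z}f(\gamma)\delta_{r(\gamma)}$ for all $f\in C_c(\mathcal G)$ and $z\in O$. Let $H_O$ be the (possibly unbounded) diagonal operator on $\ell^2(O)$ with $H_O\delta_z=(c(\gamma_z)-\lambda_1)\delta_z$. 2. $(\pi_O,\ell^2(O),e^{-\beta H_O})$ is an admissible triple for $\varphi_O$. That is: $\varphi_O$ is an extreme point of the set of $\sigma^c$-KMS$_\beta$ states and $\pi_{\varphi_O}(C^*(\mathcal G))''$ (for the GNS representation $\pi_{\varphi_O}$) is a factor of type I; $\ell^2(O)$ is separable; $\pi_O$ is irreducible; $e^{-\beta H_O}$ is a positive trace-class operator of norm $1$; and $\varphi_O(a)=\mathrm{Tr}(\pi_O(a)e^{-\beta H_O})/\mathrm{Tr}(e^{-\beta H_O})$ for all $a\in C^*(\mathcal G)$. 3. Put $Z_O(s)=e^{s\lambda_1}\sum_{z\in O}l_x(z)^s$.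 For all $s\in\mathbb C$ with $\mathrm{Re}\,s>\beta_O$ the operator $e^{-sH_O}$ is of trace class and $\mathrm{Tr}(e^{-sH_O})=Z_O(s)$. The partition function of $\varphi_O$ is $Z_O$: for every admissible triple $(\pi,\mathcal H,\rho)$ for $\varphi_O$ (an irreducible representation $\pi$ on a separable Hilbert space $\mathcal H$ and a positive trace-class operator $\rho$ of norm $1$ with $\varphi_O(a)=\mathrm{Tr}(\pi(a)\rho)/\mathrm{Tr}(\rho)$ for all $a$), with $H=-\frac1\beta\log\rho$, and for every $s$ with $\mathrm{Re}\,s>\beta$, the operator $e^{-sH}$ is of trace class and $\mathrm{Tr}(e^{-sH})=Z_O(s)$. 4. $Z_O$ is a generalised Dirichlet series: for every $t\in\mathbb R$ only finitely many $z\in O$ satisfy $c(\gamma_z)\le t$, and if $\lambda_1<\lambda_2<\cdots$ is the (finite or infinite) increasing listing of $\{c(\gamma_z):z\in O\}$, then $Z_O(s)=\sum_i|\{z\in O:c(\gamma_z)=\lambda_i\}|\,e^{-s(\lambda_i-\lambda_1)}$, with convergence for all $s$ with $\mathrm{Re}\,s>\beta_O$. -/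

import Mathlib

open scoped CompactlySupported Topology ENNReal ComplexOrder ComplexConjugate ZeroAtInfty

universe u w

section OperatorTheory

variable {H : Type*} [NormedAddCommGroup H] [InnerProductSpace ℂ H] [CompleteSpace H]

variable (H) in
/-- The index set of a chosen orthonormal basis of the Hilbert space `H`. -/
noncomputable def stdIndex : Set H := (exists_hilbertBasis ℂ H).choose

variable (H) in
/-- A chosen orthonormal basis of the Hilbert space `H`. -/
noncomputable def stdBasis : HilbertBasis (stdIndex H) ℂ H :=
  (exists_hilbertBasis ℂ H).choose_spec.choose

/-- `T` is of trace class: `∑ ⟨e_i, |T| e_i⟩ < ∞` for an orthonormal basis `(e_i)`. As `|T|` is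
positive, this does not depend on the basis. -/
def IsTraceClass (T : H →L[ℂ] H) : Prop :=
  Summable fun i => RCLike.re (inner ℂ (stdBasis H i) (CFC.abs T (stdBasis H i)))

/-- The trace `∑ ⟨e_i, T e_i⟩` of a trace class operator; for these it does not depend on the
basis. -/
noncomputable def operatorTrace (T : H →L[ℂ] H) : ℂ :=
  ∑' i, inner ℂ (stdBasis H i) (T (stdBasis H i))

/-- A representation `π` on `H` is irreducible: it is nonzero, and the only closed invariant
subspaces are `0` and `H`. -/
def IsIrreducibleRep {A : Type*} [NonUnitalCStarAlgebra A] (π : A →⋆ₙₐ[ℂ] (H →L[ℂ] H)) : Prop :=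
  (∃ a, π a ≠ 0) ∧ ∀ K : Submodule ℂ H, IsClosed (K : Set H) → (∀ a, ∀ v ∈ K, π a v ∈ K) →
    K = ⊥ ∨ K = ⊤

/-- The von Neumann algebra `π(A)''`. -/
noncomputable def bicommutant {A : Type*} [NonUnitalCStarAlgebra A] (π : A →⋆ₙₐ[ℂ] (H →L[ℂ] H)) :
    VonNeumannAlgebra H where
  __ := StarSubalgebra.centralizer ℂ (Set.centralizer (Set.range π))
  centralizer_centralizer' := by
    have hstar : star (Set.centralizer (Set.range π)) = Set.centralizer (Set.range π) := by
      have h : star (Set.range π) = Set.range π := by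
        ext T
        constructor
        · rintro ⟨a, ha⟩
          exact ⟨star a, by rw [map_star, ha, star_star]⟩
        · rintro ⟨a, rfl⟩
          exact ⟨star a, map_star π a⟩
      rw [Set.star_centralizer, h]
    have hc : (StarSubalgebra.centralizer ℂ (Set.centralizer (Set.range π))).carrier =
        Set.centralizer (Set.centralizer (Set.range π)) := by
      show ((StarSubalgebra.centralizer ℂ (Set.centralizer (Set.range π)) :
        StarSubalgebra ℂ (H →L[ℂ] H)) : Set (H →L[ℂ] H)) = _
      rw [StarSubalgebra.coe_centralizer, hstar, Set.union_self]
    rw [hc, Set.centralizer_centralizer_centralizer]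

/-- A von Neumann algebra is a factor when its centre consists of the scalars. -/
def IsFactor (M : VonNeumannAlgebra H) : Prop :=
  ∀ T ∈ M, T ∈ M.commutant → ∃ z : ℂ, T = z • (1 : H →L[ℂ] H)

/-- A von Neumann algebra is of type I when every nonzero central projection `z` majorises a nonzero
abelian projection `p`, i.e. one for which `pMp` is commutative. -/
def IsTypeI (M : VonNeumannAlgebra H) : Prop :=
  ∀ z ∈ M, z ∈ M.commutant → IsStarProjection z → z ≠ 0 →
    ∃ p ∈ M, IsStarProjection p ∧ p ≠ 0 ∧ p * z = p ∧
      ∀ S ∈ M, ∀ T ∈ M, (p * S * p) * (p * T * p) = (p * T * p) * (p * S * p)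

end OperatorTheory

/-- A time evolution on `A`: a pointwise norm-continuous one-parameter group of automorphisms. -/
structure TimeEvolution (A : Type*) [NonUnitalCStarAlgebra A] where
  aut : ℝ → A ≃⋆ₐ[ℂ] A
  aut_add : ∀ t₁ t₂ a, aut (t₁ + t₂) a = aut t₁ (aut t₂ a)
  continuous_aut : ∀ a, Continuous fun t => aut t a

section KMS

variable {A : Type*} [NonUnitalCStarAlgebra A]

/-- A state: a positive linear functional of norm one. -/
def IsState (φ : A →L[ℂ] ℂ) : Prop := (∀ a, 0 ≤ φ (star a * a)) ∧ ‖φ‖ = 1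

/-- `F` is the entire function `z ↦ σ_z(a)` extending `t ↦ σ_t(a)`; the element `a` is
`σ`-analytic when there is such an `F`, which is then unique. -/
def TimeEvolution.IsEntireExtension (σ : TimeEvolution A) (a : A) (F : ℂ → A) : Prop :=
  Differentiable ℂ F ∧ ∀ t : ℝ, F t = σ.aut t a

/-- `φ` is a `σ`-KMS state at inverse temperature `β`: a state with `φ(ab) = φ(b σ_{iβ}(a))` for all
`σ`-analytic elements `a` and `b`. -/
def IsKMSState (σ : TimeEvolution A) (β : ℝ) (φ : A →L[ℂ] ℂ) : Prop :=
  IsState φ ∧ ∀ (a b : A) (F F' : ℂ → A), σ.IsEntireExtension a F → σ.IsEntireExtension b F' →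
    φ (a * b) = φ (b * F (Complex.I * β))

/-- `φ` is an extreme point of the convex set of `σ`-KMS states at inverse temperature `β`. -/
def IsExtremalKMSState (σ : TimeEvolution A) (β : ℝ) (φ : A →L[ℂ] ℂ) : Prop :=
  φ ∈ Set.extremePoints ℝ {ψ : A →L[ℂ] ℂ | IsKMSState σ β ψ}

variable [PartialOrder A] [StarOrderedRing A]

/-- `φ` is a factor state of type I: the von Neumann algebra `π_φ(A)''` generated by its GNS
representation is a factor of type I. -/
def IsTypeIFactorState (φ : A →L[ℂ] ℂ) : Prop :=
  ∃ f : A →ₚ[ℂ] ℂ, (∀ a, f a = φ a) ∧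
    IsFactor (bicommutant f.gnsNonUnitalStarAlgHom) ∧ IsTypeI (bicommutant f.gnsNonUnitalStarAlgHom)

/-- `(π, H, ρ)` is an admissible triple for `φ`, where `φ` is an extremal `σ`-KMS state of type I at
inverse temperature `β > 0`. -/
structure IsAdmissibleTriple (σ : TimeEvolution A) (β : ℝ) (φ : A →L[ℂ] ℂ)
    {H : Type*} [NormedAddCommGroup H] [InnerProductSpace ℂ H] [CompleteSpace H]
    (π : A →⋆ₙₐ[ℂ] (H →L[ℂ] H)) (ρ : H →L[ℂ] H) : Prop where
  beta_pos : 0 < β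
  extremal : IsExtremalKMSState σ β φ
  typeI : IsTypeIFactorState φ
  separable : TopologicalSpace.SeparableSpace H
  irreducible : IsIrreducibleRep π
  isPositive : ρ.IsPositive
  isTraceClass : IsTraceClass ρ
  norm_eq_one : ‖ρ‖ = 1
  eq_trace : ∀ a, φ a = operatorTrace (π a * ρ) / operatorTrace ρ

/-- The operator `e^{-sH}`, where `H = -(1/β) log ρ` is the represented Hamiltonian of an admissible
triple and `Re s > 0`: by functional calculus it is `ρ^{s/β}`. -/
noncomputable def expHamiltonian {H : Type*} [NormedAddCommGroup H] [InnerProductSpace ℂ H]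
    [CompleteSpace H] (β : ℝ) (ρ : H →L[ℂ] H) (s : ℂ) : H →L[ℂ] H :=
  cfc (fun z : ℂ => z ^ (s / β)) ρ

end KMS

/-- On the half-plane `Re s > β`, the function `Z` is the partition function of the extremal KMS
state `φ` of type I: `Z(s) = Tr(e^{-sH})`, with `H` the represented Hamiltonian of any admissible
triple for `φ`. -/
def IsPartitionFunction.{v, v'} {A : Type v} [NonUnitalCStarAlgebra A] [PartialOrder A] [StarOrderedRing A]
    (σ : TimeEvolution A) (β : ℝ) (φ : A →L[ℂ] ℂ) (Z : ℂ → ℂ) : Prop :=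
  ∀ (H : Type v') [NormedAddCommGroup H] [InnerProductSpace ℂ H] [CompleteSpace H]
    (π : A →⋆ₙₐ[ℂ] (H →L[ℂ] H)) (ρ : H →L[ℂ] H), IsAdmissibleTriple σ β φ π ρ →
    ∀ s : ℂ, β < s.re →
      IsTraceClass (expHamiltonian β ρ s) ∧ operatorTrace (expHamiltonian β ρ s) = Z s

section Diagonal

variable {ι : Type*}

/-- The canonical basis vector `δ_z` of `ℓ²(ι)`. -/
noncomputable def delta (z : ι) : lp (fun _ : ι => ℂ) 2 :=
  haveI := Classical.decEq ι
  lp.single 2 z (1 : ℂ)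

open Classical in
/-- The diagonal operator on `ℓ²(ι)` with bounded entries `d`. -/
noncomputable def diagonalOp (d : ι → ℂ) : lp (fun _ : ι => ℂ) 2 →L[ℂ] lp (fun _ : ι => ℂ) 2 :=
  if h : ∃ K : ℝ, 0 ≤ K ∧ ∀ i, ‖d i • ContinuousLinearMap.id ℂ ℂ‖ ≤ K then
    lp.mapCLM 2 (fun i => d i • ContinuousLinearMap.id ℂ ℂ) h.choose_spec.1 h.choose_spec.2
  else 0

/-- The operator `e^{-sH}` for the (possibly unbounded) diagonal operator `H δ_z = h(z) δ_z`. -/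
noncomputable def expDiagonal (h : ι → ℝ) (s : ℂ) :
    lp (fun _ : ι => ℂ) 2 →L[ℂ] lp (fun _ : ι => ℂ) 2 :=
  diagonalOp fun z => Complex.exp (-s * h z)

end Diagonal

/-- `l 0 < l 1 < ⋯` tends to infinity and lists the elements of `S` in increasing order; when `S` has
only `n` elements, these are `l 0, …, l (n - 1)` and the later terms are immaterial. -/
def IsIncreasingListing (S : Set ℝ) (l : ℕ → ℝ) : Prop :=
  StrictMono l ∧ Filter.Tendsto l Filter.atTop Filter.atTop ∧
    l '' {i | (i : ℕ∞) < S.encard} = S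

section FiberSums

variable {Y Z W : Type*} [TopologicalSpace Y] [TopologicalSpace Z] [TopologicalSpace W]

/-- Near `z₀`, the points of a compact set `K` lying over `z` under a local homeomorphism are among
the values at `z` of finitely many local sections. -/
theorem exists_finset_localSections [T2Space Y] [T2Space Z] {p : Y → Z}
    (hp : IsLocalHomeomorph p) {K : Set Y} (hK : IsCompact K) (z₀ : Z) :
    ∃ S : Finset Y, (∀ y ∈ S, p y = z₀) ∧ ∀ᶠ z in 𝓝 z₀,
      (∀ y ∈ S, z ∈ (hp.localInverseAt y).source) ∧
      Set.InjOn (fun y => hp.localInverseAt y z) S ∧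
      p ⁻¹' {z} ∩ K ⊆ (fun y => hp.localInverseAt y z) '' S := by
  have hfin : (p ⁻¹' {z₀} ∩ K).Finite := by
    have hc : IsCompact (p ⁻¹' {z₀} ∩ K) :=
      hK.inter_left (isClosed_singleton.preimage hp.continuous)
    refine hc.finite ?_
    refine (hp.isLocalHomeomorphOn.mono (Set.subset_univ _)).isDiscrete_of_image ?_
    refine Set.Subsingleton.isDiscrete ?_
    rintro _ ⟨a, ha, rfl⟩ _ ⟨b, hb, rfl⟩
    exact ha.1.trans hb.1.symm
  obtain ⟨U, hU, hdisj⟩ := hfin.t2_separation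
  set S := hfin.toFinset with hS
  have hpS : ∀ y ∈ S, p y = z₀ := fun y hy => by
    have := hfin.mem_toFinset.1 hy
    exact this.1
  refine ⟨S, hpS, ?_⟩
  set V : Y → Set Y := fun y => U y ∩ (hp.localInverseAt y).target with hV
  have hVo : ∀ y, IsOpen (V y) := fun y => (hU y).2.inter (hp.localInverseAt y).open_target
  have hC : IsCompact (K \ ⋃ y ∈ S, V y) := hK.diff (isOpen_biUnion fun y _ => hVo y)
  have hz : z₀ ∉ p '' (K \ ⋃ y ∈ S, V y) := by
    rintro ⟨y, ⟨hyK, hy⟩, hpy⟩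
    refine hy (Set.mem_biUnion (x := y) ?_ ⟨(hU y).1, hp.self_mem_localInverseAt_target⟩)
    exact hfin.mem_toFinset.2 ⟨hpy, hyK⟩
  have e1 : ∀ᶠ z in 𝓝 z₀, z ∉ p '' (K \ ⋃ y ∈ S, V y) :=
    (hC.image hp.continuous).isClosed.isOpen_compl.mem_nhds hz
  have e2 : ∀ᶠ z in 𝓝 z₀, ∀ y ∈ S, z ∈ (hp.localInverseAt y).source := by
    rw [Filter.eventually_all_finset]
    intro y hy
    refine (hp.localInverseAt y).open_source.mem_nhds ?_
    rw [← hpS y hy]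
    exact hp.apply_self_mem_localInverseAt_source
  have e3 : ∀ᶠ z in 𝓝 z₀, ∀ y ∈ S, hp.localInverseAt y z ∈ U y := by
    rw [Filter.eventually_all_finset]
    intro y hy
    have hs : z₀ ∈ (hp.localInverseAt y).source := by
      rw [← hpS y hy]
      exact hp.apply_self_mem_localInverseAt_source
    refine ((hp.localInverseAt y).continuousAt hs).eventually ((hU y).2.mem_nhds ?_)
    rw [← hpS y hy, hp.localInverseAt_apply_self]
    exact (hU y).1
  filter_upwards [e1, e2, e3] with z h1 h2 h3
  refine ⟨h2, ?_, ?_⟩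
  · intro a ha b hb hab
    by_contra hne
    have := hdisj (hfin.mem_toFinset.1 ha) (hfin.mem_toFinset.1 hb) hne
    refine Set.disjoint_left.1 this (h3 a ha) ?_
    have h := h3 b hb
    simp only at hab
    rwa [← hab] at h
  · rintro y ⟨hy, hyK⟩
    have hy' : p y = z := hy
    by_contra hne
    refine h1 ⟨y, ⟨hyK, fun hmem => hne ?_⟩, hy'⟩
    obtain ⟨a, ha, hya⟩ := Set.mem_iUnion₂.1 hmem
    refine ⟨a, ha, ?_⟩
    refine hp.injOn_localInverseAt_target (x := a)
      ((hp.localInverseAt a).map_source (h2 a ha)) hya.2 ?_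
    rw [hp.apply_localInverseAt_of_mem (h2 a ha), hy']

/-- Fibrewise sums, along a local homeomorphism, of a continuous function supported in a compact set
depend continuously on the base point. -/
theorem continuous_fiberSum [T2Space Y] [T2Space Z] {p : Y → Z}
    (hp : IsLocalHomeomorph p) {q : W → Z} (hq : Continuous q) {K : Set Y} (hK : IsCompact K)
    {F : Y → W → ℂ} (hF : ∀ w, ∀ y ∉ K, F y w = 0)
    (hc : ContinuousOn (fun a : Y × W => F a.1 a.2) {a | p a.1 = q a.2}) :
    Continuous fun w => ∑ᶠ y ∈ p ⁻¹' {q w}, F y w := by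
  rw [continuous_iff_continuousAt]
  intro w₀
  obtain ⟨S, hS, hev⟩ := exists_finset_localSections hp hK (q w₀)
  have hev' := hq.continuousAt.eventually hev
  have heq : (fun w => ∑ᶠ y ∈ p ⁻¹' {q w}, F y w) =ᶠ[𝓝 w₀]
      fun w => ∑ y ∈ S, F (hp.localInverseAt y (q w)) w := by
    classical
    filter_upwards [hev'] with w hw
    obtain ⟨h1, h2, h3⟩ := hw
    rw [← Finset.sum_image (f := fun y => F y w) (s := S)
      (g := fun y => hp.localInverseAt y (q w)) h2]
    refine finsum_mem_eq_sum_of_inter_support_eq _ ?_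
    ext y
    simp only [Set.mem_inter_iff, Set.mem_preimage, Set.mem_singleton_iff, Function.mem_support,
      Finset.coe_image, Set.mem_image, Finset.mem_coe]
    constructor
    · rintro ⟨hy, hne⟩
      have hyK : y ∈ K := by
        by_contra h
        exact hne (hF w y h)
      exact ⟨h3 ⟨hy, hyK⟩, hne⟩
    · rintro ⟨⟨a, ha, rfl⟩, hne⟩
      exact ⟨hp.apply_localInverseAt_of_mem (h1 a ha), hne⟩
  refine ContinuousAt.congr ?_ heq.symm
  refine tendsto_finsetSum _ fun y hy => ?_
  have hs : q w₀ ∈ (hp.localInverseAt y).source := hev'.self_of_nhds.1 y hy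
  have hmem : p (hp.localInverseAt y (q w₀)) = q w₀ := hp.apply_localInverseAt_of_mem hs
  have hcw := hc (hp.localInverseAt y (q w₀), w₀) hmem
  have ht : Filter.Tendsto (fun w => (hp.localInverseAt y (q w), w)) (𝓝 w₀)
      (𝓝[{a | p a.1 = q a.2}] (hp.localInverseAt y (q w₀), w₀)) := by
    refine tendsto_nhdsWithin_iff.2 ⟨?_, ?_⟩
    · exact (((hp.localInverseAt y).continuousAt hs).comp hq.continuousAt).prodMk continuousAt_id
    · filter_upwards [hev'] with w hw
      exact hp.apply_localInverseAt_of_mem (hw.1 y hy)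
  exact hcw.tendsto.comp ht

end FiberSums

/-- An étale groupoid with unit space `X` and space of arrows `G`. The product `mul g h` is
meaningful only for composable pairs, i.e. when `s g = r h`; no law constrains its value on other
pairs. -/
structure EtaleGroupoid (X G : Type*) [TopologicalSpace X] [TopologicalSpace G] where
  r : G → X
  s : G → X
  unit : X → G
  inv : G → G
  mul : G → G → G
  r_unit : ∀ x, r (unit x) = x
  s_unit : ∀ x, s (unit x) = x
  r_inv : ∀ g, r (inv g) = s g
  s_inv : ∀ g, s (inv g) = r g
  r_mul : ∀ g h, s g = r h → r (mul g h) = r g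
  s_mul : ∀ g h, s g = r h → s (mul g h) = s h
  mul_assoc : ∀ g h k, s g = r h → s h = r k → mul (mul g h) k = mul g (mul h k)
  unit_mul : ∀ g, mul (unit (r g)) g = g
  mul_unit : ∀ g, mul g (unit (s g)) = g
  inv_mul : ∀ g, mul (inv g) g = unit (s g)
  mul_inv : ∀ g, mul g (inv g) = unit (r g)
  continuous_unit : Continuous unit
  continuous_inv : Continuous inv
  continuousOn_mul : ContinuousOn (fun a : G × G => mul a.1 a.2) {a | s a.1 = r a.2}
  isLocalHomeomorph_s : IsLocalHomeomorph s

namespace EtaleGroupoid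

section Convolution

variable {X G : Type*} [TopologicalSpace X] [TopologicalSpace G]

theorem inv_inv (𝒢 : EtaleGroupoid X G) (g : G) : 𝒢.inv (𝒢.inv g) = g := by
  have h1 := 𝒢.mul_assoc (𝒢.inv (𝒢.inv g)) (𝒢.inv g) g (by rw [𝒢.s_inv]) (𝒢.s_inv g)
  have h2 := 𝒢.mul_unit (𝒢.inv (𝒢.inv g))
  rw [𝒢.s_inv, 𝒢.r_inv] at h2
  rw [𝒢.inv_mul, 𝒢.inv_mul, 𝒢.s_inv, 𝒢.unit_mul, h2] at h1
  exact h1.symm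

/-- Inversion, as a homeomorphism of the arrow space. -/
def invHomeomorph (𝒢 : EtaleGroupoid X G) : G ≃ₜ G where
  toFun := 𝒢.inv
  invFun := 𝒢.inv
  left_inv := 𝒢.inv_inv
  right_inv := 𝒢.inv_inv
  continuous_toFun := 𝒢.continuous_inv
  continuous_invFun := 𝒢.continuous_inv

theorem isLocalHomeomorph_r (𝒢 : EtaleGroupoid X G) : IsLocalHomeomorph 𝒢.r := by
  have h := 𝒢.isLocalHomeomorph_s.comp 𝒢.invHomeomorph.isLocalHomeomorph
  have he : 𝒢.s ∘ 𝒢.invHomeomorph = 𝒢.r := funext 𝒢.s_inv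
  rwa [he] at h

theorem t2Space_units [T2Space G] (𝒢 : EtaleGroupoid X G) : T2Space X :=
  T2Space.of_injective_continuous
    (Function.LeftInverse.injective (g := 𝒢.s) 𝒢.s_unit) 𝒢.continuous_unit

/-- The space `C_c(𝒢)` of continuous compactly supported functions on the arrow space; it carries
the convolution product and the involution defined below. -/
def Cc (_ : EtaleGroupoid X G) : Type _ := C_c(G, ℂ)

noncomputable instance (𝒢 : EtaleGroupoid X G) : AddCommGroup 𝒢.Cc :=
  inferInstanceAs (AddCommGroup C_c(G, ℂ))

noncomputable instance (𝒢 : EtaleGroupoid X G) : Module ℂ 𝒢.Cc :=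
  inferInstanceAs (Module ℂ C_c(G, ℂ))

instance (𝒢 : EtaleGroupoid X G) : FunLike 𝒢.Cc G ℂ :=
  inferInstanceAs (FunLike C_c(G, ℂ) G ℂ)

namespace Cc

variable {𝒢 : EtaleGroupoid X G}

/-- Build an element of `C_c(𝒢)`. -/
def mk (f : G → ℂ) (hf : Continuous f) (hc : HasCompactSupport f) : 𝒢.Cc :=
  (⟨⟨f, hf⟩, hc⟩ : C_c(G, ℂ))

@[simp] theorem mk_apply (f : G → ℂ) (hf : Continuous f) (hc : HasCompactSupport f) (g : G) :
    (mk f hf hc : 𝒢.Cc) g = f g := rfl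

@[ext] theorem ext {f g : 𝒢.Cc} (h : ∀ a, f a = g a) : f = g := DFunLike.ext f g h

theorem continuous (f : 𝒢.Cc) : Continuous f := ContinuousMapClass.map_continuous (F := C_c(G, ℂ)) f

theorem hasCompactSupport (f : 𝒢.Cc) : HasCompactSupport f :=
  CompactlySupportedContinuousMap.hasCompactSupport f

@[simp] theorem zero_apply (a : G) : (0 : 𝒢.Cc) a = 0 := rfl

@[simp] theorem add_apply (f g : 𝒢.Cc) (a : G) : (f + g) a = f a + g a := rfl

@[simp] theorem sub_apply (f g : 𝒢.Cc) (a : G) : (f - g) a = f a - g a := rfl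

@[simp] theorem smul_apply (t : ℂ) (f : 𝒢.Cc) (a : G) : (t • f) a = t * f a := rfl

theorem finite_fiber [T2Space G] (f : 𝒢.Cc) (x : X) :
    ({η | 𝒢.r η = x} ∩ tsupport f).Finite := by
  have := 𝒢.t2Space_units
  obtain ⟨S, -, h⟩ := exists_finset_localSections 𝒢.isLocalHomeomorph_r f.hasCompactSupport x
  exact (S.finite_toSet.image _).subset h.self_of_nhds.2.2

end Cc

/-- The convolution `(f * g)(γ) = ∑ f(η) g(η⁻¹γ)`, the sum being over all arrows `η` with
`r(η) = r(γ)`. -/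
noncomputable def conv (𝒢 : EtaleGroupoid X G) (f g : G → ℂ) (γ : G) : ℂ :=
  ∑ᶠ η ∈ {η | 𝒢.r η = 𝒢.r γ}, f η * g (𝒢.mul (𝒢.inv η) γ)

theorem mul_inv_cancel_left (𝒢 : EtaleGroupoid X G) {η γ : G} (h : 𝒢.r η = 𝒢.r γ) :
    𝒢.mul η (𝒢.mul (𝒢.inv η) γ) = γ := by
  rw [← 𝒢.mul_assoc η (𝒢.inv η) γ (𝒢.r_inv η).symm ((𝒢.s_inv η).trans h), 𝒢.mul_inv, h,
    𝒢.unit_mul]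

/-- The involution `f^*(γ) = conj (f(γ⁻¹))`. -/
noncomputable instance (𝒢 : EtaleGroupoid X G) : Star 𝒢.Cc :=
  ⟨fun f => Cc.mk (fun γ => conj (f (𝒢.inv γ)))
    (Complex.continuous_conj.comp (f.continuous.comp 𝒢.continuous_inv))
    ((f.hasCompactSupport.comp_homeomorph 𝒢.invHomeomorph).comp_left (map_zero _))⟩

theorem Cc.star_apply {𝒢 : EtaleGroupoid X G} (f : 𝒢.Cc) (γ : G) :
    (star f) γ = conj (f (𝒢.inv γ)) := rfl

variable [T2Space G]

theorem continuous_conv (𝒢 : EtaleGroupoid X G) (f g : 𝒢.Cc) : Continuous (𝒢.conv f g) := by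
  have := 𝒢.t2Space_units
  refine continuous_fiberSum (K := tsupport f) (q := 𝒢.r)
    (F := fun η γ => f η * g (𝒢.mul (𝒢.inv η) γ))
    𝒢.isLocalHomeomorph_r 𝒢.isLocalHomeomorph_r.continuous f.hasCompactSupport ?_ ?_
  · intro w y hy
    rw [image_eq_zero_of_notMem_tsupport hy, zero_mul]
  · refine ContinuousOn.mul (f.continuous.comp continuous_fst).continuousOn ?_
    refine g.continuous.comp_continuousOn ?_
    refine 𝒢.continuousOn_mul.comp
      (f := fun a : G × G => (𝒢.inv a.1, a.2))
      ((𝒢.continuous_inv.comp continuous_fst).prodMk continuous_snd).continuousOn ?_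
    intro a ha
    have ha' : 𝒢.r a.1 = 𝒢.r a.2 := ha
    simpa [𝒢.s_inv] using ha'

theorem hasCompactSupport_conv (𝒢 : EtaleGroupoid X G) (f g : 𝒢.Cc) :
    HasCompactSupport (𝒢.conv f g) := by
  have := 𝒢.t2Space_units
  have hcl : IsClosed {a : G × G | 𝒢.s a.1 = 𝒢.r a.2} :=
    isClosed_eq (𝒢.isLocalHomeomorph_s.continuous.comp continuous_fst)
      (𝒢.isLocalHomeomorph_r.continuous.comp continuous_snd)
  have hK : IsCompact ((tsupport f ×ˢ tsupport g) ∩ {a : G × G | 𝒢.s a.1 = 𝒢.r a.2}) :=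
    (f.hasCompactSupport.isCompact.prod g.hasCompactSupport.isCompact).inter_right hcl
  have hK' := hK.image_of_continuousOn (𝒢.continuousOn_mul.mono Set.inter_subset_right)
  refine HasCompactSupport.intro hK' fun γ hγ => ?_
  refine finsum_mem_eq_zero_of_forall_eq_zero fun η hη => ?_
  have hη' : 𝒢.r η = 𝒢.r γ := hη
  by_contra hne
  refine hγ ⟨(η, 𝒢.mul (𝒢.inv η) γ), ⟨⟨?_, ?_⟩, ?_⟩, 𝒢.mul_inv_cancel_left hη'⟩
  · exact subset_tsupport _ (left_ne_zero_of_mul hne)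
  · exact subset_tsupport _ (right_ne_zero_of_mul hne)
  · show 𝒢.s η = 𝒢.r (𝒢.mul (𝒢.inv η) γ)
    rw [𝒢.r_mul _ _ ((𝒢.s_inv η).trans hη'), 𝒢.r_inv]

noncomputable instance (𝒢 : EtaleGroupoid X G) : Mul 𝒢.Cc :=
  ⟨fun f g => Cc.mk (𝒢.conv f g) (𝒢.continuous_conv f g) (𝒢.hasCompactSupport_conv f g)⟩

theorem Cc.mul_apply {𝒢 : EtaleGroupoid X G} (f g : 𝒢.Cc) (γ : G) :
    (f * g) γ = ∑ᶠ η ∈ {η | 𝒢.r η = 𝒢.r γ}, f η * g (𝒢.mul (𝒢.inv η) γ) := rfl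

theorem Cc.finite_support_mul {𝒢 : EtaleGroupoid X G} (f : 𝒢.Cc) (x : X) (h : G → ℂ) :
    ({η | 𝒢.r η = x} ∩ Function.support fun η => f η * h η).Finite :=
  (f.finite_fiber x).subset fun _ hη =>
    ⟨hη.1, subset_tsupport _ (left_ne_zero_of_mul hη.2)⟩

noncomputable instance (𝒢 : EtaleGroupoid X G) : NonUnitalNonAssocRing 𝒢.Cc where
  left_distrib f g h := by
    ext γ
    simp only [Cc.mul_apply, Cc.add_apply, mul_add]
    exact finsum_mem_add_distrib' (f.finite_support_mul _ _) (f.finite_support_mul _ _)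
  right_distrib f g h := by
    ext γ
    simp only [Cc.mul_apply, Cc.add_apply, add_mul]
    exact finsum_mem_add_distrib' (f.finite_support_mul _ _) (g.finite_support_mul _ _)
  zero_mul f := by
    ext γ
    simp [Cc.mul_apply]
  mul_zero f := by
    ext γ
    simp [Cc.mul_apply]

end Convolution

/-- A continuous real-valued 1-cocycle: a continuous groupoid homomorphism to `(ℝ, +)`. -/
structure Cocycle {X G : Type*} [TopologicalSpace X] [TopologicalSpace G]
    (𝒢 : EtaleGroupoid X G) where
  toFun : G → ℝ
  continuous_toFun : Continuous toFun
  map_mul' : ∀ g h, 𝒢.s g = 𝒢.r h → toFun (𝒢.mul g h) = toFun g + toFun h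

instance {X G : Type*} [TopologicalSpace X] [TopologicalSpace G] (𝒢 : EtaleGroupoid X G) :
    CoeFun 𝒢.Cocycle (fun _ => G → ℝ) := ⟨Cocycle.toFun⟩

theorem Cocycle.map_unit {X G : Type*} [TopologicalSpace X] [TopologicalSpace G]
    {𝒢 : EtaleGroupoid X G} (c : 𝒢.Cocycle) (x : X) : c (𝒢.unit x) = 0 := by
  have h := c.map_mul' (𝒢.unit x) (𝒢.unit x) (by rw [𝒢.s_unit, 𝒢.r_unit])
  have h2 := 𝒢.unit_mul (𝒢.unit x)
  rw [𝒢.r_unit] at h2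
  rw [h2] at h
  linarith

theorem Cocycle.map_inv {X G : Type*} [TopologicalSpace X] [TopologicalSpace G]
    {𝒢 : EtaleGroupoid X G} (c : 𝒢.Cocycle) (g : G) : c (𝒢.inv g) = -c g := by
  have h := c.map_mul' (𝒢.inv g) g (𝒢.s_inv g)
  rw [𝒢.inv_mul, c.map_unit] at h
  linarith

theorem fiberSum_le {G X : Type*} {p : G → X} {K : Set G} {N : ℕ} (hN : ∀ x, (p ⁻¹' {x} ∩ K).encard ≤ N)
    {f : G → ℂ} (hf : ∀ η ∉ K, f η = 0) {C : ℝ} (h0 : 0 ≤ C)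
    (hC : ∀ η, ‖f η‖ ≤ C) (x : X) :
    ∑ᶠ η ∈ {η | p η = x}, ‖f η‖ ≤ N * C := by
  have hfin : (p ⁻¹' {x} ∩ K).Finite :=
    Set.finite_of_encard_le_coe (hN x)
  have heq : ∑ᶠ η ∈ {η | p η = x}, ‖f η‖ = ∑ η ∈ hfin.toFinset, ‖f η‖ := by
    refine finsum_mem_eq_sum_of_inter_support_eq _ ?_
    ext η
    simp only [Set.mem_inter_iff, Set.mem_ofPred_eq, Function.mem_support, Set.Finite.coe_toFinset,
      Set.mem_preimage, Set.mem_singleton_iff]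
    constructor
    · rintro ⟨h1, h2⟩
      refine ⟨⟨h1, ?_⟩, h2⟩
      by_contra h
      exact h2 (by rw [hf η h, norm_zero])
    · rintro ⟨⟨h1, -⟩, h2⟩
      exact ⟨h1, h2⟩
  rw [heq]
  refine (Finset.sum_le_card_nsmul _ _ C fun η _ => hC η).trans ?_
  rw [nsmul_eq_mul]
  refine mul_le_mul_of_nonneg_right ?_ h0
  have := hN x
  rw [hfin.encard_eq_coe_toFinset_card] at this
  exact_mod_cast this

section FullAlgebra

variable {X G : Type u} [TopologicalSpace X] [TopologicalSpace G]

/-- The `I`-norm: the larger of the suprema, over the unit space, of the `ℓ¹`-norms of `f` on the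
range fibres and on the source fibres. -/
noncomputable def INorm (𝒢 : EtaleGroupoid X G) (f : 𝒢.Cc) : ℝ :=
  max (⨆ x : X, ∑ᶠ η ∈ {η | 𝒢.r η = x}, ‖f η‖) (⨆ x : X, ∑ᶠ η ∈ {η | 𝒢.s η = x}, ‖f η‖)

theorem exists_fiber_card_le {p : G → X} (hp : IsLocalHomeomorph p) {K : Set G}
    (hK : IsCompact K) : ∃ N : ℕ, ∀ x, (p ⁻¹' {x} ∩ K).encard ≤ N := by
  obtain ⟨t, -, ht⟩ := hK.elim_nhds_subcover (fun y => (hp.localInverseAt y).target)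
    fun y _ => (hp.localInverseAt y).open_target.mem_nhds hp.self_mem_localInverseAt_target
  refine ⟨t.card, fun x => ?_⟩
  rw [← Set.encard_coe_eq_coe_finsetCard]
  have hc : ∀ η ∈ p ⁻¹' {x} ∩ K, ∃ y ∈ t, η ∈ (hp.localInverseAt y).target := fun η hη => by
    simpa using ht hη.2
  choose! F hF1 hF2 using hc
  refine Set.encard_le_encard_of_injOn (f := F) hF1 ?_
  intro a ha b hb hab
  refine hp.injOn_localInverseAt_target (hF2 a ha) (hab ▸ hF2 b hb) ?_
  exact ha.1.trans hb.1.symm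

theorem iNorm_le (𝒢 : EtaleGroupoid X G) {K : Set G} (hK : IsCompact K) :
    ∃ N : ℕ, ∀ f : 𝒢.Cc, (∀ η ∉ K, f η = 0) → ∀ C : ℝ, 0 ≤ C → (∀ η, ‖f η‖ ≤ C) →
      𝒢.INorm f ≤ N * C := by
  obtain ⟨N, hN⟩ := exists_fiber_card_le 𝒢.isLocalHomeomorph_r hK
  obtain ⟨M, hM⟩ := exists_fiber_card_le 𝒢.isLocalHomeomorph_s hK
  refine ⟨max N M, fun f hf C h0 hC => ?_⟩
  have h1 : (N : ℝ) * C ≤ (max N M : ℕ) * C := by gcongr; exact le_max_left _ _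
  have h2 : (M : ℝ) * C ≤ (max N M : ℕ) * C := by gcongr; exact le_max_right _ _
  refine max_le ?_ ?_
  · exact Real.iSup_le (fun x => (fiberSum_le hN hf h0 hC x).trans h1) (by positivity)
  · exact Real.iSup_le (fun x => (fiberSum_le hM hf h0 hC x).trans h2) (by positivity)

variable [T2Space G]

/-- A `*`-representation of `C_c(𝒢)` on a Hilbert space that is bounded by the `I`-norm. -/
structure Rep (𝒢 : EtaleGroupoid X G) : Type (u + 1) where
  H : Type u
  [instNormed : NormedAddCommGroup H]
  [instInner : InnerProductSpace ℂ H]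
  [instComplete : CompleteSpace H]
  toHom : 𝒢.Cc →⋆ₙₐ[ℂ] (H →L[ℂ] H)
  norm_le : ∀ f, ‖toHom f‖ ≤ 𝒢.INorm f

attribute [instance] Rep.instNormed Rep.instInner Rep.instComplete

/-- The `ℓ^∞`-product of the algebras `B(H_π)`, over all bounded representations `π`. -/
def RepProd (𝒢 : EtaleGroupoid X G) : Type (u + 1) :=
  lp (fun π : 𝒢.Rep => π.H →L[ℂ] π.H) ∞

noncomputable instance (𝒢 : EtaleGroupoid X G) : NonUnitalCStarAlgebra 𝒢.RepProd :=
  inferInstanceAs (NonUnitalCStarAlgebra (lp (fun π : 𝒢.Rep => π.H →L[ℂ] π.H) ∞))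

/-- The component of an element of the product at a bounded representation. -/
def RepProd.component {𝒢 : EtaleGroupoid X G} (T : 𝒢.RepProd) (π : 𝒢.Rep) : π.H →L[ℂ] π.H :=
  (show lp (fun π : 𝒢.Rep => π.H →L[ℂ] π.H) ∞ from T) π

theorem RepProd.ext {𝒢 : EtaleGroupoid X G} {S T : 𝒢.RepProd}
    (h : ∀ π, S.component π = T.component π) : S = T :=
  lp.ext (funext h)

/-- The direct sum of all bounded representations. -/
noncomputable def universalRep (𝒢 : EtaleGroupoid X G) : 𝒢.Cc →⋆ₙₐ[ℂ] 𝒢.RepProd where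
  toFun f := (⟨fun π => π.toHom f,
    memℓp_infty ⟨𝒢.INorm f, by rintro _ ⟨π, rfl⟩; exact π.norm_le f⟩⟩ :
      lp (fun π : 𝒢.Rep => π.H →L[ℂ] π.H) ∞)
  map_smul' t f := RepProd.ext fun π => map_smul π.toHom t f
  map_zero' := RepProd.ext fun π => map_zero π.toHom
  map_add' f g := RepProd.ext fun π => map_add π.toHom f g
  map_mul' f g := RepProd.ext fun π => map_mul π.toHom f g
  map_star' f := RepProd.ext fun π => map_star π.toHom f

/-- The full groupoid C*-algebra `C*(𝒢)`: the completion of `C_c(𝒢)` in the norm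
`‖f‖ = sup_π ‖π(f)‖`, `π` ranging over all bounded representations, realised as the closure of the
image of `C_c(𝒢)` in the product of these representations. -/
def FullCStar (𝒢 : EtaleGroupoid X G) : Type (u + 1) :=
  (NonUnitalStarAlgHom.range 𝒢.universalRep).topologicalClosure

noncomputable instance (𝒢 : EtaleGroupoid X G) : NonUnitalCStarAlgebra 𝒢.FullCStar :=
  haveI : IsClosed (((NonUnitalStarAlgHom.range 𝒢.universalRep).topologicalClosure :
      NonUnitalStarSubalgebra ℂ 𝒢.RepProd) : Set 𝒢.RepProd) :=
    NonUnitalStarSubalgebra.isClosed_topologicalClosure _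
  inferInstanceAs (NonUnitalCStarAlgebra
    (NonUnitalStarAlgHom.range 𝒢.universalRep).topologicalClosure)

noncomputable instance (𝒢 : EtaleGroupoid X G) : PartialOrder 𝒢.FullCStar :=
  CStarAlgebra.spectralOrder _

instance (𝒢 : EtaleGroupoid X G) : StarOrderedRing 𝒢.FullCStar :=
  CStarAlgebra.spectralOrderedRing _

/-- The canonical map `C_c(𝒢) → C*(𝒢)`. -/
noncomputable def toFullCStar (𝒢 : EtaleGroupoid X G) : 𝒢.Cc →⋆ₙₐ[ℂ] 𝒢.FullCStar :=
  NonUnitalStarAlgHom.codRestrict 𝒢.universalRep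
    (NonUnitalStarAlgHom.range 𝒢.universalRep).topologicalClosure
    fun f => NonUnitalStarSubalgebra.le_topologicalClosure _ ⟨f, rfl⟩

/-- The inclusion of `C*(𝒢)` in the product of all bounded representations. -/
noncomputable def inclusion (𝒢 : EtaleGroupoid X G) : 𝒢.FullCStar →⋆ₙₐ[ℂ] 𝒢.RepProd :=
  NonUnitalStarSubalgebraClass.subtype (NonUnitalStarAlgHom.range 𝒢.universalRep).topologicalClosure

theorem denseRange_toFullCStar (𝒢 : EtaleGroupoid X G) : DenseRange 𝒢.toFullCStar := by
  intro a
  have ha : 𝒢.inclusion a ∈ closure (Set.range 𝒢.universalRep) := a.2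
  refine closure_subtype.2 ?_
  have he : ((↑) : (NonUnitalStarAlgHom.range 𝒢.universalRep).topologicalClosure → 𝒢.RepProd) ''
      Set.range 𝒢.toFullCStar = Set.range 𝒢.universalRep := by
    ext T
    constructor
    · rintro ⟨_, ⟨f, rfl⟩, rfl⟩
      exact ⟨f, rfl⟩
    · rintro ⟨f, rfl⟩
      exact ⟨_, ⟨f, rfl⟩, rfl⟩
  rw [← he] at ha
  exact ha

theorem norm_toFullCStar_le (𝒢 : EtaleGroupoid X G) (f : 𝒢.Cc) :
    ‖𝒢.toFullCStar f‖ ≤ max 0 (𝒢.INorm f) := by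
  refine lp.norm_le_of_forall_le (le_max_left _ _) fun π => ?_
  exact (π.norm_le f).trans (le_max_right _ _)

/-- The automorphism `f ↦ e^{itc} f` of `C_c(𝒢)`. -/
noncomputable def twistCc (𝒢 : EtaleGroupoid X G) (c : 𝒢.Cocycle) (t : ℝ) :
    𝒢.Cc →⋆ₙₐ[ℂ] 𝒢.Cc where
  toFun f := Cc.mk (fun γ => Complex.exp (Complex.I * t * c γ) * f γ)
    ((Complex.continuous_exp.comp (continuous_const.mul
      (Complex.continuous_ofReal.comp c.continuous_toFun))).mul f.continuous)
    f.hasCompactSupport.mul_left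
  map_smul' a f := by
    ext γ
    simp only [Cc.mk_apply, Cc.smul_apply, MonoidHom.id_apply]
    ring
  map_zero' := by
    ext γ
    simp
  map_add' f g := by
    ext γ
    simp only [Cc.mk_apply, Cc.add_apply]
    ring
  map_mul' f g := by
    ext γ
    simp only [Cc.mk_apply, Cc.mul_apply]
    rw [mul_finsum_mem]
    refine finsum_mem_congr rfl fun η hη => ?_
    have hη' : 𝒢.r η = 𝒢.r γ := hη
    have hc : c γ = c η + c (𝒢.mul (𝒢.inv η) γ) := by
      rw [c.map_mul' _ _ ((𝒢.s_inv η).trans hη'), c.map_inv]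
      ring
    rw [hc]
    push_cast
    rw [mul_add, Complex.exp_add]
    ring
  map_star' f := by
    ext γ
    simp only [Cc.mk_apply, Cc.star_apply, map_mul, ← Complex.exp_conj, Complex.conj_I,
      Complex.conj_ofReal, c.map_inv]
    push_cast
    ring_nf

theorem twistCc_apply (𝒢 : EtaleGroupoid X G) (c : 𝒢.Cocycle) (t : ℝ) (f : 𝒢.Cc) (γ : G) :
    𝒢.twistCc c t f γ = Complex.exp (Complex.I * t * c γ) * f γ := rfl

theorem norm_twistCc_apply (𝒢 : EtaleGroupoid X G) (c : 𝒢.Cocycle) (t : ℝ) (f : 𝒢.Cc) (γ : G) :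
    ‖𝒢.twistCc c t f γ‖ = ‖f γ‖ := by
  rw [twistCc_apply, norm_mul]
  have : Complex.I * t * c γ = ((t * c γ : ℝ) : ℂ) * Complex.I := by push_cast; ring
  rw [this, Complex.norm_exp_ofReal_mul_I, one_mul]

/-- The bounded representation `π ∘ (f ↦ e^{itc} f)`. -/
@[reducible] noncomputable def Rep.twist {𝒢 : EtaleGroupoid X G} (π : 𝒢.Rep) (c : 𝒢.Cocycle)
    (t : ℝ) : 𝒢.Rep where
  H := π.H
  toHom := π.toHom.comp (𝒢.twistCc c t)
  norm_le f := by
    refine (π.norm_le (𝒢.twistCc c t f)).trans (le_of_eq ?_)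
    simp only [INorm, norm_twistCc_apply]

/-- Reindexing the product of all bounded representations by `π ↦ π ∘ (f ↦ e^{itc} f)`. -/
noncomputable def twistProd (𝒢 : EtaleGroupoid X G) (c : 𝒢.Cocycle) (t : ℝ) :
    𝒢.RepProd →⋆ₙₐ[ℂ] 𝒢.RepProd where
  toFun T := (⟨fun π => T.component (π.twist c t),
    memℓp_infty ⟨‖T‖, by rintro _ ⟨π, rfl⟩; exact lp.norm_apply_le_norm (by simp) _ _⟩⟩ :
      lp (fun π : 𝒢.Rep => π.H →L[ℂ] π.H) ∞)
  map_smul' _ _ := rfl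
  map_zero' := rfl
  map_add' _ _ := rfl
  map_mul' _ _ := rfl
  map_star' _ := rfl

theorem twistProd_universalRep (𝒢 : EtaleGroupoid X G) (c : 𝒢.Cocycle) (t : ℝ) (f : 𝒢.Cc) :
    𝒢.twistProd c t (𝒢.universalRep f) = 𝒢.universalRep (𝒢.twistCc c t f) := rfl

theorem twistProd_mem (𝒢 : EtaleGroupoid X G) (c : 𝒢.Cocycle) (t : ℝ) (a : 𝒢.FullCStar) :
    𝒢.twistProd c t (𝒢.inclusion a) ∈
      (NonUnitalStarAlgHom.range 𝒢.universalRep).topologicalClosure := by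
  have hcont : Continuous (𝒢.twistProd c t) :=
    AddMonoidHomClass.continuous_of_bound (𝒢.twistProd c t) 1 fun T => by
      rw [one_mul]
      exact NonUnitalStarAlgHom.norm_apply_le (𝒢.twistProd c t) T
  refine map_mem_closure hcont (s := Set.range 𝒢.universalRep) a.2 ?_
  rintro _ ⟨f, rfl⟩
  exact ⟨𝒢.twistCc c t f, rfl⟩

/-- The endomorphism of `C*(𝒢)` extending `f ↦ e^{itc} f`. -/
noncomputable def timeHom (𝒢 : EtaleGroupoid X G) (c : 𝒢.Cocycle) (t : ℝ) :
    𝒢.FullCStar →⋆ₙₐ[ℂ] 𝒢.FullCStar :=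
  NonUnitalStarAlgHom.codRestrict ((𝒢.twistProd c t).comp 𝒢.inclusion)
    (NonUnitalStarAlgHom.range 𝒢.universalRep).topologicalClosure (𝒢.twistProd_mem c t)

theorem timeHom_toFullCStar (𝒢 : EtaleGroupoid X G) (c : 𝒢.Cocycle) (t : ℝ) (f : 𝒢.Cc) :
    𝒢.timeHom c t (𝒢.toFullCStar f) = 𝒢.toFullCStar (𝒢.twistCc c t f) := rfl

theorem norm_timeHom_le (𝒢 : EtaleGroupoid X G) (c : 𝒢.Cocycle) (t : ℝ) (a : 𝒢.FullCStar) :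
    ‖𝒢.timeHom c t a‖ ≤ ‖a‖ :=
  NonUnitalStarAlgHom.norm_apply_le (𝒢.timeHom c t) a

theorem continuous_timeHom (𝒢 : EtaleGroupoid X G) (c : 𝒢.Cocycle) (t : ℝ) :
    Continuous (𝒢.timeHom c t) :=
  AddMonoidHomClass.continuous_of_bound (𝒢.timeHom c t) 1 fun a => by
    rw [one_mul]
    exact 𝒢.norm_timeHom_le c t a

theorem timeHom_add (𝒢 : EtaleGroupoid X G) (c : 𝒢.Cocycle) (t₁ t₂ : ℝ) (a : 𝒢.FullCStar) :
    𝒢.timeHom c (t₁ + t₂) a = 𝒢.timeHom c t₁ (𝒢.timeHom c t₂ a) := by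
  refine 𝒢.denseRange_toFullCStar.induction_on a (isClosed_eq (𝒢.continuous_timeHom c _)
    ((𝒢.continuous_timeHom c _).comp (𝒢.continuous_timeHom c _))) fun f => ?_
  simp only [timeHom_toFullCStar]
  congr 1
  ext γ
  simp only [twistCc_apply]
  rw [← _root_.mul_assoc, ← Complex.exp_add]
  push_cast
  ring_nf

theorem timeHom_zero (𝒢 : EtaleGroupoid X G) (c : 𝒢.Cocycle) (a : 𝒢.FullCStar) :
    𝒢.timeHom c 0 a = a := by
  refine 𝒢.denseRange_toFullCStar.induction_on a (isClosed_eq (𝒢.continuous_timeHom c _)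
    continuous_id) fun f => ?_
  rw [timeHom_toFullCStar]
  congr 1
  ext γ
  simp [twistCc_apply]

theorem continuous_timeHom_toFullCStar (𝒢 : EtaleGroupoid X G) (c : 𝒢.Cocycle) (f : 𝒢.Cc) :
    Continuous fun t => 𝒢.timeHom c t (𝒢.toFullCStar f) := by
  obtain ⟨N, hN⟩ := 𝒢.iNorm_le f.hasCompactSupport.isCompact
  obtain ⟨C, hC⟩ := f.hasCompactSupport.exists_bound_of_continuous f.continuous
  obtain ⟨M, hM⟩ := f.hasCompactSupport.isCompact.exists_bound_of_continuousOn
    c.continuous_toFun.continuousOn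
  have hlip : LipschitzWith (Real.toNNReal (N * (|M| * |C|))) fun t =>
      𝒢.timeHom c t (𝒢.toFullCStar f) := by
    refine LipschitzWith.of_dist_le_mul fun t t₀ => ?_
    rw [Real.coe_toNNReal _ (by positivity), dist_eq_norm, timeHom_toFullCStar,
      timeHom_toFullCStar, ← map_sub]
    have h0 : 0 ≤ |M| * |C| * dist t t₀ := by positivity
    have hb : 𝒢.INorm (𝒢.twistCc c t f - 𝒢.twistCc c t₀ f) ≤ N * (|M| * |C| * dist t t₀) := by
      refine hN _ (fun η hη => ?_) _ h0 fun η => ?_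
      · simp [twistCc_apply, image_eq_zero_of_notMem_tsupport hη]
      · by_cases hη : η ∈ tsupport f
        swap
        · simpa [twistCc_apply, image_eq_zero_of_notMem_tsupport hη] using h0
        have he : 𝒢.twistCc c t f η - 𝒢.twistCc c t₀ f η =
            Complex.exp (Complex.I * t₀ * c η) *
              ((Complex.exp (Complex.I * ((t - t₀) * c η : ℝ)) - 1) * f η) := by
          have : Complex.I * t * c η =
              Complex.I * t₀ * c η + Complex.I * ((t - t₀) * c η : ℝ) := by
            push_cast
            ring
          rw [twistCc_apply, twistCc_apply, this, Complex.exp_add]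
          ring
        have h1 : ‖Complex.exp (Complex.I * t₀ * c η)‖ = 1 := by
          have : Complex.I * t₀ * c η = ((t₀ * c η : ℝ) : ℂ) * Complex.I := by push_cast; ring
          rw [this, Complex.norm_exp_ofReal_mul_I]
        rw [Cc.sub_apply, he, norm_mul, h1, one_mul, norm_mul]
        have h2 : ‖Complex.exp (Complex.I * ((t - t₀) * c η : ℝ)) - 1‖ ≤ dist t t₀ * |M| := by
          refine (Real.norm_exp_I_mul_ofReal_sub_one_le).trans ?_
          rw [norm_mul, ← dist_eq_norm]
          gcongr
          exact (hM η hη).trans (le_abs_self M)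
        calc _ ≤ dist t t₀ * |M| * |C| := by
              gcongr
              exact (hC η).trans (le_abs_self C)
          _ = |M| * |C| * dist t t₀ := by ring
    refine (𝒢.norm_toFullCStar_le _).trans (max_le (by positivity) (hb.trans (le_of_eq ?_)))
    ring
  exact hlip.continuous

theorem continuous_timeHom_apply (𝒢 : EtaleGroupoid X G) (c : 𝒢.Cocycle) (a : 𝒢.FullCStar) :
    Continuous fun t => 𝒢.timeHom c t a := by
  rw [Metric.continuous_iff]
  intro t₀ ε hε
  obtain ⟨f, hf⟩ := Metric.denseRange_iff.1 𝒢.denseRange_toFullCStar a (ε / 3) (by positivity)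
  obtain ⟨δ, hδ, h⟩ := Metric.continuous_iff.1 (𝒢.continuous_timeHom_toFullCStar c f) t₀ (ε / 3)
    (by positivity)
  refine ⟨δ, hδ, fun t ht => ?_⟩
  have key : ∀ s, dist (𝒢.timeHom c s a) (𝒢.timeHom c s (𝒢.toFullCStar f)) < ε / 3 := fun s => by
    rw [dist_eq_norm, ← map_sub]
    refine (𝒢.norm_timeHom_le c s _).trans_lt ?_
    rwa [← dist_eq_norm]
  have h1 := key t
  have h2 := key t₀
  have h3 := h t ht
  rw [dist_comm] at h2
  calc _ ≤ _ := dist_triangle4 _ (𝒢.timeHom c t (𝒢.toFullCStar f))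
        (𝒢.timeHom c t₀ (𝒢.toFullCStar f)) _
    _ < ε := by linarith

/-- The time evolution `σ^c` on `C*(𝒢)` given by `σ^c_t(f) = e^{itc} f` for `f` in `C_c(𝒢)`. -/
noncomputable def timeEvolution (𝒢 : EtaleGroupoid X G) (c : 𝒢.Cocycle) :
    TimeEvolution 𝒢.FullCStar where
  aut t := StarAlgEquiv.ofNonUnitalStarAlgHom (𝒢.timeHom c t) (𝒢.timeHom c (-t))
    (NonUnitalStarAlgHom.ext fun a => by
      show 𝒢.timeHom c (-t) (𝒢.timeHom c t a) = a
      rw [← timeHom_add, neg_add_cancel, timeHom_zero])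
    (NonUnitalStarAlgHom.ext fun a => by
      show 𝒢.timeHom c t (𝒢.timeHom c (-t) a) = a
      rw [← timeHom_add, add_neg_cancel, timeHom_zero])
  aut_add t₁ t₂ a := 𝒢.timeHom_add c t₁ t₂ a
  continuous_aut a := 𝒢.continuous_timeHom_apply c a

/-- Restriction of functions in `C_c(𝒢)` to the unit space. -/
noncomputable def restrictUnits (𝒢 : EtaleGroupoid X G) : 𝒢.Cc →ₗ[ℂ] C₀(X, ℂ) where
  toFun f := ⟨⟨fun x => f (𝒢.unit x), f.continuous.comp 𝒢.continuous_unit⟩, by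
    have he : Topology.IsClosedEmbedding 𝒢.unit :=
      Function.LeftInverse.isClosedEmbedding 𝒢.s_unit 𝒢.isLocalHomeomorph_s.continuous
        𝒢.continuous_unit
    exact (f.hasCompactSupport.comp_isClosedEmbedding he).is_zero_at_infty⟩
  map_add' _ _ := rfl
  map_smul' _ _ := rfl

/-- The canonical conditional expectation `Φ : C*(𝒢) → C₀(X)`: the continuous linear extension of
the restriction map `C_c(𝒢) → C₀(X)`. -/
noncomputable def condExp (𝒢 : EtaleGroupoid X G) : 𝒢.FullCStar →L[ℂ] C₀(X, ℂ) :=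
  𝒢.restrictUnits.extendOfNorm
    ({ toFun := 𝒢.toFullCStar
       map_add' := map_add 𝒢.toFullCStar
       map_smul' := map_smul 𝒢.toFullCStar } : 𝒢.Cc →ₗ[ℂ] 𝒢.FullCStar)

end FullAlgebra

section Orbits

variable {X G : Type u} [TopologicalSpace X] [TopologicalSpace G]

/-- The orbit `𝒢x = r(s⁻¹(x))`. -/
def orbit (𝒢 : EtaleGroupoid X G) (x : X) : Set X := 𝒢.r '' {γ | 𝒢.s γ = x}

theorem r_mem_orbit (𝒢 : EtaleGroupoid X G) {x : X} (z : 𝒢.orbit x) {γ : G} (h : 𝒢.s γ = z) :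
    𝒢.r γ ∈ 𝒢.orbit x := by
  obtain ⟨η, hη, hz⟩ := z.2
  have hc : 𝒢.s γ = 𝒢.r η := h.trans hz.symm
  exact ⟨𝒢.mul γ η, (𝒢.s_mul γ η hc).trans hη, 𝒢.r_mul γ η hc⟩

/-- The set `𝒢_x^y` of arrows with source `x` and range `y`. -/
def arrows (𝒢 : EtaleGroupoid X G) (x y : X) : Set G := {γ | 𝒢.s γ = x ∧ 𝒢.r γ = y}

/-- The orbit of `x` is consistent: `c` vanishes on the isotropy group `𝒢_x^x`. -/
def IsConsistent (𝒢 : EtaleGroupoid X G) (c : 𝒢.Cocycle) (x : X) : Prop :=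
  ∀ γ ∈ 𝒢.arrows x x, c γ = 0

/-- The function `l_x(z) = e^{-c(γ)}`, where `γ ∈ 𝒢_x^z`; for a consistent orbit the value does not
depend on the choice of `γ`. -/
noncomputable def orbitWeight (𝒢 : EtaleGroupoid X G) (c : 𝒢.Cocycle) (x : X) (z : 𝒢.orbit x) : ℝ :=
  Real.exp (-c z.2.choose)

/-- The orbit of `x` is `β`-summable: it is consistent and `∑_z l_x(z)^β < ∞`. -/
def IsSummableOrbit (𝒢 : EtaleGroupoid X G) (c : 𝒢.Cocycle) (β : ℝ) (x : X) : Prop :=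
  𝒢.IsConsistent c x ∧ Summable fun z : 𝒢.orbit x => 𝒢.orbitWeight c x z ^ β

/-- The abscissa `β_O`: the infimum in `[-∞, ∞]` of the real `b` with `∑_z l_x(z)^b < ∞`. -/
noncomputable def orbitAbscissa (𝒢 : EtaleGroupoid X G) (c : 𝒢.Cocycle) (x : X) : EReal :=
  sInf ((fun b : ℝ => (b : EReal)) '' {b | Summable fun z : 𝒢.orbit x => 𝒢.orbitWeight c x z ^ b})

/-- The function `Z_O(s) = e^{sλ₁} ∑_z l_x(z)^s`. -/
noncomputable def orbitZeta (𝒢 : EtaleGroupoid X G) (c : 𝒢.Cocycle) (x : X) (lam₁ : ℝ) (s : ℂ) : ℂ :=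
  Complex.exp (s * lam₁) * ∑' z : 𝒢.orbit x, (𝒢.orbitWeight c x z : ℂ) ^ s

section Measure

variable [MeasurableSpace X]

/-- The measure `∑_z l_x(z)^β δ_z`. -/
noncomputable def orbitSumMeasure (𝒢 : EtaleGroupoid X G) (c : 𝒢.Cocycle) (β : ℝ) (x : X) :
    MeasureTheory.Measure X :=
  MeasureTheory.Measure.sum fun z : 𝒢.orbit x =>
    ENNReal.ofReal (𝒢.orbitWeight c x z ^ β) • MeasureTheory.Measure.dirac (z : X)

/-- The measure `m_O = (∑_z l_x(z)^β)⁻¹ ∑_z l_x(z)^β δ_z`. -/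
noncomputable def orbitMeasure (𝒢 : EtaleGroupoid X G) (c : 𝒢.Cocycle) (β : ℝ) (x : X) :
    MeasureTheory.Measure X :=
  (∑' z : 𝒢.orbit x, ENNReal.ofReal (𝒢.orbitWeight c x z ^ β))⁻¹ • 𝒢.orbitSumMeasure c β x

instance (𝒢 : EtaleGroupoid X G) (c : 𝒢.Cocycle) (β : ℝ) (x : X) :
    MeasureTheory.IsFiniteMeasure (𝒢.orbitMeasure c β x) := by
  refine ⟨lt_of_le_of_lt ?_ ENNReal.one_lt_top⟩
  have h : 𝒢.orbitSumMeasure c β x Set.univ =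
      ∑' z : 𝒢.orbit x, ENNReal.ofReal (𝒢.orbitWeight c x z ^ β) := by
    simp [orbitSumMeasure, MeasureTheory.Measure.sum_apply]
  rw [orbitMeasure, MeasureTheory.Measure.smul_apply, h, smul_eq_mul]
  exact ENNReal.inv_mul_le_one _

/-- Integration of functions in `C₀(X)` against a finite Borel measure. -/
noncomputable def _root_.integralC₀ [BorelSpace X] (m : MeasureTheory.Measure X)
    [MeasureTheory.IsFiniteMeasure m] : C₀(X, ℂ) →L[ℂ] ℂ :=
  LinearMap.mkContinuous
    { toFun := fun f => ∫ y, f y ∂m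
      map_add' := fun f g =>
        MeasureTheory.integral_add (f.toBCF.integrable m) (g.toBCF.integrable m)
      map_smul' := fun t f => MeasureTheory.integral_const_mul t _ }
    (m.real Set.univ) fun f => by
      rw [mul_comm]
      exact MeasureTheory.norm_integral_le_of_norm_le_const
        (Filter.Eventually.of_forall fun y => f.toBCF.norm_coe_le_norm y)

/-- The functional `φ_O = m_O ∘ Φ` on `C*(𝒢)`. -/
noncomputable def orbitState [T2Space G] [BorelSpace X] (𝒢 : EtaleGroupoid X G) (c : 𝒢.Cocycle)
    (β : ℝ) (x : X) : 𝒢.FullCStar →L[ℂ] ℂ :=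
  (integralC₀ (𝒢.orbitMeasure c β x)).comp 𝒢.condExp

end Measure

/-- `π` is the orbit representation of `C*(𝒢)` on `ℓ²(𝒢x)`:
`π(f) δ_z = ∑_{γ ∈ 𝒢_z} f(γ) δ_{r(γ)}` for all `f` in `C_c(𝒢)` and all `z` in the orbit. -/
def IsOrbitRep [T2Space G] (𝒢 : EtaleGroupoid X G) (x : X)
    (π : 𝒢.FullCStar →⋆ₙₐ[ℂ]
      (lp (fun _ : 𝒢.orbit x => ℂ) 2 →L[ℂ] lp (fun _ : 𝒢.orbit x => ℂ) 2)) : Prop :=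
  ∀ (f : 𝒢.Cc) (z : 𝒢.orbit x), π (𝒢.toFullCStar f) (delta z) =
    ∑ᶠ γ : {γ : G // 𝒢.s γ = z}, f γ • delta (⟨𝒢.r γ, 𝒢.r_mem_orbit z γ.2⟩ : 𝒢.orbit x)

end Orbits

end EtaleGroupoid

/-! ### Parseval identities, Hilbert–Schmidt sums, and traces in different bases. -/

section HilbertBases

variable {ι κ : Type*} {H H' : Type*} [NormedAddCommGroup H] [InnerProductSpace ℂ H]
  [NormedAddCommGroup H'] [InnerProductSpace ℂ H']

/-! As the isotropy of `x` is trivial, `z ↦ γ z` identifies the orbit with the source fibre of `x`,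
and `π_O` becomes the regular representation there: the entry of `f` at `(w, z)` is `f(γ_w γ_z⁻¹)`
(`regular`, `orbitEquiv`, `isOrbitRep_iff`). Write `h(z) = c(γ_z) - λ₁`. Three facts about this
matrix carry the theorem. Its diagonal consists of values on units, so `φ_O = ∑ q_z ⟨δ_z, π_O(·)
δ_z⟩` with `q_z` proportional to `e^{-βh(z)}` (`isDiagonalFunctional_orbitState`). Since `c(γ_w
γ_z⁻¹) = h(w) - h(z)`, the time evolution is implemented by `e^{itH}` (`isDiagonalEvolution_orbit`).
Bump functions on small bisections around `γ_w γ_z⁻¹` form bounded nets of analytic elements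
converging strongly to the matrix units (`hasAnalyticMatrixUnits_orbit`). What remains is operator
theory of such "diagonal" states, with no groupoid in it.

The matrix units make `π_O` irreducible with scalar commutant. They also make `Ω = ∑ √q_z δ_z ⊗ δ_z`
cyclic for a multiple of `π_O`, so that multiple is the GNS representation of `φ_O`, and it
generates a type I factor (`isTypeIFactorState_of_diagonal`). The KMS identity is the Gibbs
computation with matrix entries (`IsDiagonalEvolution.kms`). For extremality, a KMS state dominated
by a multiple of `φ_O` comes from an operator in the commutant of the multiple, that is, from a
matrix of scalars. The KMS identity evaluated on matrix units makes this matrix a multiple of the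
identity (`eq_of_isKMSState_of_le`).

For the partition function, the trace formula of an arbitrary admissible triple yields a nonzero
intertwiner, hence a unitary, between `π_O` and the given representation. Evaluating the formula on
matrix units then shows that `ρ` is diagonal with eigenvalues proportional to `q_z`
(`exists_eigenbasis_of_trace`), and `‖ρ‖ = 1` fixes the factor. Thus `ρ^{s/β}` has eigenvalues
`e^{-sh(z)}`. Summability leaves only finitely many `z` with `c(γ_z) ≤ t`; this gives the minimum,
the listing, and the regrouping into a Dirichlet series. -/

theorem HilbertBasis.ext_clm (b : HilbertBasis ι ℂ H) {S T : H →L[ℂ] H'}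
    (h : ∀ i, S (b i) = T (b i)) : S = T := by
  ext v
  have hS := (b.hasSum_repr v).mapL S
  have hT := (b.hasSum_repr v).mapL T
  simp only [map_smul, h] at hS hT
  exact hS.unique hT

theorem HilbertBasis.ext_inner (b : HilbertBasis ι ℂ H) {v v' : H}
    (h : ∀ i, inner ℂ (b i) v = inner ℂ (b i) v') : v = v' := by
  apply b.repr.injective
  ext i
  rw [b.repr_apply_apply, b.repr_apply_apply, h]

theorem HilbertBasis.hasSum_norm_inner_sq (b : HilbertBasis ι ℂ H) (v : H) :
    HasSum (fun i => ‖inner ℂ (b i) v‖ ^ 2) (‖v‖ ^ 2) := by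
  have h := Complex.hasSum_re (b.hasSum_inner_mul_inner v v)
  have h2 : (inner ℂ v v).re = ‖v‖ ^ 2 := by
    rw [inner_self_eq_norm_sq_to_K]
    norm_cast
  rw [h2] at h
  refine h.congr_fun fun i => ?_
  rw [← inner_conj_symm v (b i), ← Complex.normSq_eq_conj_mul_self, Complex.normSq_eq_norm_sq,
    Complex.ofReal_re]

/-- Hölder with exponents 2 and 2, applied to the coordinate sequences. The bound makes the double
sums in `hasSum_inner_of_diagonal` and `IsDiagonalEvolution.kms` absolutely convergent. -/
theorem HilbertBasis.summable_norm_inner_mul_inner (b : HilbertBasis ι ℂ H) (x y : H) :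
    (Summable fun i => ‖inner ℂ x (b i)‖ * ‖inner ℂ (b i) y‖) ∧
      ∑' i, ‖inner ℂ x (b i)‖ * ‖inner ℂ (b i) y‖ ≤ ‖x‖ * ‖y‖ := by
  have hpq : (2 : ℝ≥0∞).toReal.HolderConjugate (2 : ℝ≥0∞).toReal := by
    simpa using Real.HolderConjugate.two_two
  have h := lp.tsum_mul_le_mul_norm hpq (b.repr x) (b.repr y)
  simpa only [b.repr_apply_apply, LinearIsometryEquiv.norm_map, norm_inner_symm] using h

theorem summable_prod_of_hasSum {f : ι × κ → ℝ} {g : ι → ℝ} (hf : ∀ p, 0 ≤ f p)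
    (h : ∀ i, HasSum (fun j => f (i, j)) (g i)) (hg : Summable g) : Summable f :=
  (summable_prod_of_nonneg hf).2
    ⟨fun i => (h i).summable, hg.congr fun i => (h i).tsum_eq.symm⟩

theorem mul_le_sq_add_sq (x y : ℝ) : x * y ≤ x ^ 2 + y ^ 2 := by
  nlinarith [sq_nonneg (x - y), sq_nonneg x, sq_nonneg y]

theorem summable_hilbertSchmidt_prod (b : HilbertBasis ι ℂ H) (f : HilbertBasis κ ℂ H')
    (X : H →L[ℂ] H') (hX : Summable fun i => ‖X (b i)‖ ^ 2) :
    Summable fun p : ι × κ => ‖inner ℂ (f p.2) (X (b p.1))‖ ^ 2 := by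
  refine summable_prod_of_hasSum (g := fun i => ‖X (b i)‖ ^ 2) (fun _ => sq_nonneg _)
    (fun i => ?_) hX
  exact f.hasSum_norm_inner_sq (X (b i))

variable [CompleteSpace H] [CompleteSpace H']

/-- Expand each inner product in the second basis and exchange the sums; the Hilbert–Schmidt
conditions and `xy ≤ x² + y²` give absolute summability. This is the cyclicity of the trace needed
to split a trace class operator into two Hilbert–Schmidt factors. -/
theorem tsum_hilbertSchmidt_inner (b : HilbertBasis ι ℂ H) (f : HilbertBasis κ ℂ H')
    (X Y : H →L[ℂ] H') (hX : Summable fun i => ‖X (b i)‖ ^ 2)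
    (hY : Summable fun i => ‖Y (b i)‖ ^ 2) :
    ∑' i, inner ℂ (X (b i)) (Y (b i)) = ∑' j, inner ℂ (Y.adjoint (f j)) (X.adjoint (f j)) := by
  have hs : Summable fun p : ι × κ =>
      inner ℂ (X (b p.1)) (f p.2) * inner ℂ (f p.2) (Y (b p.1)) := by
    refine Summable.of_norm_bounded ((summable_hilbertSchmidt_prod b f X hX).add
      (summable_hilbertSchmidt_prod b f Y hY)) fun p => ?_
    rw [norm_mul, norm_inner_symm]
    exact mul_le_sq_add_sq _ _
  calc _ = ∑' i, ∑' j, inner ℂ (X (b i)) (f j) * inner ℂ (f j) (Y (b i)) :=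
        tsum_congr fun i => (f.tsum_inner_mul_inner _ _).symm
    _ = ∑' j, ∑' i, inner ℂ (X (b i)) (f j) * inner ℂ (f j) (Y (b i)) :=
        (Summable.tsum_comm (f := fun i j => inner ℂ (X (b i)) (f j) * inner ℂ (f j) (Y (b i)))
          hs).symm
    _ = _ := by
        refine tsum_congr fun j => ?_
        rw [← b.tsum_inner_mul_inner]
        refine tsum_congr fun i => ?_
        rw [ContinuousLinearMap.adjoint_inner_left, ContinuousLinearMap.adjoint_inner_right,
          mul_comm]

omit [CompleteSpace H] [CompleteSpace H'] in
/-- The trace of an operator that is, in one Hilbert basis, a summable diagonal followed by a bounded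
operator, may be computed in any Hilbert basis. -/
theorem hasSum_inner_of_diagonal (b : HilbertBasis ι ℂ H) (e : HilbertBasis κ ℂ H)
    (A T : H →L[ℂ] H) (d : ι → ℂ) (hd : Summable fun i => ‖d i‖)
    (hT : ∀ i, T (b i) = d i • A (b i)) :
    HasSum (fun j => inner ℂ (e j) (T (e j))) (∑' i, d i * inner ℂ (b i) (A (b i))) := by
  set F : ι × κ → ℂ := fun p =>
    d p.1 * (inner ℂ (b p.1) (e p.2) * inner ℂ (e p.2) (A (b p.1))) with hF
  have hs : Summable F := by
    apply Summable.of_norm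
    rw [summable_prod_of_nonneg fun _ => norm_nonneg _]
    simp only [hF, norm_mul, tsum_mul_left]
    refine ⟨fun i => (e.summable_norm_inner_mul_inner _ _).1.mul_left _, ?_⟩
    refine Summable.of_nonneg_of_le (fun i => by positivity) (fun i => ?_) (hd.mul_right ‖A‖)
    gcongr
    refine (e.summable_norm_inner_mul_inner _ _).2.trans ?_
    rw [b.orthonormal.1, one_mul]
    simpa [b.orthonormal.1] using A.le_opNorm (b i)
  -- Summing over `j` first uses completeness of `e`; summing over `i` first expands `e j` in the
  -- basis `b`, on which `T` is known.
  have h1 : ∀ i, HasSum (fun j => F (i, j)) (d i * inner ℂ (b i) (A (b i))) := fun i =>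
    (e.hasSum_inner_mul_inner _ _).mul_left _
  have h2 : ∀ j, HasSum (fun i => F (i, j)) (inner ℂ (e j) (T (e j))) := fun j => by
    have h := (b.hasSum_repr (e j)).mapL ((innerSL ℂ (e j)).comp T)
    simp only [map_smul, ContinuousLinearMap.comp_apply, hT, innerSL_apply_apply,
      b.repr_apply_apply, smul_eq_mul] at h
    refine h.congr_fun fun i => ?_
    simp only [hF]
    ring
  have h3 := hs.hasSum.prod_fiberwise h1
  have h4 := hs.prod_symm.hasSum.prod_fiberwise h2
  rw [h3.tsum_eq]
  convert h4 using 1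
  exact ((Equiv.prodComm κ ι).tsum_eq F).symm

end HilbertBases

/-! ### Eigenvectors under functional calculus, and traces of diagonal operators. -/

section Operators

variable {ι : Type*} {H : Type*} [NormedAddCommGroup H] [InnerProductSpace ℂ H] [CompleteSpace H]

/-- The functions `f` on the spectrum for which `v` is an eigenvector of `f(T)` with eigenvalue
`f(μ)` form a closed algebra containing the constants, the coordinate and its conjugate. By
Stone–Weierstrass these are all continuous functions. The conjugate coordinate is the reason for the
hypothesis on `star T`. -/
theorem cfc_apply_eigenvector {T : H →L[ℂ] H} (hT : IsStarNormal T) {v : H} {μ : ℂ}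
    (hv : T v = μ • v) (hv' : star T v = conj μ • v) (hμ : μ ∈ spectrum ℂ T) {g : ℂ → ℂ}
    (hg : ContinuousOn g (spectrum ℂ T)) : cfc g T v = g μ • v := by
  rw [cfc_apply g T hT hg]
  have key : ∀ f : C(spectrum ℂ T, ℂ), cfcHom hT f v = f ⟨μ, hμ⟩ • v := by
    intro f
    refine ContinuousMap.induction_on_of_compact
      (p := fun f => cfcHom hT f v = f ⟨μ, hμ⟩ • v) (fun r => ?_) ?_ ?_ ?_ ?_ ?_ f
    · have : (ContinuousMap.const (spectrum ℂ T) r) = algebraMap ℂ C(spectrum ℂ T, ℂ) r := rfl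
      rw [this, AlgHomClass.commutes]
      simp [Algebra.algebraMap_eq_smul_one]
    · rw [cfcHom_id]
      simpa using hv
    · rw [map_star, cfcHom_id]
      simpa using hv'
    · intro f g hf hg
      rw [map_add, add_apply, hf, hg, ContinuousMap.add_apply, add_smul]
    · intro f g hf hg
      rw [map_mul, mul_apply_eq_comp, hg, map_smul, hf, smul_smul,
        ContinuousMap.mul_apply, mul_comm]
    · intro f hf
      have hcl : IsClosed {f : C(spectrum ℂ T, ℂ) | cfcHom hT f v = f ⟨μ, hμ⟩ • v} := by
        refine isClosed_eq ?_ ?_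
        · exact (ContinuousLinearMap.apply ℂ H v).continuous.comp (cfcHom_continuous hT)
        · exact (ContinuousEvalConst.continuous_eval_const _).smul continuous_const
      exact hcl.closure_subset (mem_closure_iff_frequently.2 hf)
  rw [key]
  rfl

omit [CompleteSpace H] in
theorem mem_spectrum_of_eigenvector {T : H →L[ℂ] H} {v : H} (hv0 : v ≠ 0) {μ : ℂ}
    (hv : T v = μ • v) : μ ∈ spectrum ℂ T := by
  rw [spectrum.mem_iff]
  intro hu
  obtain ⟨S, hS⟩ := hu.exists_left_inv
  have h : S ((algebraMap ℂ (H →L[ℂ] H) μ - T) v) = v := by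
    rw [← mul_apply_eq_comp, hS, one_apply_eq_self]
  have h0 : (algebraMap ℂ (H →L[ℂ] H) μ - T) v = 0 := by
    simp [Algebra.algebraMap_eq_smul_one, hv]
  rw [h0, map_zero] at h
  exact hv0 h.symm

omit [CompleteSpace H] in
-- For `k > 0` the vector `u = Rv - kv` satisfies `Ru = -ku`, which positivity of `R` allows only if
-- `u = 0`; for `k = 0`, `‖Rv‖² = ⟨v, R²v⟩ = 0`. It is applied to `|T|`, whose square is `T*T`.
theorem apply_eq_smul_of_sq {R : H →L[ℂ] H} (hR : R.IsPositive) {v : H} {k : ℝ} (hk : 0 ≤ k)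
    (h : R (R v) = ((k ^ 2 : ℝ) : ℂ) • v) : R v = (k : ℂ) • v := by
  rcases hk.eq_or_lt with rfl | hk
  · have h1 : inner ℂ (R v) (R v) = 0 := by
      rw [hR.isSymmetric.apply_clm v (R v), h]
      simp
    simpa using h1
  · set u := R v - (k : ℂ) • v with hu
    have h1 : R u = -(k : ℂ) • u := by
      rw [hu, map_sub, map_smul, h]
      push_cast
      module
    have h2 := hR.re_inner_nonneg_left u
    rw [h1, inner_smul_left] at h2
    have h3 : RCLike.re (conj (-(k : ℂ)) * inner ℂ u u) = -k * ‖u‖ ^ 2 := by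
      rw [← Complex.ofReal_neg, Complex.conj_ofReal, inner_self_eq_norm_sq_to_K]
      simp [← Complex.ofReal_pow]
    rw [h3] at h2
    have h4 : ‖u‖ ^ 2 = 0 := le_antisymm (by nlinarith [sq_nonneg ‖u‖]) (sq_nonneg _)
    have h5 : u = 0 := by simpa using h4
    exact sub_eq_zero.1 h5

theorem abs_apply_eigenvector {T : H →L[ℂ] H} {v : H} {μ : ℂ}
    (h : (star T * T) v = ((‖μ‖ ^ 2 : ℝ) : ℂ) • v) : CFC.abs T v = (‖μ‖ : ℂ) • v := by
  refine apply_eq_smul_of_sq ((ContinuousLinearMap.nonneg_iff_isPositive _).1 (CFC.abs_nonneg T))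
    (norm_nonneg μ) ?_
  rw [← h, ← CFC.abs_mul_abs]
  rfl

theorem star_apply_of_diagonal (b : HilbertBasis ι ℂ H) {T : H →L[ℂ] H} {d : ι → ℂ}
    (hT : ∀ i, T (b i) = d i • b i) (i : ι) : star T (b i) = conj (d i) • b i := by
  classical
  refine b.ext_inner fun j => ?_
  rw [ContinuousLinearMap.star_eq_adjoint, ContinuousLinearMap.adjoint_inner_right, hT,
    inner_smul_left, inner_smul_right, orthonormal_iff_ite.1 b.orthonormal]
  split_ifs with h
  · rw [h]
  · simp

/-- In the basis `b` the operator `|T|` is diagonal with entries `‖d i‖`, so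
`hasSum_inner_of_diagonal` with `A = 1` evaluates both defining sums in the chosen standard basis.
-/
theorem isTraceClass_of_diagonal (b : HilbertBasis ι ℂ H) {T : H →L[ℂ] H} {d : ι → ℂ}
    (hT : ∀ i, T (b i) = d i • b i) (hd : Summable fun i => ‖d i‖) :
    IsTraceClass T ∧ operatorTrace T = ∑' i, d i := by
  have hb : ∀ i, inner ℂ (b i) (b i) = 1 := fun i => by
    rw [inner_self_eq_norm_sq_to_K, b.orthonormal.1]
    simp
  constructor
  · have habs : ∀ i, CFC.abs T (b i) = (‖d i‖ : ℂ) • b i := fun i => by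
      refine abs_apply_eigenvector ?_
      rw [mul_apply_eq_comp, hT, map_smul, star_apply_of_diagonal b hT, smul_smul,
        Complex.mul_conj, Complex.normSq_eq_norm_sq]
    have h := hasSum_inner_of_diagonal b (stdBasis H) 1 (CFC.abs T) (fun i => (‖d i‖ : ℂ))
      (by simpa using hd) (by simpa using habs)
    exact (Complex.hasSum_re h).summable
  · have h := hasSum_inner_of_diagonal b (stdBasis H) 1 T d hd (by simpa using hT)
    rw [operatorTrace, h.tsum_eq]
    simp only [one_apply_eq_self, hb, mul_one]

/-- `Tr(Bρ) = ∑ ⟨√ρ e_i, B √ρ e_i⟩` for a positive trace class operator `ρ`. -/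
theorem operatorTrace_mul_eq {ρ : H →L[ℂ] H} (hρ : ρ.IsPositive) (htr : IsTraceClass ρ) :
    ∃ S : H →L[ℂ] H, S.adjoint = S ∧ S * S = ρ ∧ (Summable fun i => ‖S (stdBasis H i)‖ ^ 2) ∧
      ∀ B : H →L[ℂ] H, operatorTrace (B * ρ) =
        ∑' i, inner ℂ (S (stdBasis H i)) (B (S (stdBasis H i))) := by
  have hρ0 : 0 ≤ ρ := (ContinuousLinearMap.nonneg_iff_isPositive _).2 hρ
  set S := CFC.sqrt ρ with hSdef
  have hS0 : 0 ≤ S := CFC.sqrt_nonneg ρ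
  have hSS : S * S = ρ := CFC.sqrt_mul_sqrt_self ρ hρ0
  have hSa : S.adjoint = S := by
    rw [← ContinuousLinearMap.star_eq_adjoint]
    exact (IsSelfAdjoint.of_nonneg hS0).star_eq
  have hadj : ∀ x y, inner ℂ x (S y) = inner ℂ (S x) y := fun x y => by
    rw [← ContinuousLinearMap.adjoint_inner_left, hSa]
  have hsum : Summable fun i => ‖S (stdBasis H i)‖ ^ 2 := by
    have h := htr
    rw [IsTraceClass, CFC.abs_of_nonneg ρ hρ0] at h
    refine h.congr fun i => ?_
    rw [← hSS, mul_apply_eq_comp, hadj, inner_self_eq_norm_sq_to_K]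
    norm_cast
  refine ⟨S, hSa, hSS, hsum, fun B => ?_⟩
  have hX : Summable fun i => ‖(B * S) (stdBasis H i)‖ ^ 2 := by
    refine Summable.of_nonneg_of_le (fun i => by positivity) (fun i => ?_) (hsum.mul_left (‖B‖ ^ 2))
    rw [← mul_pow]
    gcongr
    exact B.le_opNorm _
  rw [operatorTrace]
  -- Both `√ρ` and `B√ρ` are Hilbert–Schmidt; exchanging them moves one factor `√ρ` across the
  -- trace.
  have h := tsum_hilbertSchmidt_inner (stdBasis H) (stdBasis H) S (B * S) hsum hX
  rw [hSa] at h
  rw [show (∑' i, inner ℂ (S (stdBasis H i)) (B (S (stdBasis H i)))) =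
    ∑' i, inner ℂ (S (stdBasis H i)) ((B * S) (stdBasis H i)) from rfl, h]
  refine tsum_congr fun i => ?_
  rw [ContinuousLinearMap.adjoint_inner_left, ← hSS]
  rfl

end Operators

/-! ### The canonical basis of `ℓ²(ι)` and diagonal operators on it. -/

section Delta

variable {ι : Type*}

theorem delta_apply_self (z : ι) : (delta z : lp (fun _ : ι => ℂ) 2) z = 1 := by
  classical
  rw [delta]
  convert lp.single_apply_self (E := fun _ : ι => ℂ) 2 z (1 : ℂ)

theorem delta_apply_ne {z i : ι} (h : i ≠ z) : (delta z : lp (fun _ : ι => ℂ) 2) i = 0 := by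
  classical
  rw [delta]
  convert lp.single_apply_ne (E := fun _ : ι => ℂ) 2 z (1 : ℂ) h

theorem inner_delta_left (z : ι) (v : lp (fun _ : ι => ℂ) 2) : inner ℂ (delta z) v = v z := by
  classical
  have h := lp.inner_single_left (𝕜 := ℂ) (G := fun _ : ι => ℂ) z (1 : ℂ) v
  have hd : delta z = lp.single (E := fun _ : ι => ℂ) 2 z (1 : ℂ) := by
    rw [delta]
  rw [hd, h]
  simp

theorem norm_delta (z : ι) : ‖(delta z : lp (fun _ : ι => ℂ) 2)‖ = 1 := by
  have h : ((‖(delta z : lp (fun _ : ι => ℂ) 2)‖ ^ 2 : ℝ) : ℂ) = 1 := by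
    have := inner_self_eq_norm_sq_to_K (𝕜 := ℂ) (delta z : lp (fun _ : ι => ℂ) 2)
    rw [inner_delta_left, delta_apply_self] at this
    push_cast
    exact this.symm
  have h' : ‖(delta z : lp (fun _ : ι => ℂ) 2)‖ ^ 2 = 1 := by exact_mod_cast h
  exact (pow_eq_one_iff_of_nonneg (norm_nonneg _) two_ne_zero).1 h'

variable (ι) in
/-- The canonical Hilbert basis of `ℓ²(ι)`. -/
noncomputable def deltaBasis : HilbertBasis ι ℂ (lp (fun _ : ι => ℂ) 2) :=
  HilbertBasis.ofRepr (LinearIsometryEquiv.refl ℂ _)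

@[simp] theorem deltaBasis_apply (z : ι) : deltaBasis ι z = delta z := by
  classical
  have h := (deltaBasis ι).repr_symm_single z
  rw [← h, delta]
  show lp.single (E := fun _ : ι => ℂ) 2 z (1 : ℂ) = _
  convert rfl

theorem hasSum_delta (v : lp (fun _ : ι => ℂ) 2) : HasSum (fun i => v i • delta i) v := by
  have h := (deltaBasis ι).hasSum_repr v
  simp only [deltaBasis_apply] at h
  exact h

theorem ext_delta {H : Type*} [NormedAddCommGroup H] [InnerProductSpace ℂ H]
    {S T : lp (fun _ : ι => ℂ) 2 →L[ℂ] H} (h : ∀ i, S (delta i) = T (delta i)) : S = T :=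
  (deltaBasis ι).ext_clm fun i => by simpa using h i

theorem diagonalOp_apply {d : ι → ℂ} {C : ℝ} (hd : ∀ i, ‖d i‖ ≤ C) (v : lp (fun _ : ι => ℂ) 2)
    (i : ι) : diagonalOp d v i = d i * v i := by
  have h : ∃ K : ℝ, 0 ≤ K ∧ ∀ i, ‖d i • ContinuousLinearMap.id ℂ ℂ‖ ≤ K :=
    ⟨|C|, abs_nonneg _, fun i => by
      rw [norm_smul, ContinuousLinearMap.norm_id, mul_one]
      exact (hd i).trans (le_abs_self C)⟩
  rw [diagonalOp, dif_pos h]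
  rfl

theorem diagonalOp_delta {d : ι → ℂ} {C : ℝ} (hd : ∀ i, ‖d i‖ ≤ C) (z : ι) :
    diagonalOp d (delta z) = d z • delta z := by
  ext i
  rw [diagonalOp_apply hd, lp.coeFn_smul, Pi.smul_apply, smul_eq_mul]
  by_cases h : i = z
  · rw [h]
  · rw [delta_apply_ne h, mul_zero, mul_zero]

end Delta

/-- Strong convergence of a bounded family of operators may be checked on a total set. -/
theorem tendsto_apply_of_total {α E F : Type*} [NormedAddCommGroup E] [NormedSpace ℂ E]
    [NormedAddCommGroup F] [NormedSpace ℂ F] {l : Filter α} {T : α → E →L[ℂ] F} {S : E →L[ℂ] F}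
    {C : ℝ} (hC : ∀ᶠ a in l, ‖T a‖ ≤ C) {s : Set E}
    (hs : (Submodule.span ℂ s).topologicalClosure = ⊤)
    (h : ∀ v ∈ s, Filter.Tendsto (fun a => T a v) l (𝓝 (S v))) (v : E) :
    Filter.Tendsto (fun a => T a v) l (𝓝 (S v)) := by
  have hspan : ∀ v ∈ Submodule.span ℂ s, Filter.Tendsto (fun a => T a v) l (𝓝 (S v)) := by
    intro v hv
    induction hv using Submodule.span_induction with
    | mem v hv => exact h v hv
    | zero => simpa using tendsto_const_nhds
    | add x y _ _ hx hy => simpa using hx.add hy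
    | smul c x _ hx => simpa using hx.const_smul c
  have hv : v ∈ closure (Submodule.span ℂ s : Set E) := by
    rw [← Submodule.topologicalClosure_coe, hs]
    trivial
  rw [Metric.tendsto_nhds]
  intro ε hε
  -- `K` bounds `‖T a‖ + ‖S‖`; the extra 1 keeps it positive, so that the tolerance can be divided
  -- by it.
  set K := |C| + ‖S‖ + 1 with hK
  have hK0 : 0 < K := by positivity
  obtain ⟨u, hu, huv⟩ := Metric.mem_closure_iff.1 hv (ε / (2 * K)) (by positivity)
  filter_upwards [Metric.tendsto_nhds.1 (hspan u hu) (ε / 2) (by positivity), hC] with a ha hCa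
  have h1 : T a v - S v = (T a u - S u) + (T a (v - u) - S (v - u)) := by
    rw [map_sub, map_sub]
    abel
  rw [dist_eq_norm] at ha huv ⊢
  rw [h1]
  have h2 : ‖T a (v - u) - S (v - u)‖ ≤ K * ‖v - u‖ := by
    calc _ ≤ ‖T a (v - u)‖ + ‖S (v - u)‖ := norm_sub_le _ _
      _ ≤ |C| * ‖v - u‖ + ‖S‖ * ‖v - u‖ := by
          gcongr
          · exact (T a).le_of_opNorm_le (hCa.trans (le_abs_self C)) _
          · exact S.le_opNorm _
      _ ≤ K * ‖v - u‖ := by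
          rw [hK]
          nlinarith [norm_nonneg (v - u)]
  have h3 : K * ‖v - u‖ < ε / 2 := by
    calc _ < K * (ε / (2 * K)) := by gcongr
      _ = ε / 2 := by field_simp
  calc _ ≤ _ := norm_add_le _ _
    _ < ε := by linarith

/-! ### Multiples `T ⊕ T ⊕ ⋯` of an operator on `ℓ²(ι, H₀)`. -/

section Amplification

variable (ι : Type*) {H₀ : Type*} [NormedAddCommGroup H₀] [InnerProductSpace ℂ H₀]

/-- The diagonal operator `T ⊕ T ⊕ ⋯` on `ℓ²(ι, H₀)`. -/
noncomputable def amplify (T : H₀ →L[ℂ] H₀) :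
    lp (fun _ : ι => H₀) 2 →L[ℂ] lp (fun _ : ι => H₀) 2 :=
  lp.mapCLM 2 (fun _ => T) (norm_nonneg T) fun _ => le_rfl

variable {ι}

theorem amplify_apply (T : H₀ →L[ℂ] H₀) (v : lp (fun _ : ι => H₀) 2) (i : ι) :
    amplify ι T v i = T (v i) := rfl

theorem norm_amplify_le (T : H₀ →L[ℂ] H₀) : ‖amplify ι T‖ ≤ ‖T‖ :=
  lp.norm_mapCLM_le _ _ _ _

open Classical in
/-- The inclusion of the `z`-th summand of `ℓ²(ι, H₀)`. -/
noncomputable def summandIncl (z : ι) : H₀ →L[ℂ] lp (fun _ : ι => H₀) 2 :=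
  lp.singleContinuousLinearMap ℂ (fun _ : ι => H₀) 2 z

open Classical in
theorem summandIncl_apply (z : ι) (u : H₀) (i : ι) :
    summandIncl z u i = if i = z then u else 0 := by
  rw [summandIncl, lp.singleContinuousLinearMap_apply, lp.single_apply, Pi.single_apply]

theorem summandIncl_apply_self (z : ι) (u : H₀) : summandIncl z u z = u := by
  simp [summandIncl_apply]

theorem summandIncl_apply_ne {z i : ι} (h : i ≠ z) (u : H₀) : summandIncl z u i = 0 := by
  simp [summandIncl_apply, h]

theorem amplify_summandIncl (T : H₀ →L[ℂ] H₀) (z : ι) (u : H₀) :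
    amplify ι T (summandIncl z u) = summandIncl z (T u) := by
  ext i
  rw [amplify_apply]
  by_cases h : i = z
  · rw [h, summandIncl_apply_self, summandIncl_apply_self]
  · rw [summandIncl_apply_ne h, summandIncl_apply_ne h, map_zero]

theorem inner_summandIncl_left (z : ι) (u : H₀) (v : lp (fun _ : ι => H₀) 2) :
    inner ℂ (summandIncl z u) v = inner ℂ u (v z) := by
  classical
  rw [lp.inner_eq_tsum, tsum_eq_single z, summandIncl_apply_self]
  intro i hi
  rw [summandIncl_apply_ne hi, inner_zero_left]

theorem hasSum_summandIncl (v : lp (fun _ : ι => H₀) 2) :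
    HasSum (fun z => summandIncl z (v z)) v := by
  classical
  have h := lp.hasSum_single (p := 2) (by simp) v
  convert h using 2 with z
  rw [summandIncl, lp.singleContinuousLinearMap_apply]

theorem ext_summandIncl {H : Type*} [NormedAddCommGroup H] [InnerProductSpace ℂ H]
    {S T : lp (fun _ : ι => H₀) 2 →L[ℂ] H}
    (h : ∀ z u, S (summandIncl z u) = T (summandIncl z u)) : S = T := by
  ext v
  have hS := (hasSum_summandIncl v).mapL S
  have hT := (hasSum_summandIncl v).mapL T
  simp only [h] at hS
  exact hS.unique hT

theorem topologicalClosure_span_summandIncl :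
    (Submodule.span ℂ {v : lp (fun _ : ι => H₀) 2 | ∃ z u, v = summandIncl z u}).topologicalClosure
      = ⊤ := by
  refine eq_top_iff.2 fun v _ => ?_
  rw [← SetLike.mem_coe, Submodule.topologicalClosure_coe]
  refine mem_closure_of_tendsto (hasSum_summandIncl v) (Filter.Eventually.of_forall fun s => ?_)
  exact Submodule.sum_mem _ fun z _ => Submodule.subset_span ⟨z, _, rfl⟩

theorem amplify_mul (S T : H₀ →L[ℂ] H₀) : amplify ι (S * T) = amplify ι S * amplify ι T := rfl

theorem amplify_star [CompleteSpace H₀] (T : H₀ →L[ℂ] H₀) :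
    amplify ι (star T) = star (amplify ι T) := by
  rw [ContinuousLinearMap.star_eq_adjoint, ContinuousLinearMap.star_eq_adjoint,
    ContinuousLinearMap.eq_adjoint_iff]
  intro x y
  rw [lp.inner_eq_tsum, lp.inner_eq_tsum]
  refine tsum_congr fun i => ?_
  rw [amplify_apply, amplify_apply, ContinuousLinearMap.adjoint_inner_left]

/-- Convergence is clear on vectors supported in one summand, and these are total. The uniform bound
carries it to all vectors, which is why nets of matrix units are required to be bounded. -/
theorem amplify_tendsto {α : Type*} {l : Filter α} {T : α → H₀ →L[ℂ] H₀} {S : H₀ →L[ℂ] H₀}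
    {C : ℝ} (hC : ∀ a, ‖T a‖ ≤ C) (h : ∀ v, Filter.Tendsto (fun a => T a v) l (𝓝 (S v)))
    (v : lp (fun _ : ι => H₀) 2) :
    Filter.Tendsto (fun a => amplify ι (T a) v) l (𝓝 (amplify ι S v)) := by
  refine tendsto_apply_of_total (T := fun a => amplify ι (T a))
    (Filter.Eventually.of_forall fun a => (norm_amplify_le (T a)).trans (hC a))
    topologicalClosure_span_summandIncl ?_ v
  rintro _ ⟨z, u, rfl⟩
  simp only [amplify_summandIncl]
  exact ((summandIncl z).continuous.tendsto _).comp (h u)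

end Amplification

/-! ### The von Neumann algebra generated by a multiple of a representation with scalar commutant.
-/

section Multiples

variable {A : Type*} [NonUnitalCStarAlgebra A]

/-- Only scalars commute with the representation `π`. -/
def HasScalarCommutant {H₀ : Type*} [NormedAddCommGroup H₀] [InnerProductSpace ℂ H₀]
    [CompleteSpace H₀] (π : A →⋆ₙₐ[ℂ] (H₀ →L[ℂ] H₀)) : Prop :=
  ∀ T : H₀ →L[ℂ] H₀, (∀ a u, T (π a u) = π a (T u)) → ∃ t : ℂ, T = t • (1 : H₀ →L[ℂ] H₀)

variable {ι : Type*} {H₀ : Type*} [NormedAddCommGroup H₀] [InnerProductSpace ℂ H₀]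
  [CompleteSpace H₀] {π₀ : A →⋆ₙₐ[ℂ] (H₀ →L[ℂ] H₀)}

/-- An operator commuting with a multiple of a representation with scalar commutant is a matrix of
scalars. -/
theorem HasScalarCommutant.exists_matrix (hπ₀ : HasScalarCommutant π₀)
    (T : lp (fun _ : ι => H₀) 2 →L[ℂ] lp (fun _ : ι => H₀) 2)
    (hT : ∀ a v, T (amplify ι (π₀ a) v) = amplify ι (π₀ a) (T v)) :
    ∃ t : ι → ι → ℂ, ∀ z w u, T (summandIncl z u) w = t w z • u := by
  have h : ∀ z w, ∃ t : ℂ, ∀ u, T (summandIncl z u) w = t • u := fun z w => by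
    obtain ⟨t, ht⟩ := hπ₀ ((lp.evalCLM ℂ (fun _ : ι => H₀) 2 w) ∘L T ∘L summandIncl z) fun a u => by
      show T (summandIncl z (π₀ a u)) w = π₀ a (T (summandIncl z u) w)
      rw [← amplify_summandIncl, hT, amplify_apply]
    refine ⟨t, fun u => ?_⟩
    exact congrArg (fun S : H₀ →L[ℂ] H₀ => S u) ht
  choose t ht using h
  exact ⟨fun w z => t z w, fun z w u => ht z w u⟩

/-- `StarSubalgebra.centralizer` also asks for commutation with adjoints. This adds nothing here,
since the range of `π`, and with it the commutant, is closed under adjoints. -/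
theorem mem_bicommutant_iff {H : Type*} [NormedAddCommGroup H] [InnerProductSpace ℂ H]
    [CompleteSpace H] {π : A →⋆ₙₐ[ℂ] (H →L[ℂ] H)} {T : H →L[ℂ] H} :
    T ∈ bicommutant π ↔ ∀ S : H →L[ℂ] H, (∀ a, π a * S = S * π a) → S * T = T * S := by
  have hstar : star (Set.centralizer (Set.range π)) = Set.centralizer (Set.range π) := by
    have h : star (Set.range π) = Set.range π := by
      ext T
      constructor
      · rintro ⟨a, ha⟩
        exact ⟨star a, by rw [map_star, ha, star_star]⟩
      · rintro ⟨a, rfl⟩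
        exact ⟨star a, map_star π a⟩
    rw [Set.star_centralizer, h]
  have h : (T ∈ bicommutant π) ↔ T ∈ ((StarSubalgebra.centralizer ℂ
      (Set.centralizer (Set.range π)) : StarSubalgebra ℂ (H →L[ℂ] H)) : Set (H →L[ℂ] H)) := Iff.rfl
  rw [h, StarSubalgebra.coe_centralizer, hstar, Set.union_self, Set.mem_centralizer_iff]
  simp only [Set.mem_centralizer_iff, Set.forall_mem_range]

theorem map_mem_bicommutant {H : Type*} [NormedAddCommGroup H] [InnerProductSpace ℂ H]
    [CompleteSpace H] (π : A →⋆ₙₐ[ℂ] (H →L[ℂ] H)) (a : A) : π a ∈ bicommutant π :=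
  mem_bicommutant_iff.2 fun _ hS => (hS a).symm

variable {H : Type*} [NormedAddCommGroup H] [InnerProductSpace ℂ H] [CompleteSpace H]
  {π : A →⋆ₙₐ[ℂ] (H →L[ℂ] H)}

/-- If `π` is equivalent to a multiple of `π₀`, whose commutant is scalar, then every element of
`π(A)''` is a multiple of an operator on the space of `π₀`. -/
theorem exists_amplify_of_mem_bicommutant [Nonempty ι] (V : H ≃ₗᵢ[ℂ] lp (fun _ : ι => H₀) 2)
    (hV : ∀ a v, V (π a v) = amplify ι (π₀ a) (V v)) {T : H →L[ℂ] H} (hT : T ∈ bicommutant π) :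
    ∃ T₀ : H₀ →L[ℂ] H₀, ∀ v, V (T v) = amplify ι T₀ (V v) := by
  -- The operators moving summand `w` to summand `z` commute with every multiple, so their
  -- transports to `H` lie in the commutant of `π` and commute with `T`.
  let e : ι → ι → lp (fun _ : ι => H₀) 2 →L[ℂ] lp (fun _ : ι => H₀) 2 := fun z w =>
    summandIncl z ∘L lp.evalCLM ℂ (fun _ : ι => H₀) 2 w
  have he : ∀ z w v, e z w v = summandIncl z (v w) := fun _ _ _ => rfl
  let E : ι → ι → H →L[ℂ] H := fun z w =>
    V.symm.toContinuousLinearEquiv.toContinuousLinearMap ∘L e z w ∘L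
      V.toContinuousLinearEquiv.toContinuousLinearMap
  have hE : ∀ z w v, V (E z w v) = summandIncl z (V v w) := fun z w v => by
    show V (V.symm _) = _
    rw [V.apply_symm_apply]
    rfl
  have hcomm : ∀ z w, E z w * T = T * E z w := fun z w => by
    refine mem_bicommutant_iff.1 hT _ fun a => ?_
    ext v
    apply V.injective
    rw [mul_apply_eq_comp, mul_apply_eq_comp, hV, hE, hE, hV, amplify_summandIncl, amplify_apply]
  have hcomm' : ∀ z w v, V (T (E z w v)) = summandIncl z (V (T v) w) := fun z w v => by
    rw [← hE, ← mul_apply_eq_comp, ← mul_apply_eq_comp, hcomm]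
  obtain ⟨o⟩ := ‹Nonempty ι›
  -- The compression of `T` to one summand; commutation with the shifts `E` carries it to every
  -- other summand.
  let T₀ : H₀ →L[ℂ] H₀ := lp.evalCLM ℂ (fun _ : ι => H₀) 2 o ∘L
    V.toContinuousLinearEquiv.toContinuousLinearMap ∘L T ∘L
      V.symm.toContinuousLinearEquiv.toContinuousLinearMap ∘L summandIncl o
  have hT₀ : ∀ u, T₀ u = V (T (V.symm (summandIncl o u))) o := fun u => rfl
  refine ⟨T₀, fun v => ?_⟩
  have key : (V.toContinuousLinearEquiv.toContinuousLinearMap ∘L T ∘L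
      V.symm.toContinuousLinearEquiv.toContinuousLinearMap) = amplify ι T₀ := by
    refine ext_summandIncl fun z u => ?_
    show V (T (V.symm (summandIncl z u))) = _
    have h1 : V.symm (summandIncl z u) = E z o (V.symm (summandIncl o u)) := by
      apply V.injective
      rw [hE, V.apply_symm_apply, V.apply_symm_apply, summandIncl_apply_self]
    rw [amplify_summandIncl, h1, hcomm', hT₀]
  have h2 := congrArg (fun S => S (V v)) key
  rw [← h2]
  show _ = V (T (V.symm (V v)))
  rw [V.symm_apply_apply]

/-- Transported to `ℓ²(ι, H₀)`, the commutant of `π` consists of matrices of scalars, and the same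
`T₀` in every summand commutes with those. -/
theorem mem_bicommutant_of_amplify (hπ₀ : HasScalarCommutant π₀)
    (V : H ≃ₗᵢ[ℂ] lp (fun _ : ι => H₀) 2)
    (hV : ∀ a v, V (π a v) = amplify ι (π₀ a) (V v)) {T : H →L[ℂ] H} {T₀ : H₀ →L[ℂ] H₀}
    (hT : ∀ v, V (T v) = amplify ι T₀ (V v)) : T ∈ bicommutant π := by
  refine mem_bicommutant_iff.2 fun S hS => ?_
  obtain ⟨t, ht⟩ := hπ₀.exists_matrix (V.toContinuousLinearEquiv.toContinuousLinearMap ∘L S ∘L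
      V.symm.toContinuousLinearEquiv.toContinuousLinearMap) fun a v => by
    show V (S (V.symm (amplify ι (π₀ a) v))) = amplify ι (π₀ a) (V (S (V.symm v)))
    have h1 : V.symm (amplify ι (π₀ a) v) = π a (V.symm v) := by
      apply V.injective
      rw [hV, V.apply_symm_apply, V.apply_symm_apply]
    rw [h1, ← hV, ← mul_apply_eq_comp, ← hS a]
    rfl
  have ht' : ∀ z w u, V (S (V.symm (summandIncl z u))) w = t w z • u := ht
  have key : V.toContinuousLinearEquiv.toContinuousLinearMap ∘L (S * T) ∘L
      V.symm.toContinuousLinearEquiv.toContinuousLinearMap =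
      V.toContinuousLinearEquiv.toContinuousLinearMap ∘L (T * S) ∘L
      V.symm.toContinuousLinearEquiv.toContinuousLinearMap := by
    refine ext_summandIncl fun z u => ?_
    show V (S (T (V.symm (summandIncl z u)))) = V (T (S (V.symm (summandIncl z u))))
    have h1 : T (V.symm (summandIncl z u)) = V.symm (summandIncl z (T₀ u)) := by
      apply V.injective
      rw [hT, V.apply_symm_apply, V.apply_symm_apply, amplify_summandIncl]
    rw [h1, hT]
    ext w
    rw [amplify_apply, ht', ht', map_smul]
  ext v
  have h2 := congrArg (fun S => S (V v)) key
  have h3 : V ((S * T) (V.symm (V v))) = V ((T * S) (V.symm (V v))) := h2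
  rw [V.symm_apply_apply] at h3
  exact V.injective h3

/-- A central element is a multiple of some `T₀`. It commutes with each `π a`, so `T₀` commutes with
`π₀` and is scalar. -/
theorem isFactor_bicommutant [Nonempty ι] (hπ₀ : HasScalarCommutant π₀)
    (V : H ≃ₗᵢ[ℂ] lp (fun _ : ι => H₀) 2)
    (hV : ∀ a v, V (π a v) = amplify ι (π₀ a) (V v)) : IsFactor (bicommutant π) := by
  intro T hT hT'
  obtain ⟨T₀, hT₀⟩ := exists_amplify_of_mem_bicommutant V hV hT
  rw [VonNeumannAlgebra.mem_commutant_iff] at hT'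
  obtain ⟨o⟩ := ‹Nonempty ι›
  have h0 : ∀ u, V (T (V.symm (summandIncl o u))) = summandIncl o (T₀ u) := fun u => by
    rw [hT₀, V.apply_symm_apply, amplify_summandIncl]
  obtain ⟨t, ht⟩ := hπ₀ T₀ fun a u => by
    have h1 := congrArg (fun S => V (S (V.symm (summandIncl o u))) o)
      (hT' _ (map_mem_bicommutant π a))
    simp only [mul_apply_eq_comp] at h1
    rw [hV, h0, amplify_apply, summandIncl_apply_self, hT₀, hV, V.apply_symm_apply,
      amplify_apply, amplify_apply, summandIncl_apply_self] at h1
    exact h1.symm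
  refine ⟨t, ?_⟩
  ext v
  apply V.injective
  rw [hT₀]
  ext i
  simp [amplify_apply, ht]

/-- Factoriality leaves 1 as the only nonzero central projection. The multiple of a rank one
projection of `H₀` is the required abelian projection `p`: it compresses the algebra to multiples of
`p`. -/
theorem isTypeI_bicommutant [Nonempty ι] [Nontrivial H₀] (hπ₀ : HasScalarCommutant π₀)
    (V : H ≃ₗᵢ[ℂ] lp (fun _ : ι => H₀) 2)
    (hV : ∀ a v, V (π a v) = amplify ι (π₀ a) (V v)) : IsTypeI (bicommutant π) := by
  intro z hz hz' hzp hz0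
  obtain ⟨t, ht⟩ := isFactor_bicommutant hπ₀ V hV z hz hz'
  have hz1 : z = 1 := by
    have h1 := hzp.isIdempotentElem
    rw [IsIdempotentElem, ht, smul_mul_smul_comm, one_mul, ← sub_eq_zero, ← sub_smul] at h1
    rcases smul_eq_zero.1 h1 with h2 | h2
    · rcases eq_or_ne t 0 with h3 | h3
      · exact absurd (by rw [ht, h3, zero_smul]) hz0
      · have : t = 1 := by
          have h4 : t * (t - 1) = 0 := by linear_combination h2
          exact sub_eq_zero.1 ((mul_eq_zero.1 h4).resolve_left h3)
        rw [ht, this, one_smul]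
    · exact absurd (by rw [ht, h2, smul_zero]) hz0
  obtain ⟨e, he⟩ := exists_norm_eq H₀ zero_le_one
  have hee : inner ℂ e e = (1 : ℂ) := by
    rw [inner_self_eq_norm_sq_to_K, he]
    simp
  let p₀ : H₀ →L[ℂ] H₀ := (innerSL ℂ e).smulRight e
  have hp₀ : ∀ u, p₀ u = inner ℂ e u • e := fun u => rfl
  have hp₀p : p₀ * p₀ = p₀ := by
    ext u
    rw [mul_apply_eq_comp, hp₀, hp₀, inner_smul_right, hee, mul_one]
  have hp₀s : star p₀ = p₀ := by
    rw [ContinuousLinearMap.star_eq_adjoint]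
    refine ((ContinuousLinearMap.eq_adjoint_iff _ _).2 fun x y => ?_).symm
    rw [hp₀, hp₀, inner_smul_left, inner_smul_right, inner_conj_symm]
    ring
  let p : H →L[ℂ] H := V.symm.toContinuousLinearEquiv.toContinuousLinearMap ∘L amplify ι p₀ ∘L
      V.toContinuousLinearEquiv.toContinuousLinearMap
  have hp : ∀ v, V (p v) = amplify ι p₀ (V v) := fun v => by
    show V (V.symm _) = _
    rw [V.apply_symm_apply]
    rfl
  have hpM : p ∈ bicommutant π := mem_bicommutant_of_amplify hπ₀ V hV hp
  have hpS : ∀ S ∈ bicommutant π, ∃ k : ℂ, p * S * p = k • p := fun S hS => by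
    obtain ⟨S₀, hS₀⟩ := exists_amplify_of_mem_bicommutant V hV hS
    refine ⟨inner ℂ e (S₀ e), ?_⟩
    ext v
    apply V.injective
    ext i
    simp only [mul_apply_eq_comp, smul_apply, map_smul, lp.coeFn_smul, Pi.smul_apply,
      hp, hS₀, amplify_apply, hp₀, inner_smul_right]
    rw [smul_smul, mul_comm]
  refine ⟨p, hpM, ⟨?_, ?_⟩, ?_, ?_, ?_⟩
  · ext v
    apply V.injective
    rw [mul_apply_eq_comp, hp, hp, ← mul_apply_eq_comp, ← amplify_mul, hp₀p]
  · rw [IsSelfAdjoint, ContinuousLinearMap.star_eq_adjoint]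
    refine ((ContinuousLinearMap.eq_adjoint_iff _ _).2 fun x y => ?_).symm
    rw [← V.inner_map_map, ← V.inner_map_map x, hp, hp,
      ← ContinuousLinearMap.adjoint_inner_right, ← ContinuousLinearMap.star_eq_adjoint,
      ← amplify_star, hp₀s]
  · obtain ⟨o⟩ := ‹Nonempty ι›
    intro h0
    have h1 : V (p (V.symm (summandIncl o e))) o = e := by
      rw [hp, V.apply_symm_apply, amplify_apply, summandIncl_apply_self, hp₀, hee, one_smul]
    rw [h0] at h1
    have h2 : e = 0 := by simpa using h1.symm
    rw [h2, norm_zero] at he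
    exact zero_ne_one he
  · rw [hz1, mul_one]
  · intro S hS T hT
    obtain ⟨k, hk⟩ := hpS S hS
    obtain ⟨m, hm⟩ := hpS T hT
    rw [hk, hm, smul_mul_smul_comm, smul_mul_smul_comm, mul_comm k m]

end Multiples

/-! ### Representations whose strong closure contains the matrix units. -/

section MatrixUnits

variable {A : Type*} [NonUnitalCStarAlgebra A] {ι : Type*}

/-- Every matrix unit `δ_z ↦ δ_w` is the strong limit of a bounded net in `π(A)`. -/
def HasMatrixUnits (π : A →⋆ₙₐ[ℂ] (lp (fun _ : ι => ℂ) 2 →L[ℂ] lp (fun _ : ι => ℂ) 2)) : Prop :=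
  ∀ z w : ι, ∃ (C : ℝ) (a : Finset ι → A), (∀ F, ‖π (a F)‖ ≤ C) ∧
    ∀ v, Filter.Tendsto (fun F => π (a F) v) Filter.atTop (𝓝 (v z • delta w))

theorem topologicalClosure_span_delta :
    (Submodule.span ℂ (Set.range fun z : ι => delta z)).topologicalClosure = ⊤ := by
  have h := (deltaBasis ι).dense_span
  have h2 : (⇑(deltaBasis ι)) = fun z => delta z := funext deltaBasis_apply
  rwa [h2] at h

/-- The index `F` lists basis vectors to be killed. Any fixed `delta y` eventually belongs to `F`,
so `T F (delta y)` is eventually constant; the uniform bound does the rest. -/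
theorem tendsto_matrixUnit {l : Filter (Finset ι)}
    {T : Finset ι → lp (fun _ : ι => ℂ) 2 →L[ℂ] lp (fun _ : ι => ℂ) 2} {C : ℝ}
    (hC : ∀ F, ‖T F‖ ≤ C) (hl : l ≤ Filter.atTop) {z w : ι} {t : ℂ}
    (hz : ∀ F, T F (delta z) = t • delta w)
    (h0 : ∀ F, ∀ y ∈ F, y ≠ z → T F (delta y) = 0) (v : lp (fun _ : ι => ℂ) 2) :
    Filter.Tendsto (fun F => T F v) l (𝓝 ((t * v z) • delta w)) := by
  let S : lp (fun _ : ι => ℂ) 2 →L[ℂ] lp (fun _ : ι => ℂ) 2 :=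
    ((innerSL ℂ (delta z)).smulRight (t • delta w))
  have hS : ∀ v, S v = (t * v z) • delta w := fun v => by
    show inner ℂ (delta z) v • t • delta w = _
    rw [inner_delta_left, smul_smul, mul_comm]
  rw [← hS]
  refine tendsto_apply_of_total (Filter.Eventually.of_forall hC) topologicalClosure_span_delta ?_ v
  rintro _ ⟨y, rfl⟩
  refine tendsto_const_nhds.congr' ?_
  have hev : ∀ᶠ F : Finset ι in l, y ∈ F :=
    hl ((Filter.eventually_ge_atTop {y}).mono fun F hF => hF (Finset.mem_singleton_self y))
  filter_upwards [hev] with F hF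
  rw [hS]
  by_cases h : y = z
  · subst h
    simp only [hz, delta_apply_self, mul_one]
  · simp only [h0 F y hF h, delta_apply_ne (Ne.symm h), mul_zero, zero_smul]

variable {π : A →⋆ₙₐ[ℂ] (lp (fun _ : ι => ℂ) 2 →L[ℂ] lp (fun _ : ι => ℂ) 2)}

/-- With `a F` tending to the unit `δ_o ↦ δ_w`, the vector `T δ_w` is the limit of `T π(a F) δ_o =
π(a F) T δ_o`, namely `(T δ_o)(o) δ_w`. The scalar does not depend on `w`. -/
theorem HasMatrixUnits.hasScalarCommutant [Nonempty ι] (hπ : HasMatrixUnits π) :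
    HasScalarCommutant π := by
  intro T hT
  obtain ⟨o⟩ := ‹Nonempty ι›
  refine ⟨T (delta o) o, ext_delta fun w => ?_⟩
  obtain ⟨C, a, -, ha⟩ := hπ o w
  have h1 := (T.continuous.tendsto _).comp (ha (delta o))
  have h2 := ha (T (delta o))
  have h3 := tendsto_nhds_unique (h1.congr fun F => hT _ _) h2
  rw [delta_apply_self, one_smul] at h3
  rw [h3]
  rfl

/-- A nonzero vector of an invariant subspace has a nonzero coordinate `z`, and the units `δ_z ↦
δ_w` turn it into a nonzero multiple of each `delta w`; closedness keeps these limits inside. -/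
theorem HasMatrixUnits.isIrreducibleRep [Nonempty ι] (hπ : HasMatrixUnits π) :
    IsIrreducibleRep π := by
  refine ⟨?_, fun K hK hinv => ?_⟩
  · obtain ⟨o⟩ := ‹Nonempty ι›
    by_contra! h
    obtain ⟨C, a, -, ha⟩ := hπ o o
    have h1 := ha (delta o)
    simp only [h, zero_apply] at h1
    have h2 := tendsto_nhds_unique h1 tendsto_const_nhds
    rw [delta_apply_self, one_smul] at h2
    have h3 := norm_delta o
    rw [h2, norm_zero] at h3
    exact zero_ne_one h3
  · rw [or_iff_not_imp_left]
    intro hne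
    obtain ⟨v, hv, hv0⟩ := (Submodule.ne_bot_iff _).1 hne
    obtain ⟨z, hz⟩ : ∃ z, v z ≠ 0 := by
      by_contra! h
      exact hv0 (lp.ext (funext h))
    have hd : ∀ w, delta w ∈ K := fun w => by
      obtain ⟨C, a, -, ha⟩ := hπ z w
      have h1 : v z • delta w ∈ K :=
        hK.mem_of_tendsto (ha v) (Filter.Eventually.of_forall fun F => hinv _ _ hv)
      exact (Submodule.smul_mem_iff _ hz).1 h1
    refine eq_top_iff.2 fun v _ => ?_
    refine hK.mem_of_tendsto (hasSum_delta v) (Filter.Eventually.of_forall fun s => ?_)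
    exact Submodule.sum_mem _ fun z _ => Submodule.smul_mem _ _ (hd z)

/-- A nonzero intertwiner into an irreducible representation from one with scalar commutant is a
multiple of a unitary. -/
theorem exists_unitary_intertwiner {H₀ H : Type*} [NormedAddCommGroup H₀] [InnerProductSpace ℂ H₀]
    [CompleteSpace H₀] [NormedAddCommGroup H] [InnerProductSpace ℂ H] [CompleteSpace H]
    {π₀ : A →⋆ₙₐ[ℂ] (H₀ →L[ℂ] H₀)} {π : A →⋆ₙₐ[ℂ] (H →L[ℂ] H)} (hπ₀ : HasScalarCommutant π₀)
    (hπ : IsIrreducibleRep π) (W : H₀ →L[ℂ] H) (hW0 : W ≠ 0) (hW : ∀ a u, W (π₀ a u) = π a (W u)) :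
    ∃ U : H₀ ≃ₗᵢ[ℂ] H, ∀ a u, U (π₀ a u) = π a (U u) := by
  have hW' : ∀ a v, W.adjoint (π a v) = π₀ a (W.adjoint v) := fun a v => by
    refine ext_inner_left ℂ fun u => ?_
    have h1 : ∀ (u u' : H₀), inner ℂ u (π₀ a u') = inner ℂ (π₀ (star a) u) u' := fun u u' => by
      rw [map_star, ContinuousLinearMap.star_eq_adjoint, ContinuousLinearMap.adjoint_inner_left]
    have h2 : ∀ (u u' : H), inner ℂ u (π a u') = inner ℂ (π (star a) u) u' := fun u u' => by
      rw [map_star, ContinuousLinearMap.star_eq_adjoint, ContinuousLinearMap.adjoint_inner_left]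
    rw [h1, ContinuousLinearMap.adjoint_inner_right, ContinuousLinearMap.adjoint_inner_right, hW, h2]
  -- Schur's lemma: `W* W` commutes with `π₀`, so it is a scalar and `W` scales all norms by one
  -- factor.
  obtain ⟨t, ht⟩ := hπ₀ (W.adjoint ∘L W) fun a u => by
    show W.adjoint (W (π₀ a u)) = π₀ a (W.adjoint (W u))
    rw [hW, hW']
  have hnorm : ∀ u, ‖W u‖ ^ 2 = t.re * ‖u‖ ^ 2 := fun u => by
    have h1 : inner ℂ u ((W.adjoint ∘L W) u) = inner ℂ (W u) (W u) :=
      ContinuousLinearMap.adjoint_inner_right W u (W u)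
    rw [ht, smul_apply, one_apply_eq_self, inner_smul_right, inner_self_eq_norm_sq_to_K,
      inner_self_eq_norm_sq_to_K] at h1
    have h2 := congrArg Complex.re h1
    simp only [Complex.coe_algebraMap, ← Complex.ofReal_pow, Complex.re_mul_ofReal,
      Complex.ofReal_re] at h2
    exact h2.symm
  have ht0 : 0 < t.re := by
    obtain ⟨u, hu⟩ : ∃ u, W u ≠ 0 := by
      by_contra! h
      exact hW0 (ContinuousLinearMap.ext h)
    have h1 : 0 < ‖W u‖ ^ 2 := by positivity
    rw [hnorm] at h1
    exact (pos_iff_pos_of_mul_pos h1).2 (by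
      rcases eq_or_ne u 0 with h | h
      · rw [h] at hu
        simp at hu
      · positivity)
  let U₀ : H₀ →ₗᵢ[ℂ] H :=
    { toLinearMap := (((Real.sqrt t.re)⁻¹ : ℂ) • W).toLinearMap
      norm_map' := fun u => by
        show ‖((Real.sqrt t.re)⁻¹ : ℂ) • W u‖ = ‖u‖
        have h0 : 0 < Real.sqrt t.re := Real.sqrt_pos.2 ht0
        have h1 : ‖W u‖ = Real.sqrt t.re * ‖u‖ := by
          rw [← sq_eq_sq₀ (norm_nonneg _) (by positivity), hnorm, mul_pow, Real.sq_sqrt ht0.le]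
        rw [norm_smul, h1, norm_inv, Complex.norm_real, Real.norm_of_nonneg h0.le]
        field_simp }
  have hU₀ : ∀ u, U₀ u = ((Real.sqrt t.re)⁻¹ : ℂ) • W u := fun u => rfl
  have hint : ∀ a u, U₀ (π₀ a u) = π a (U₀ u) := fun a u => by
    rw [hU₀, hU₀, hW, map_smul]
  have hsurj : Function.Surjective U₀ := by
    rw [← LinearIsometry.coe_toLinearMap, ← LinearMap.range_eq_top]
    -- The range of an isometry is closed, and it is invariant under `π`, so irreducibility makes it
    -- everything.
    refine (hπ.2 _ ?_ ?_).resolve_left ?_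
    · rw [LinearMap.coe_range]
      exact U₀.isometry.isClosedEmbedding.isClosed_range
    · rintro a _ ⟨u, rfl⟩
      exact ⟨π₀ a u, hint a u⟩
    · intro h
      rw [LinearMap.range_eq_bot] at h
      refine hW0 (ContinuousLinearMap.ext fun u => ?_)
      have h1 : U₀ u = 0 := congrArg (fun S : H₀ →ₗ[ℂ] H => S u) h
      have h2 : u = 0 := by
        rw [← norm_eq_zero, ← U₀.norm_map, h1, norm_zero]
      rw [h2, map_zero, map_zero]
  exact ⟨LinearIsometryEquiv.ofSurjective U₀ hsurj, hint⟩

end MatrixUnits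

/-! ### The GNS representation of a diagonal functional. -/

section DiagonalState

variable {A : Type*} [NonUnitalCStarAlgebra A] {ι : Type*}
  (π : A →⋆ₙₐ[ℂ] (lp (fun _ : ι => ℂ) 2 →L[ℂ] lp (fun _ : ι => ℂ) 2))

/-- The matrix coefficient `a ↦ ⟨δ_w, π(a) δ_z⟩`. -/
noncomputable def matrixCoeff (w z : ι) : A →L[ℂ] ℂ :=
  LinearMap.mkContinuous
    { toFun := fun a => π a (delta z) w
      map_add' := fun a b => by rw [map_add]; rfl
      map_smul' := fun t a => by rw [map_smul]; rfl } 1 fun a => by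
    have h1 : ‖π a (delta z) w‖ ≤ ‖π a (delta z)‖ := lp.norm_apply_le_norm (by simp) _ _
    have h2 : ‖π a (delta z)‖ ≤ ‖π a‖ := by
      simpa [norm_delta] using (π a).le_opNorm (delta z)
    rw [one_mul]
    exact h1.trans (h2.trans (NonUnitalStarAlgHom.norm_apply_le π a))

theorem matrixCoeff_apply (w z : ι) (a : A) : matrixCoeff π w z a = π a (delta z) w := rfl

variable {π}

theorem norm_map_delta_le (a : A) (z : ι) : ‖π a (delta z)‖ ≤ ‖a‖ := by
  have h2 : ‖π a (delta z)‖ ≤ ‖π a‖ := by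
    simpa [norm_delta] using (π a).le_opNorm (delta z)
  exact h2.trans (NonUnitalStarAlgHom.norm_apply_le π a)

theorem norm_matrixCoeff_apply_le (w z : ι) (a : A) : ‖matrixCoeff π w z a‖ ≤ ‖a‖ :=
  (lp.norm_apply_le_norm (by simp) _ _).trans (norm_map_delta_le a z)

theorem inner_map_delta (a b : A) (z y : ι) :
    inner ℂ (π b (delta z)) (π a (delta y)) = matrixCoeff π z y (star b * a) := by
  rw [matrixCoeff_apply, ← inner_delta_left, map_mul, map_star,
    ContinuousLinearMap.star_eq_adjoint, mul_apply_eq_comp, ContinuousLinearMap.adjoint_inner_right]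

theorem hasSum_matrixCoeff_mul (w z : ι) (a b : A) :
    HasSum (fun y => matrixCoeff π w y a * matrixCoeff π y z b) (matrixCoeff π w z (a * b)) := by
  have h := (deltaBasis ι).hasSum_inner_mul_inner (π (star a) (delta w)) (π b (delta z))
  rw [inner_map_delta, star_star] at h
  refine h.congr_fun fun y => ?_
  rw [deltaBasis_apply, inner_delta_left, matrixCoeff_apply, matrixCoeff_apply,
    ← inner_delta_left w, map_star, ContinuousLinearMap.star_eq_adjoint,
    ContinuousLinearMap.adjoint_inner_left]

variable (π) in
/-- `φ(a) = ∑_z q_z ⟨δ_z, π(a) δ_z⟩`. -/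
def IsDiagonalFunctional (q : ι → ℝ) (φ : A →L[ℂ] ℂ) : Prop :=
  ∀ a, φ a = ∑' z, (q z : ℂ) * matrixCoeff π z z a

theorem sqrt_smul_delta_memℓp {q : ι → ℝ} (hq0 : ∀ z, 0 ≤ q z) (hq : Summable q) :
    Memℓp (fun z => (Real.sqrt (q z) : ℂ) • (delta z : lp (fun _ : ι => ℂ) 2)) 2 := by
  refine memℓp_gen ?_
  refine hq.congr fun z => ?_
  have h : ‖(Real.sqrt (q z) : ℂ) • (delta z : lp (fun _ : ι => ℂ) 2)‖ = Real.sqrt (q z) := by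
    rw [norm_smul, norm_delta, mul_one, Complex.norm_real, Real.norm_of_nonneg (Real.sqrt_nonneg _)]
  rw [h]
  simp [Real.sq_sqrt (hq0 z)]

/-- The vector `∑ √q_z δ_z ⊗ δ_z`, which implements a diagonal functional. -/
noncomputable def diagonalVector {q : ι → ℝ} (hq0 : ∀ z, 0 ≤ q z) (hq : Summable q) :
    lp (fun _ : ι => lp (fun _ : ι => ℂ) 2) 2 :=
  ⟨_, sqrt_smul_delta_memℓp hq0 hq⟩

variable (π) in
/-- The map `a ↦ π^∞(a) Ω`, with `Ω` the vector `∑ √q_z δ_z ⊗ δ_z`. -/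
noncomputable def diagonalGNS {q : ι → ℝ} (hq0 : ∀ z, 0 ≤ q z) (hq : Summable q) :
    A →ₗ[ℂ] lp (fun _ : ι => lp (fun _ : ι => ℂ) 2) 2 where
  toFun a := amplify ι (π a) (diagonalVector hq0 hq)
  map_add' a b := by
    ext z : 2
    rw [map_add]
    rfl
  map_smul' t a := by
    ext z : 2
    rw [map_smul]
    rfl

section

variable {q : ι → ℝ} (hq0 : ∀ z, 0 ≤ q z) (hq : Summable q)

theorem diagonalGNS_apply (a : A) (z : ι) :
    diagonalGNS π hq0 hq a z = (Real.sqrt (q z) : ℂ) • π a (delta z) :=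
  map_smul (π a) _ _

theorem diagonalGNS_mul (a b : A) :
    diagonalGNS π hq0 hq (a * b) = amplify ι (π a) (diagonalGNS π hq0 hq b) := by
  show amplify ι (π (a * b)) _ = amplify ι (π a) (amplify ι (π b) _)
  rw [map_mul]
  rfl

/-- The two factors `√q_z` combine to the weight `q_z`. So the vector `Ω = ∑ √q_z δ_z ⊗ δ_z`
implements `φ` in the multiple of `π`. -/
theorem inner_diagonalGNS {φ : A →L[ℂ] ℂ} (hφ : IsDiagonalFunctional π q φ) (a b : A) :
    inner ℂ (diagonalGNS π hq0 hq b) (diagonalGNS π hq0 hq a) = φ (star b * a) := by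
  rw [lp.inner_eq_tsum, hφ]
  refine tsum_congr fun z => ?_
  rw [diagonalGNS_apply, diagonalGNS_apply, inner_smul_left, inner_smul_right, inner_map_delta,
    Complex.conj_ofReal, ← mul_assoc, ← Complex.ofReal_mul, Real.mul_self_sqrt (hq0 z)]

theorem norm_diagonalGNS_sq {φ : A →L[ℂ] ℂ} (hφ : IsDiagonalFunctional π q φ) (a : A) :
    ((‖diagonalGNS π hq0 hq a‖ ^ 2 : ℝ) : ℂ) = φ (star a * a) := by
  rw [← inner_diagonalGNS hq0 hq hφ, inner_self_eq_norm_sq_to_K]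
  push_cast
  rfl

/-- Bounded strong convergence passes to multiples by `amplify_tendsto`. The limit of `π(a F)` kills
all `delta y` with `y ≠ z`, so of `Ω` only the summand `z` survives. -/
theorem tendsto_diagonalGNS {a : Finset ι → A} {C : ℝ} {z w : ι} {t : ℂ}
    (hC : ∀ F, ‖π (a F)‖ ≤ C)
    (ha : ∀ v, Filter.Tendsto (fun F => π (a F) v) Filter.atTop (𝓝 ((t * v z) • delta w))) :
    Filter.Tendsto (fun F => diagonalGNS π hq0 hq (a F)) Filter.atTop
      (𝓝 (summandIncl z (((Real.sqrt (q z) : ℂ) * t) • delta w))) := by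
  let S : lp (fun _ : ι => ℂ) 2 →L[ℂ] lp (fun _ : ι => ℂ) 2 :=
    ((innerSL ℂ (delta z)).smulRight (t • delta w))
  have hS : ∀ v, S v = (t * v z) • delta w := fun v => by
    show inner ℂ (delta z) v • t • delta w = _
    rw [inner_delta_left, smul_smul, mul_comm]
  have h := amplify_tendsto (ι := ι) (S := S) hC (fun v => by rw [hS]; exact ha v)
    (diagonalVector hq0 hq)
  have hlim : summandIncl z (((Real.sqrt (q z) : ℂ) * t) • delta w) =
      amplify ι S (diagonalVector hq0 hq) := by
    symm
    ext y : 2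
    have h1 : amplify ι S (diagonalVector hq0 hq) y = (Real.sqrt (q y) : ℂ) • S (delta y) :=
      map_smul S _ _
    rw [h1, hS]
    by_cases hy : y = z
    · rw [hy, summandIncl_apply_self, delta_apply_self, mul_one, smul_smul]
    · rw [summandIncl_apply_ne hy, delta_apply_ne (Ne.symm hy), mul_zero, zero_smul, smul_zero]
  rw [hlim]
  exact h

/-- The limits in `tendsto_diagonalGNS` are `√q_z` times the elementary vectors `δ_z ⊗ δ_w`. As no
`q z` vanishes, all of these lie in the closure of the range, so `Ω` is cyclic. -/
theorem denseRange_diagonalGNS (hqpos : ∀ z, 0 < q z) (hπ : HasMatrixUnits π) :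
    DenseRange (diagonalGNS π hq0 hq) := by
  set K := (LinearMap.range (diagonalGNS π hq0 hq)).topologicalClosure with hK
  have hKc : IsClosed (K : Set (lp (fun _ : ι => lp (fun _ : ι => ℂ) 2) 2)) :=
    Submodule.isClosed_topologicalClosure _
  have h1 : ∀ z w, summandIncl z (delta w) ∈ K := fun z w => by
    obtain ⟨C, a, hC, ha⟩ := hπ z w
    have h2 := tendsto_diagonalGNS hq0 hq (t := 1) hC (by simpa using ha)
    have h3 := hKc.mem_of_tendsto h2 (Filter.Eventually.of_forall fun F =>
      Submodule.le_topologicalClosure _ ⟨a F, rfl⟩)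
    rw [mul_one, map_smul] at h3
    refine (Submodule.smul_mem_iff _ ?_).1 h3
    exact_mod_cast (Real.sqrt_pos.2 (hqpos z)).ne'
  have h2 : ∀ z u, summandIncl z u ∈ K := fun z u => by
    have h3 := (hasSum_delta u).mapL (summandIncl (ι := ι) z)
    refine hKc.mem_of_tendsto h3 (Filter.Eventually.of_forall fun s => ?_)
    refine Submodule.sum_mem _ fun w _ => ?_
    rw [map_smul]
    exact Submodule.smul_mem _ _ (h1 z w)
  intro v
  have h3 : v ∈ K := hKc.mem_of_tendsto (hasSum_summandIncl v)
    (Filter.Eventually.of_forall fun s => Submodule.sum_mem _ fun z _ => h2 z _)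
  rw [hK, ← SetLike.mem_coe, Submodule.topologicalClosure_coe] at h3
  exact h3

end

/-- The class of an element in the GNS space of a positive functional. -/
noncomputable def gnsClass [PartialOrder A] [StarOrderedRing A] (f : A →ₚ[ℂ] ℂ) : A →ₗ[ℂ] f.GNS :=
  (UniformSpace.Completion.toComplₗᵢ (𝕜 := ℂ) (E := f.PreGNS)).toLinearMap ∘ₗ
    f.toPreGNS.toLinearMap

theorem denseRange_gnsClass [PartialOrder A] [StarOrderedRing A] (f : A →ₚ[ℂ] ℂ) :
    DenseRange (gnsClass f) := by
  have h := UniformSpace.Completion.denseRange_coe (α := f.PreGNS)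
  have h2 : Set.range (gnsClass f) = Set.range ((↑) : f.PreGNS → f.GNS) := by
    ext v
    exact ⟨fun ⟨a, ha⟩ => ⟨f.toPreGNS a, ha⟩, fun ⟨a, ha⟩ => ⟨f.ofPreGNS a, ha⟩⟩
  rw [DenseRange, h2]
  exact h

theorem inner_gnsClass [PartialOrder A] [StarOrderedRing A] (f : A →ₚ[ℂ] ℂ) (a b : A) :
    inner ℂ (gnsClass f b) (gnsClass f a) = f (star b * a) :=
  UniformSpace.Completion.inner_coe (𝕜 := ℂ) (f.toPreGNS b) (f.toPreGNS a)

theorem gnsNonUnitalStarAlgHom_gnsClass [PartialOrder A] [StarOrderedRing A] (f : A →ₚ[ℂ] ℂ)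
    (a b : A) : f.gnsNonUnitalStarAlgHom a (gnsClass f b) = gnsClass f (a * b) :=
  PositiveLinearMap.gnsNonUnitalStarAlgHom_apply_coe f

/-- A bounded functional that is positive on the elements `a^* a`, as a positive linear map. -/
noncomputable def positiveLinearMapOf [PartialOrder A] [StarOrderedRing A] (φ : A →L[ℂ] ℂ)
    (hφ : ∀ a, 0 ≤ φ (star a * a)) : A →ₚ[ℂ] ℂ :=
  PositiveLinearMap.mk₀ φ.toLinearMap fun a ha => by
    obtain ⟨b, rfl⟩ := CStarAlgebra.nonneg_iff_eq_star_mul_self.1 ha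
    exact hφ b

/-- Uniqueness of the GNS representation: sending the class of `a` to `π^∞(a)Ω` preserves norms and
has dense range, so it extends to a unitary onto the multiple of `π`, to which the factor and type I
results apply. -/
theorem isTypeIFactorState_of_diagonal [PartialOrder A] [StarOrderedRing A] [Nonempty ι]
    {q : ι → ℝ} (hqpos : ∀ z, 0 < q z) (hq : Summable q) (hπ : HasMatrixUnits π)
    {φ : A →L[ℂ] ℂ} (hφ : IsDiagonalFunctional π q φ) : IsTypeIFactorState φ := by
  have hq0 : ∀ z, 0 ≤ q z := fun z => (hqpos z).le
  have hpos : ∀ a : A, 0 ≤ φ (star a * a) := fun a => by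
    rw [← norm_diagonalGNS_sq hq0 hq hφ]
    exact Complex.zero_le_real.2 (sq_nonneg _)
  let f : A →ₚ[ℂ] ℂ := positiveLinearMapOf φ hpos
  have hf : ∀ a, f a = φ a := fun a => rfl
  have hd₁ := denseRange_gnsClass f
  have hd₂ := denseRange_diagonalGNS hq0 hq hqpos hπ
  have hnorm : ∀ a, ‖diagonalGNS π hq0 hq (LinearEquiv.refl ℂ A a)‖ = ‖gnsClass f a‖ := fun a => by
    rw [norm_eq_sqrt_re_inner (𝕜 := ℂ), norm_eq_sqrt_re_inner (𝕜 := ℂ), inner_gnsClass, hf,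
      LinearEquiv.refl_apply, inner_diagonalGNS hq0 hq hφ]
  let V : f.GNS ≃ₗᵢ[ℂ] lp (fun _ : ι => lp (fun _ : ι => ℂ) 2) 2 :=
    (LinearEquiv.refl ℂ A).extendOfIsometry (gnsClass f) (diagonalGNS π hq0 hq) hd₁ hd₂ hnorm
  have hVe : ∀ a, V (gnsClass f a) = diagonalGNS π hq0 hq a := fun a =>
    LinearEquiv.extendOfIsometry_eq _ _ _ hd₁ hd₂ hnorm a
  have hV : ∀ a v, V (f.gnsNonUnitalStarAlgHom a v) = amplify ι (π a) (V v) := fun a v => by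
    refine hd₁.induction_on v (isClosed_eq ?_ ?_) fun b => ?_
    · exact V.continuous.comp (f.gnsNonUnitalStarAlgHom a).continuous
    · exact (amplify ι (π a)).continuous.comp V.continuous
    · rw [gnsNonUnitalStarAlgHom_gnsClass, hVe, hVe, diagonalGNS_mul]
  have hnt : Nontrivial (lp (fun _ : ι => ℂ) 2) := by
    obtain ⟨o⟩ := ‹Nonempty ι›
    refine ⟨delta o, 0, fun h => ?_⟩
    have h3 := norm_delta o
    rw [h, norm_zero] at h3
    exact zero_ne_one h3
  exact ⟨f, hf, isFactor_bicommutant hπ.hasScalarCommutant V hV,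
    isTypeI_bicommutant hπ.hasScalarCommutant V hV⟩

end DiagonalState

/-! ### The KMS condition and extremality of diagonal states. -/

section DiagonalKMS

variable {A : Type*} [NonUnitalCStarAlgebra A] {ι : Type*}
  {π : A →⋆ₙₐ[ℂ] (lp (fun _ : ι => ℂ) 2 →L[ℂ] lp (fun _ : ι => ℂ) 2)}

theorem IsDiagonalFunctional.nonneg {q : ι → ℝ} (hq0 : ∀ z, 0 ≤ q z) (hq : Summable q)
    {φ : A →L[ℂ] ℂ} (hφ : IsDiagonalFunctional π q φ) (a : A) : 0 ≤ φ (star a * a) := by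
  rw [← norm_diagonalGNS_sq hq0 hq hφ]
  exact Complex.zero_le_real.2 (sq_nonneg _)

/-- The vectors `π(a)u` are total, because matrix units give every `delta w` as a limit of such
vectors; on them convergence follows from `ea → a`. -/
theorem tendsto_map_approximateUnit [PartialOrder A] [StarOrderedRing A] (hπ : HasMatrixUnits π)
    (v : lp (fun _ : ι => ℂ) 2) :
    Filter.Tendsto (fun e => π e v) (CStarAlgebra.approximateUnit A) (𝓝 v) := by
  have hu := CStarAlgebra.increasingApproximateUnit A
  refine tendsto_apply_of_total (T := fun e => π e) (S := ContinuousLinearMap.id ℂ _) (C := 1)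
    (s := {v | ∃ a u, v = π a u}) ?_ ?_ ?_ v
  · filter_upwards [hu.eventually_norm] with e he
    exact (NonUnitalStarAlgHom.norm_apply_le π e).trans he
  · set K := (Submodule.span ℂ {v | ∃ a u, v = π a u}).topologicalClosure with hK
    have hKc : IsClosed (K : Set (lp (fun _ : ι => ℂ) 2)) := Submodule.isClosed_topologicalClosure _
    have hd : ∀ w, delta w ∈ K := fun w => by
      obtain ⟨C, a, -, ha⟩ := hπ w w
      have h1 := ha (delta w)
      rw [delta_apply_self, one_smul] at h1
      exact hKc.mem_of_tendsto h1 (Filter.Eventually.of_forall fun F =>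
        Submodule.le_topologicalClosure _ (Submodule.subset_span ⟨_, _, rfl⟩))
    refine eq_top_iff.2 fun v _ => ?_
    refine hKc.mem_of_tendsto (hasSum_delta v) (Filter.Eventually.of_forall fun s => ?_)
    exact Submodule.sum_mem _ fun z _ => Submodule.smul_mem _ _ (hd z)
  · rintro _ ⟨a, u, rfl⟩
    have h1 := hu.tendsto_mul_right a
    have hc : Continuous fun b => π b u :=
      (ContinuousLinearMap.apply ℂ _ u).continuous.comp
        (AddMonoidHomClass.continuous_of_bound π 1 fun b => by
          rw [one_mul]
          exact NonUnitalStarAlgHom.norm_apply_le π b)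
    refine ((hc.tendsto _).comp h1).congr fun e => ?_
    show π (e * a) u = _
    rw [map_mul]
    rfl

/-- The norm is at most `∑ q_z = 1`. It is at least 1 because `φ(e)` tends to `∑ q_z` along an
approximate unit, by dominated convergence. -/
theorem isState_of_diagonal [PartialOrder A] [StarOrderedRing A] {q : ι → ℝ}
    (hq0 : ∀ z, 0 ≤ q z) (hq : HasSum q 1) (hπ : HasMatrixUnits π)
    {φ : A →L[ℂ] ℂ} (hφ : IsDiagonalFunctional π q φ) : IsState φ := by
  refine ⟨hφ.nonneg hq0 hq.summable, le_antisymm ?_ ?_⟩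
  · refine φ.opNorm_le_bound zero_le_one fun a => ?_
    rw [hφ, ← hq.tsum_eq, ← tsum_mul_right]
    refine tsum_of_norm_bounded (hq.summable.mul_right ‖a‖).hasSum fun z => ?_
    rw [norm_mul, Complex.norm_real, Real.norm_of_nonneg (hq0 z)]
    exact mul_le_mul_of_nonneg_left (norm_matrixCoeff_apply_le z z a) (hq0 z)
  · have hu := CStarAlgebra.increasingApproximateUnit A
    have h1 : Filter.Tendsto (fun e => φ e) (CStarAlgebra.approximateUnit A) (𝓝 1) := by
      have h2 : Filter.Tendsto (fun e => ∑' z, (q z : ℂ) * matrixCoeff π z z e)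
          (CStarAlgebra.approximateUnit A) (𝓝 (∑' z, (q z : ℂ) * 1)) := by
        refine tendsto_tsum_of_dominated_convergence hq.summable (fun z => ?_) ?_
        · refine Filter.Tendsto.const_mul _ ?_
          have h3 := (((innerSL ℂ (delta z : lp (fun _ : ι => ℂ) 2)).continuous.tendsto _).comp
            (tendsto_map_approximateUnit hπ (delta z)))
          simp only [innerSL_apply_apply, inner_delta_left, delta_apply_self] at h3
          refine h3.congr fun e => ?_
          rw [matrixCoeff_apply, ← inner_delta_left]
          rfl
        · filter_upwards [hu.eventually_norm] with e he z
          rw [norm_mul, Complex.norm_real, Real.norm_of_nonneg (hq0 z)]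
          exact mul_le_of_le_one_right (hq0 z) ((norm_matrixCoeff_apply_le z z e).trans he)
      simp only [mul_one, ← Complex.ofReal_tsum, hq.tsum_eq, Complex.ofReal_one] at h2
      exact h2.congr fun e => (hφ e).symm
    have h2 := h1.norm
    rw [norm_one] at h2
    refine le_of_tendsto h2 ?_
    filter_upwards [hu.eventually_norm] with e he
    exact (φ.le_opNorm e).trans (mul_le_of_le_one_right (norm_nonneg _) he)

/-- The time evolution is implemented by the diagonal unitaries `e^{itH}`, `H δ_z = h(z) δ_z`. -/
def IsDiagonalEvolution (π : A →⋆ₙₐ[ℂ] (lp (fun _ : ι => ℂ) 2 →L[ℂ] lp (fun _ : ι => ℂ) 2))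
    (σ : TimeEvolution A) (h : ι → ℝ) : Prop :=
  ∀ (t : ℝ) a w z, matrixCoeff π w z (σ.aut t a) =
    Complex.exp (Complex.I * t * (h w - h z)) * matrixCoeff π w z a

/-- Both sides are entire in `ζ` and agree on the real axis, so the identity theorem applies at 0.
-/
theorem IsDiagonalEvolution.matrixCoeff_extension {σ : TimeEvolution A} {h : ι → ℝ}
    (hσ : IsDiagonalEvolution π σ h) {a : A} {F : ℂ → A} (hF : σ.IsEntireExtension a F) (ζ : ℂ)
    (w z : ι) : matrixCoeff π w z (F ζ) =
      Complex.exp (Complex.I * ζ * (h w - h z)) * matrixCoeff π w z a := by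
  have h1 : AnalyticOnNhd ℂ (fun ζ => matrixCoeff π w z (F ζ)) Set.univ :=
    ((matrixCoeff π w z).differentiable.comp hF.1).differentiableOn.analyticOnNhd isOpen_univ
  have h2 : AnalyticOnNhd ℂ (fun ζ : ℂ =>
      Complex.exp (Complex.I * ζ * (h w - h z)) * matrixCoeff π w z a) Set.univ := by
    refine DifferentiableOn.analyticOnNhd ?_ isOpen_univ
    fun_prop
  have h3 : ∃ᶠ ζ in 𝓝[≠] (0 : ℂ), matrixCoeff π w z (F ζ) =
      Complex.exp (Complex.I * ζ * (h w - h z)) * matrixCoeff π w z a := by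
    have h4 : Filter.Tendsto (fun t : ℝ => (t : ℂ)) (𝓝[≠] 0) (𝓝[≠] 0) := by
      refine tendsto_nhdsWithin_iff.2 ⟨?_, ?_⟩
      · exact (Complex.continuous_ofReal.tendsto' 0 0 Complex.ofReal_zero).mono_left
          nhdsWithin_le_nhds
      · filter_upwards [self_mem_nhdsWithin] with t ht
        simpa using ht
    refine h4.frequently (Filter.Eventually.frequently (Filter.Eventually.of_forall fun t => ?_))
    rw [hF.2, hσ]
  exact congrFun (h1.eq_of_frequently_eq h2 h3) ζ

/-- In matrix entries both sides are double sums of `q_w a_{wy} b_{yw}`: at `iβ` the evolution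
multiplies `a_{wy}` by `e^{-β(h_w - h_y)}`, which changes the weight `q_y` into `q_w`. Only the
order of summation differs. -/
theorem IsDiagonalEvolution.kms {σ : TimeEvolution A} {h : ι → ℝ}
    (hσ : IsDiagonalEvolution π σ h) {β k : ℝ} {q : ι → ℝ} (hq0 : ∀ z, 0 ≤ q z) (hq : Summable q)
    (hqh : ∀ z, q z = k * Real.exp (-β * h z))
    {φ : A →L[ℂ] ℂ} (hφ : IsDiagonalFunctional π q φ) {a : A} (b : A) {F : ℂ → A}
    (hF : σ.IsEntireExtension a F) : φ (a * b) = φ (b * F (Complex.I * β)) := by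
  set G : ι → ι → ℂ := fun w y => q w * (matrixCoeff π w y a * matrixCoeff π y w b) with hG
  have hsum : Summable fun p : ι × ι => G p.1 p.2 := by
    apply Summable.of_norm
    -- By Hölder the sum over `y` is at most `q w ‖a*‖ ‖b‖`, which is summable in `w`.
    rw [summable_prod_of_nonneg fun _ => norm_nonneg _]
    have h1 := fun w => (deltaBasis ι).summable_norm_inner_mul_inner (π (star a) (delta w))
      (π b (delta w))
    have h2 : ∀ w y, ‖G w y‖ = q w * (‖inner ℂ (π (star a) (delta w)) (deltaBasis ι y)‖ *
        ‖inner ℂ (deltaBasis ι y) (π b (delta w))‖) := fun w y => by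
      rw [hG, norm_mul, norm_mul, Complex.norm_real, Real.norm_of_nonneg (hq0 w), deltaBasis_apply,
        inner_delta_left, matrixCoeff_apply, matrixCoeff_apply, ← inner_delta_left w, map_star,
        ContinuousLinearMap.star_eq_adjoint, ContinuousLinearMap.adjoint_inner_left]
    simp only [h2, tsum_mul_left]
    refine ⟨fun w => (h1 w).1.mul_left _, ?_⟩
    refine Summable.of_nonneg_of_le
      (fun w => mul_nonneg (hq0 w) (tsum_nonneg fun y => by positivity))
      (fun w => mul_le_mul_of_nonneg_left ((h1 w).2.trans (mul_le_mul (norm_map_delta_le _ _)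
        (norm_map_delta_le _ _) (norm_nonneg _) (norm_nonneg _))) (hq0 w)) (hq.mul_right _)
  have h1 : φ (a * b) = ∑' w, ∑' y, G w y := by
    rw [hφ]
    refine tsum_congr fun w => ?_
    rw [← (hasSum_matrixCoeff_mul w w a b).tsum_eq, ← tsum_mul_left]
  have h2 : φ (b * F (Complex.I * β)) = ∑' y, ∑' w, G w y := by
    rw [hφ]
    refine tsum_congr fun y => ?_
    rw [← (hasSum_matrixCoeff_mul y y b _).tsum_eq, ← tsum_mul_left]
    refine tsum_congr fun w => ?_
    rw [hσ.matrixCoeff_extension hF, hG]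
    simp only [hqh]
    push_cast
    have h3 : Complex.exp (-β * h w) = Complex.exp (-β * h y) *
        Complex.exp (Complex.I * (Complex.I * β) * (h w - h y)) := by
      rw [← Complex.exp_add]
      congr 1
      rw [← mul_assoc, Complex.I_mul_I]
      ring
    rw [h3]
    ring
  rw [h1, h2]
  exact (Summable.tsum_comm (f := G) hsum).symm

/-- Every matrix unit is the limit of a bounded net of `σ`-analytic elements, compatibly with the
adjoint and with `σ_{iβ}`. -/
def HasAnalyticMatrixUnits
    (π : A →⋆ₙₐ[ℂ] (lp (fun _ : ι => ℂ) 2 →L[ℂ] lp (fun _ : ι => ℂ) 2))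
    (σ : TimeEvolution A) (β : ℝ) : Prop :=
  ∀ z w : ι, ∃ C : ℝ, ∀ S : Finset ι, ∃ (a : A) (F F' : ℂ → A),
    σ.IsEntireExtension a F ∧ σ.IsEntireExtension (star a) F' ∧
    ‖a‖ ≤ C ∧ ‖F' (Complex.I * β)‖ ≤ C ∧
    π a (delta z) = delta w ∧ π (star a) (delta w) = delta z ∧
    (∀ y ∈ S, y ≠ z → π a (delta y) = 0) ∧ (∀ y ∈ S, y ≠ w → π (star a) (delta y) = 0)

theorem HasAnalyticMatrixUnits.hasMatrixUnits {σ : TimeEvolution A} {β : ℝ}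
    (hπ : HasAnalyticMatrixUnits π σ β) : HasMatrixUnits π := by
  intro z w
  obtain ⟨C, h⟩ := hπ z w
  choose a F F' _ _ h1 _ h2 _ h3 _ using h
  have hC : ∀ S, ‖π (a S)‖ ≤ C := fun S => (NonUnitalStarAlgHom.norm_apply_le π _).trans (h1 S)
  refine ⟨C, a, hC, fun v => ?_⟩
  simpa using tendsto_matrixUnit (t := 1) hC le_rfl (by simpa using h2) h3 v

/-- Take `b` to be the adjoint of an element of an approximate unit and pass to the limit. -/
theorem eq_smul_of_mul_eq [PartialOrder A] [StarOrderedRing A] {φ ψ : A →L[ℂ] ℂ} {t : ℂ}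
    (h : ∀ a b, ψ (star b * a) = t * φ (star b * a)) : ψ = t • φ := by
  ext a
  have hu := CStarAlgebra.increasingApproximateUnit A
  have h1 := hu.tendsto_mul_right a
  have h2 := (ψ.continuous.tendsto _).comp h1
  have h3 := ((t • φ).continuous.tendsto _).comp h1
  have := hu.neBot
  refine tendsto_nhds_unique h2 (h3.congr fun e => ?_)
  have h4 := h a (star e)
  rw [star_star] at h4
  exact h4.symm

/-- A positive functional dominated by a diagonal one is implemented by a positive operator in the
commutant. -/
theorem exists_operator_of_le [PartialOrder A] [StarOrderedRing A] {q : ι → ℝ}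
    (hqpos : ∀ z, 0 < q z) (hq : Summable q) (hπ : HasMatrixUnits π)
    {φ ψ : A →L[ℂ] ℂ} (hφ : IsDiagonalFunctional π q φ) (hψ : ∀ a, 0 ≤ ψ (star a * a)) {C : ℝ}
    (hC : 0 ≤ C) (hle : ∀ a, (ψ (star a * a)).re ≤ C * (φ (star a * a)).re) :
    ∃ T : lp (fun _ : ι => lp (fun _ : ι => ℂ) 2) 2 →L[ℂ] lp (fun _ : ι => lp (fun _ : ι => ℂ) 2) 2,
      (∀ v, 0 ≤ inner ℂ v (T v)) ∧
      (∀ a v, T (amplify ι (π a) v) = amplify ι (π a) (T v)) ∧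
      ∀ a b, inner ℂ (diagonalGNS π (fun z => (hqpos z).le) hq b)
        (T (diagonalGNS π (fun z => (hqpos z).le) hq a)) = ψ (star b * a) := by
  have hq0 : ∀ z, 0 ≤ q z := fun z => (hqpos z).le
  set L := diagonalGNS π (fun z => (hqpos z).le) hq with hL
  have hd : DenseRange L := denseRange_diagonalGNS hq0 hq hqpos hπ
  let f := positiveLinearMapOf ψ hψ
  have hf : ∀ a, f a = ψ a := fun _ => rfl
  have hnorm : ∀ a, ‖gnsClass f a‖ ≤ Real.sqrt C * ‖L a‖ := fun a => by
    rw [norm_eq_sqrt_re_inner (𝕜 := ℂ), norm_eq_sqrt_re_inner (𝕜 := ℂ), inner_gnsClass, hf,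
      hL, inner_diagonalGNS hq0 hq hφ, ← Real.sqrt_mul hC]
    exact Real.sqrt_le_sqrt (hle a)
  -- A Radon–Nikodym argument: domination makes the passage from the GNS space of `φ` to that of `ψ`
  -- bounded, and `W* W` is the density.
  let W := (gnsClass f).extendOfNorm L
  have hW : ∀ a, W (L a) = gnsClass f a := fun a =>
    LinearMap.extendOfNorm_eq hd ⟨_, hnorm⟩ a
  have hT : ∀ u v, inner ℂ u ((W.adjoint ∘L W) v) = inner ℂ (W u) (W v) := fun u v =>
    ContinuousLinearMap.adjoint_inner_right W u (W v)
  have hTL : ∀ a b, inner ℂ (L b) ((W.adjoint ∘L W) (L a)) = ψ (star b * a) := fun a b => by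
    rw [hT, hW, hW, inner_gnsClass, hf]
  refine ⟨W.adjoint ∘L W, fun v => ?_, fun c v => ?_, hTL⟩
  · rw [hT, inner_self_eq_norm_sq_to_K]
    have h1 := Complex.zero_le_real.2 (sq_nonneg ‖W v‖)
    rwa [Complex.ofReal_pow] at h1
  · refine ext_inner_left ℂ fun u => ?_
    -- On the dense vectors `L b` and `L a` both sides equal `ψ(b* c a)`.
    refine hd.induction_on₂ (p := fun u v => inner ℂ u ((W.adjoint ∘L W) (amplify ι (π c) v)) =
      inner ℂ u (amplify ι (π c) ((W.adjoint ∘L W) v))) ?_ ?_ u v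
    · exact isClosed_eq (by fun_prop) (by fun_prop)
    · intro b a
      rw [← diagonalGNS_mul, ← hL, hTL]
      have h1 : inner ℂ (L b) (amplify ι (π c) ((W.adjoint ∘L W) (L a))) =
          inner ℂ (amplify ι (π (star c)) (L b)) ((W.adjoint ∘L W) (L a)) := by
        rw [map_star, amplify_star, ContinuousLinearMap.star_eq_adjoint,
          ContinuousLinearMap.adjoint_inner_left]
      rw [h1, hL, ← diagonalGNS_mul, ← hL, hTL, star_mul, star_star, mul_assoc]

/-- The density of `ψ` relative to `φ` lies in the commutant of a multiple of `π`, so it is a matrix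
`t` of scalars. The KMS identity for `ψ` on matrix units forces `t` to be a multiple of the
identity, and normalisation makes the multiple 1. -/
theorem eq_of_isKMSState_of_le [PartialOrder A] [StarOrderedRing A] [Nonempty ι]
    {σ : TimeEvolution A} {h : ι → ℝ}
    (hσ : IsDiagonalEvolution π σ h) {β k : ℝ} {q : ι → ℝ} (hqpos : ∀ z, 0 < q z) (hq : Summable q)
    (hqh : ∀ z, q z = k * Real.exp (-β * h z)) (hπ : HasAnalyticMatrixUnits π σ β)
    {φ ψ : A →L[ℂ] ℂ} (hφ : IsDiagonalFunctional π q φ) (hφs : IsState φ) (hψ : IsKMSState σ β ψ)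
    {C : ℝ} (hC : 0 ≤ C) (hle : ∀ a, (ψ (star a * a)).re ≤ C * (φ (star a * a)).re) : ψ = φ := by
  have hq0 : ∀ z, 0 ≤ q z := fun z => (hqpos z).le
  have hmu := hπ.hasMatrixUnits
  obtain ⟨T, hTpos, hTc, hT⟩ := exists_operator_of_le hqpos hq hmu hφ hψ.1.1 hC hle
  obtain ⟨t, ht⟩ := hmu.hasScalarCommutant.exists_matrix T hTc
  have htd : ∀ z w u u', inner ℂ (summandIncl w u) (T (summandIncl z u')) =
      t w z * inner ℂ u u' := fun z w u u' => by
    rw [inner_summandIncl_left, ht, inner_smul_right]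
  obtain ⟨o⟩ := ‹Nonempty ι›
  -- Let `a` tend to `δ_z ↦ δ_o` and `b` to `δ_{z'} ↦ δ_o`, and pass to the limit in `ψ(a* b) = ψ(b
  -- σ_{iβ}(a*))`. The left side tends to `√q_z √q_{z'} t_{zz'}`; on the right `σ_{iβ}(a*)` tends to
  -- `e^{-β(h_z - h_o)}` times `δ_o ↦ δ_z`, which leaves only `t_{oo}`.
  have key : ∀ z z', (Real.sqrt (q z) * Real.sqrt (q z') : ℂ) * t z z' =
      q o * (Real.exp (-β * (h z - h o)) * t o o) * inner ℂ (delta z' : lp (fun _ : ι => ℂ) 2)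
        (delta z) := by
    intro z z'
    obtain ⟨C₁, h₁⟩ := hπ z o
    obtain ⟨C₂, h₂⟩ := hπ z' o
    choose a Fa Fa' a1 a2 a3 a4 a5 a6 a7 a8 using h₁
    choose b Fb Fb' b1 b2 b3 b4 b5 b6 b7 b8 using h₂
    have hbd : ∀ {x : A} {C : ℝ}, ‖x‖ ≤ C → ‖π x‖ ≤ C := fun hx =>
      (NonUnitalStarAlgHom.norm_apply_le π _).trans hx
    have l1 := tendsto_diagonalGNS hq0 hq (z := z) (w := o) (t := 1) (fun S => hbd (a3 S))
      fun v => tendsto_matrixUnit (t := 1) (fun S => hbd (a3 S)) le_rfl (by simpa using a5) a7 v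
    have l2 := tendsto_diagonalGNS hq0 hq (z := z') (w := o) (t := 1) (fun S => hbd (b3 S))
      fun v => tendsto_matrixUnit (t := 1) (fun S => hbd (b3 S)) le_rfl (by simpa using b5) b7 v
    have b3' : ∀ S, ‖star (b S)‖ ≤ C₂ := fun S => by rw [norm_star]; exact b3 S
    have l3 := tendsto_diagonalGNS hq0 hq (a := fun S => star (b S)) (z := o) (w := z') (t := 1)
      (fun S => hbd (b3' S))
      fun v => tendsto_matrixUnit (T := fun S => π (star (b S))) (t := 1) (fun S => hbd (b3' S))
        le_rfl (by simpa using b6) b8 v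
    have hcoef : ∀ S y w, π (Fa' S (Complex.I * β)) (delta y) w =
        Real.exp (-β * (h w - h y)) * π (star (a S)) (delta y) w := fun S y w => by
      have h3 := hσ.matrixCoeff_extension (a2 S) (Complex.I * β) w y
      rw [matrixCoeff_apply, matrixCoeff_apply] at h3
      rw [h3, ← mul_assoc, Complex.I_mul_I]
      push_cast
      ring_nf
    have l4 := tendsto_diagonalGNS hq0 hq (a := fun S => Fa' S (Complex.I * β)) (z := o) (w := z)
      (t := Real.exp (-β * (h z - h o))) (fun S => hbd (a4 S)) fun v => by
        refine tendsto_matrixUnit (T := fun S => π (Fa' S (Complex.I * β)))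
          (fun S => hbd (a4 S)) le_rfl ?_ ?_ v
        · intro S
          ext w
          rw [hcoef, a6, lp.coeFn_smul, Pi.smul_apply, smul_eq_mul]
          by_cases hw : w = z
          · rw [hw]
          · rw [delta_apply_ne hw, mul_zero, mul_zero]
        · intro S y hy hyo
          ext w
          rw [hcoef, a8 S y hy hyo]
          simp
    have hL := (l1.inner ((T.continuous.tendsto _).comp l2) (𝕜 := ℂ))
    have hR := (l3.inner ((T.continuous.tendsto _).comp l4) (𝕜 := ℂ))
    have heq : ∀ S, inner ℂ (diagonalGNS π hq0 hq (a S)) (T (diagonalGNS π hq0 hq (b S))) =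
        inner ℂ (diagonalGNS π hq0 hq (star (b S)))
          (T (diagonalGNS π hq0 hq (Fa' S (Complex.I * β)))) := fun S => by
      rw [hT, hT, star_star]
      exact hψ.2 _ _ _ _ (a2 S) (b1 S)
    have hlim := tendsto_nhds_unique (hL.congr heq) hR
    rw [htd, htd] at hlim
    simp only [inner_smul_left, inner_smul_right, mul_one, Complex.conj_ofReal, inner_delta_left,
      delta_apply_self] at hlim
    have hso : (Real.sqrt (q o) : ℂ) * Real.sqrt (q o) = q o := by
      rw [← Complex.ofReal_mul, Real.mul_self_sqrt (hq0 o)]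
    rw [inner_delta_left, ← hso]
    linear_combination hlim
  have htz : ∀ z z', t z z' = t o o * inner ℂ (delta z' : lp (fun _ : ι => ℂ) 2) (delta z) := by
    intro z z'
    have h1 := key z z'
    have hpos : (0 : ℝ) < Real.sqrt (q z) * Real.sqrt (q z') :=
      mul_pos (Real.sqrt_pos.2 (hqpos z)) (Real.sqrt_pos.2 (hqpos z'))
    have hne : (Real.sqrt (q z) * Real.sqrt (q z') : ℂ) ≠ 0 := by exact_mod_cast hpos.ne'
    rw [inner_delta_left] at h1 ⊢
    by_cases hz : z' = z
    · subst hz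
      rw [delta_apply_self, mul_one] at h1 ⊢
      -- The Gibbs form of the weights makes the factor `e^{-β(h_z - h_o)}` cancel, so the diagonal
      -- of `t` is constant.
      have h2 : q o * Real.exp (-β * (h z' - h o)) = q z' := by
        rw [hqh, hqh z', mul_assoc, ← Real.exp_add]
        ring_nf
      have h3 : (Real.sqrt (q z') : ℂ) * Real.sqrt (q z') = q z' := by
        rw [← Complex.ofReal_mul, Real.mul_self_sqrt (hq0 z')]
      have hqz : (q z' : ℂ) ≠ 0 := by exact_mod_cast (hqpos z').ne'
      rw [h3, ← mul_assoc, ← Complex.ofReal_mul, h2] at h1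
      exact mul_left_cancel₀ hqz h1
    · rw [delta_apply_ne hz, mul_zero] at h1 ⊢
      exact (mul_eq_zero.1 h1).resolve_left hne
  have hTs : T = t o o • (1 : lp (fun _ : ι => lp (fun _ : ι => ℂ) 2) 2 →L[ℂ] _) := by
    refine ext_summandIncl fun z u => ?_
    ext w : 2
    rw [ht, htz, inner_delta_left, smul_apply, one_apply_eq_self, lp.coeFn_smul, Pi.smul_apply]
    by_cases hw : w = z
    · subst hw
      rw [delta_apply_self, mul_one, summandIncl_apply_self]
    · rw [delta_apply_ne (Ne.symm hw), summandIncl_apply_ne hw, mul_zero, zero_smul, smul_zero]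
  have hψφ : ψ = t o o • φ := eq_smul_of_mul_eq fun a b => by
    rw [← hT, hTs, smul_apply, one_apply_eq_self, inner_smul_right, inner_diagonalGNS hq0 hq hφ]
  have ht0 : 0 ≤ t o o := by
    have h1 := hTpos (summandIncl o (delta o))
    rwa [htd, inner_delta_left, delta_apply_self, mul_one] at h1
  have ht1 : t o o = 1 := by
    have h1 := hψ.1.2
    rw [hψφ, norm_smul, hφs.2, mul_one] at h1
    rw [← Complex.norm_of_nonneg' ht0, h1, Complex.ofReal_one]
  rw [hψφ, ht1, one_smul]

/-- In a convex decomposition with weight `x` on `ψ₁`, positivity of the other summand gives `ψ₁ ≤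
x⁻¹ φ`, and `eq_of_isKMSState_of_le` identifies `ψ₁` with `φ`. -/
theorem isExtremalKMSState_of_diagonal [PartialOrder A] [StarOrderedRing A] [Nonempty ι]
    {σ : TimeEvolution A} {h : ι → ℝ}
    (hσ : IsDiagonalEvolution π σ h) {β k : ℝ} {q : ι → ℝ} (hqpos : ∀ z, 0 < q z) (hq : HasSum q 1)
    (hqh : ∀ z, q z = k * Real.exp (-β * h z)) (hπ : HasAnalyticMatrixUnits π σ β)
    {φ : A →L[ℂ] ℂ} (hφ : IsDiagonalFunctional π q φ) : IsExtremalKMSState σ β φ := by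
  have hq0 : ∀ z, 0 ≤ q z := fun z => (hqpos z).le
  have hs : IsState φ := isState_of_diagonal hq0 hq hπ.hasMatrixUnits hφ
  refine mem_extremePoints_iff_left.2 ⟨⟨hs, fun a b F _ hF _ => ?_⟩, ?_⟩
  · exact hσ.kms hq0 hq.summable hqh hφ b hF
  · rintro ψ₁ hψ₁ ψ₂ hψ₂ ⟨x, y, hx, hy, hxy, rfl⟩
    refine eq_of_isKMSState_of_le hσ hqpos hq.summable hqh hπ hφ hs hψ₁ (inv_nonneg.2 hx.le)
      fun a => ?_
    have h1 : ((x • ψ₁ + y • ψ₂) (star a * a)).re =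
        x * (ψ₁ (star a * a)).re + y * (ψ₂ (star a * a)).re := by
      simp
    rw [h1, mul_add, ← mul_assoc, inv_mul_cancel₀ hx.ne', one_mul]
    have h2 : 0 ≤ (ψ₂ (star a * a)).re := (Complex.nonneg_iff.1 (hψ₂.1.1 a)).1
    have h3 : 0 ≤ x⁻¹ * (y * (ψ₂ (star a * a)).re) := by positivity
    linarith

end DiagonalKMS

/-! ### The operators `e^{-sH}`, uniqueness of the density operator, and admissible triples. -/

section PartitionFunction

theorem norm_le_of_diagonal {ι H : Type*} [NormedAddCommGroup H] [InnerProductSpace ℂ H]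
    [CompleteSpace H] (b : HilbertBasis ι ℂ H) {T : H →L[ℂ] H} {d : ι → ℂ}
    (hT : ∀ i, T (b i) = d i • b i) {k : ℝ} (hk : 0 ≤ k) (hd : ∀ i, ‖d i‖ ≤ k) : ‖T‖ ≤ k := by
  refine T.opNorm_le_bound hk fun v => ?_
  rw [← sq_le_sq₀ (norm_nonneg _) (by positivity), mul_pow]
  refine hasSum_le (fun i => ?_) (b.hasSum_norm_inner_sq (T v))
    ((b.hasSum_norm_inner_sq v).mul_left (k ^ 2))
  have h1 : inner ℂ (b i) (T v) = d i * inner ℂ (b i) v := by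
    rw [← ContinuousLinearMap.adjoint_inner_left, ← ContinuousLinearMap.star_eq_adjoint,
      star_apply_of_diagonal b hT, inner_smul_left, Complex.conj_conj]
  rw [h1, norm_mul, mul_pow]
  gcongr
  exact hd i

variable {ι : Type*}

theorem norm_exp_neg_mul (s : ℂ) (t : ℝ) : ‖Complex.exp (-s * t)‖ = Real.exp (-s.re * t) := by
  rw [Complex.norm_exp]
  simp

theorem expDiagonal_delta {h : ι → ℝ} {s : ℂ} (hs : Summable fun z => Real.exp (-s.re * h z))
    (z : ι) : expDiagonal h s (delta z) = Complex.exp (-s * h z) • delta z := by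
  -- `diagonalOp` is 0 unless its entries are bounded; each modulus is a term of the convergent
  -- positive series, so the total is a bound.
  refine diagonalOp_delta (C := ∑' z, Real.exp (-s.re * h z)) (fun i => ?_) z
  rw [norm_exp_neg_mul]
  exact hs.le_tsum i fun _ _ => (Real.exp_pos _).le

theorem isTraceClass_expDiagonal {h : ι → ℝ} {s : ℂ}
    (hs : Summable fun z => Real.exp (-s.re * h z)) :
    IsTraceClass (expDiagonal h s) ∧
      operatorTrace (expDiagonal h s) = ∑' z, Complex.exp (-s * h z) :=
  isTraceClass_of_diagonal (deltaBasis ι) (by simpa using expDiagonal_delta hs)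
    (by simpa only [norm_exp_neg_mul] using hs)

/-- `e^{-βH} = S* S` with `S = e^{-βH/2}`, which is bounded because `h ≥ 0`. -/
theorem isPositive_expDiagonal {h : ι → ℝ} {β : ℝ} (hs : Summable fun z => Real.exp (-β * h z))
    (hβ : 0 ≤ β) (h0 : ∀ z, 0 ≤ h z) : (expDiagonal h β).IsPositive := by
  let S := diagonalOp fun z => ((Real.exp (-(β / 2) * h z) : ℝ) : ℂ)
  have hS : ∀ z, S (delta z) = ((Real.exp (-(β / 2) * h z) : ℝ) : ℂ) • delta z := fun z => by
    refine diagonalOp_delta (C := 1) (fun i => ?_) z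
    rw [Complex.norm_real, Real.norm_of_nonneg (Real.exp_pos _).le, Real.exp_le_one_iff]
    nlinarith [mul_nonneg hβ (h0 i)]
  have h1 : expDiagonal h β = star S * S := by
    refine ext_delta fun z => ?_
    have h2 := star_apply_of_diagonal (deltaBasis ι) (T := S)
      (d := fun z => ((Real.exp (-(β / 2) * h z) : ℝ) : ℂ))
      (fun z => by rw [deltaBasis_apply, hS]) z
    rw [deltaBasis_apply, Complex.conj_ofReal] at h2
    rw [expDiagonal_delta (by simpa using hs), mul_apply_eq_comp, hS, map_smul, h2, smul_smul,
      ← Complex.ofReal_mul, ← Real.exp_add]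
    push_cast
    ring_nf
  rw [h1, ← ContinuousLinearMap.nonneg_iff_isPositive]
  exact star_mul_self_nonneg S

theorem norm_expDiagonal {h : ι → ℝ} {β : ℝ} (hs : Summable fun z => Real.exp (-β * h z))
    (hβ : 0 ≤ β) (h0 : ∀ z, 0 ≤ h z) {z₀ : ι} (hz₀ : h z₀ = 0) : ‖expDiagonal h (β : ℂ)‖ = 1 := by
  have hd := expDiagonal_delta (h := h) (s := β) (by simpa using hs)
  refine le_antisymm (norm_le_of_diagonal (deltaBasis ι)
    (d := fun z => Complex.exp (-(β : ℂ) * h z)) (fun z => by rw [deltaBasis_apply, hd])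
    zero_le_one fun i => ?_) ?_
  · rw [norm_exp_neg_mul, Complex.ofReal_re, Real.exp_le_one_iff]
    nlinarith [mul_nonneg hβ (h0 i)]
  · have h1 := (expDiagonal h (β : ℂ)).le_opNorm (delta z₀)
    rw [hd, hz₀] at h1
    simpa [norm_delta] using h1

theorem separableSpace_lp [Countable ι] : TopologicalSpace.SeparableSpace (lp (fun _ : ι => ℂ) 2) := by
  have h1 : TopologicalSpace.IsSeparable (Set.range fun z : ι => (delta z : lp (fun _ : ι => ℂ) 2)) :=
    (Set.countable_range _).isSeparable
  have h2 := (h1.span (R := ℂ)).closure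
  rw [← Submodule.topologicalClosure_coe, topologicalClosure_span_delta, Submodule.top_coe] at h2
  exact TopologicalSpace.isSeparable_univ_iff.1 h2

variable {A : Type*} [NonUnitalCStarAlgebra A]
  {π : A →⋆ₙₐ[ℂ] (lp (fun _ : ι => ℂ) 2 →L[ℂ] lp (fun _ : ι => ℂ) 2)}

/-- A density operator that implements a diagonal functional in an irreducible representation is
itself diagonal, with the same spectral data. -/
theorem exists_eigenbasis_of_trace [Nonempty ι] {q : ι → ℝ} (hqpos : ∀ z, 0 < q z) (hq : Summable q)
    (hπ : HasMatrixUnits π) {φ : A →L[ℂ] ℂ} (hφ : IsDiagonalFunctional π q φ) (hφ0 : φ ≠ 0)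
    {H : Type*} [NormedAddCommGroup H] [InnerProductSpace ℂ H] [CompleteSpace H]
    {π' : A →⋆ₙₐ[ℂ] (H →L[ℂ] H)} (hirr : IsIrreducibleRep π') {ρ : H →L[ℂ] H}
    (hρ : ρ.IsPositive) (htr : IsTraceClass ρ)
    (hφ' : ∀ a, φ a = operatorTrace (π' a * ρ) / operatorTrace ρ) :
    ∃ (b : HilbertBasis ι ℂ H) (k : ℂ), ∀ z, ρ (b z) = (k * q z) • b z := by
  have hq0 : ∀ z, 0 ≤ q z := fun z => (hqpos z).le
  obtain ⟨S, hSa, hSS, hsum, htrace⟩ := operatorTrace_mul_eq hρ htr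
  set e := stdBasis H with he
  have hadj : ∀ x y, inner ℂ x (S y) = inner ℂ (S x) y := fun x y => by
    rw [← ContinuousLinearMap.adjoint_inner_left, hSa]
  set τ : ℝ := ∑' i, ‖S (e i)‖ ^ 2 with hτ
  have hτ0 : 0 ≤ τ := tsum_nonneg fun i => sq_nonneg _
  have hτtr : operatorTrace ρ = τ := by
    have h1 := htrace 1
    rw [one_mul] at h1
    rw [h1, hτ, Complex.ofReal_tsum]
    refine tsum_congr fun i => ?_
    rw [one_apply_eq_self, inner_self_eq_norm_sq_to_K]
    push_cast
    rfl
  -- If the trace vanished, the quotient defining `φ` would be 0 by the convention for division.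
  have hτne : (τ : ℂ) ≠ 0 := by
    intro h0
    apply hφ0
    ext a
    rw [hφ', hτtr, h0, div_zero]
    rfl
  have htφ : ∀ a, (τ : ℂ) * φ a = ∑' i, inner ℂ (S (e i)) (π' a (S (e i))) := fun a => by
    rw [hφ', hτtr, mul_div_cancel₀ _ hτne, htrace]
  -- Each `‖π' a (S e_i)‖²` is one term of a positive series with sum `τ φ(a* a) = τ ‖π^∞(a)Ω‖²`.
  -- Hence `π^∞(a)Ω ↦ π'(a) S e_i` is well defined and bounded.
  have hbound : ∀ i a, ‖π' a (S (e i))‖ ^ 2 ≤ τ * ‖diagonalGNS π hq0 hq a‖ ^ 2 := fun i a => by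
    have hs : Summable fun i => ‖π' a (S (e i))‖ ^ 2 := by
      refine Summable.of_nonneg_of_le (fun i => by positivity) (fun i => ?_)
        (hsum.mul_left (‖π' a‖ ^ 2))
      rw [← mul_pow]
      gcongr
      exact (π' a).le_opNorm _
    refine (hs.le_tsum i fun _ _ => sq_nonneg _).trans (le_of_eq ?_)
    have h1 := htφ (star a * a)
    rw [← norm_diagonalGNS_sq hq0 hq hφ] at h1
    have h2 : ∀ i, inner ℂ (S (e i)) (π' (star a * a) (S (e i))) =
        ((‖π' a (S (e i))‖ ^ 2 : ℝ) : ℂ) := fun i => by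
      rw [map_mul, map_star, ContinuousLinearMap.star_eq_adjoint, mul_apply_eq_comp,
        ContinuousLinearMap.adjoint_inner_right, inner_self_eq_norm_sq_to_K]
      push_cast
      rfl
    simp only [h2, ← Complex.ofReal_tsum] at h1
    exact_mod_cast h1.symm
  obtain ⟨i₀, hi₀⟩ : ∃ i, S (e i) ≠ 0 := by
    by_contra! h0
    refine hτne ?_
    simp [hτ, h0]
  set v := S (e i₀) with hv
  have hd := denseRange_diagonalGNS hq0 hq hqpos hπ
  let L : A →ₗ[ℂ] H :=
    { toFun := fun a => π' a v
      map_add' := fun a b => by rw [map_add]; rfl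
      map_smul' := fun t a => by rw [map_smul]; rfl }
  have hL : ∀ a, ‖L a‖ ≤ Real.sqrt τ * ‖diagonalGNS π hq0 hq a‖ := fun a => by
    rw [← sq_le_sq₀ (norm_nonneg _) (by positivity), mul_pow, Real.sq_sqrt hτ0]
    exact hbound i₀ a
  let W₀ := L.extendOfNorm (diagonalGNS π hq0 hq)
  have hW₀ : ∀ a, W₀ (diagonalGNS π hq0 hq a) = π' a v := fun a =>
    LinearMap.extendOfNorm_eq hd ⟨_, hL⟩ a
  have hW₀c : ∀ a x, W₀ (amplify ι (π a) x) = π' a (W₀ x) := fun a x => by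
    refine hd.induction_on x (isClosed_eq (by fun_prop) (by fun_prop)) fun b => ?_
    rw [← diagonalGNS_mul, hW₀, hW₀, map_mul]
    rfl
  -- The common kernel of all `π' a` is closed and invariant; it is not everything because `π'` is
  -- nonzero, so it is 0 and does not contain `v`.
  obtain ⟨a₀, ha₀⟩ : ∃ a, π' a v ≠ 0 := by
    by_contra! h0
    let K : Submodule ℂ H := ⨅ a, LinearMap.ker (π' a).toLinearMap
    have hK : ∀ u, u ∈ K ↔ ∀ a, π' a u = 0 := fun u => by
      simp [K, Submodule.mem_iInf]
    have hKc : IsClosed (K : Set H) := by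
      have : (K : Set H) = ⋂ a, {u | π' a u = 0} := by
        ext u
        simp [hK]
      rw [this]
      exact isClosed_iInter fun a => isClosed_eq (π' a).continuous continuous_const
    rcases hirr.2 K hKc fun a u hu => (hK _).2 fun b => by
      rw [(hK u).1 hu a, map_zero] with h1 | h1
    · have h2 : v ∈ K := (hK v).2 h0
      rw [h1] at h2
      exact hi₀ ((Submodule.mem_bot ℂ).1 h2)
    · obtain ⟨a, ha⟩ := hirr.1
      refine ha (ContinuousLinearMap.ext fun u => ?_)
      have h2 : u ∈ K := by
        rw [h1]
        trivial
      exact (hK u).1 h2 a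
  obtain ⟨z₁, hz₁⟩ : ∃ z, W₀ ∘L summandIncl z ≠ 0 := by
    by_contra! h0
    have h1 : W₀ = 0 := ext_summandIncl fun z u => by
      exact congrArg (fun R : lp (fun _ : ι => ℂ) 2 →L[ℂ] H => R u) (h0 z)
    apply ha₀
    rw [← hW₀, h1]
    rfl
  -- A nonzero intertwiner that is nonzero on some summand restricts there to an intertwiner from
  -- `π` itself, so `π'` is unitarily equivalent to `π`.
  obtain ⟨U, hU⟩ := exists_unitary_intertwiner hπ.hasScalarCommutant hirr _ hz₁ fun a u => by
    show W₀ (summandIncl z₁ (π a u)) = π' a (W₀ (summandIncl z₁ u))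
    rw [← amplify_summandIncl, hW₀c]
  let x : stdIndex H → lp (fun _ : ι => ℂ) 2 := fun i => U.symm (S (e i))
  have hx : ∀ i, U (x i) = S (e i) := fun i => U.apply_symm_apply _
  have hxnorm : ∀ i, ‖x i‖ = ‖S (e i)‖ := fun i => U.symm.norm_map _
  have hxφ : ∀ a, ∑' i, inner ℂ (x i) (π a (x i)) =
      (τ : ℂ) * ∑' z, (q z : ℂ) * matrixCoeff π z z a := fun a => by
    rw [← hφ, htφ]
    refine tsum_congr fun i => ?_
    rw [← U.inner_map_map, hU, hx]
  -- Evaluate both expressions for `τ φ` on a net tending to the matrix unit `δ_w ↦ δ_z`. One side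
  -- becomes an entry of `ρ` in the basis `U δ_z`, the other the corresponding entry of the diagonal
  -- matrix `τ q`.
  have hmat : ∀ z w, inner ℂ (U (delta w)) (ρ (U (delta z))) =
      ((τ : ℂ) * q z) * inner ℂ (U (delta w)) (U (delta z)) := fun z w => by
    obtain ⟨C, a, hC, ha⟩ := hπ w z
    have l1 : Filter.Tendsto (fun F => ∑' i, inner ℂ (x i) (π (a F) (x i))) Filter.atTop
        (𝓝 (∑' i, inner ℂ (x i) (x i w • delta z))) := by
      refine tendsto_tsum_of_dominated_convergence (bound := fun i => C * ‖S (e i)‖ ^ 2)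
        (hsum.mul_left C) (fun i => ?_) (Filter.Eventually.of_forall fun F i => ?_)
      · exact tendsto_const_nhds.inner (ha (x i))
      · calc _ ≤ ‖x i‖ * ‖π (a F) (x i)‖ := norm_inner_le_norm _ _
          _ ≤ ‖x i‖ * (C * ‖x i‖) := by
              gcongr
              exact (π (a F)).le_of_opNorm_le (hC F) _
          _ = C * ‖S (e i)‖ ^ 2 := by
              rw [hxnorm]
              ring
    have l2 : Filter.Tendsto (fun F => ∑' y, (q y : ℂ) * matrixCoeff π y y (a F)) Filter.atTop
        (𝓝 (∑' y, (q y : ℂ) *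
          ((delta y : lp (fun _ : ι => ℂ) 2) w * (delta z : lp (fun _ : ι => ℂ) 2) y))) := by
      refine tendsto_tsum_of_dominated_convergence (bound := fun y => q y * C)
        (hq.mul_right C) (fun y => ?_) (Filter.Eventually.of_forall fun F y => ?_)
      · refine Filter.Tendsto.const_mul _ ?_
        have h1 := (tendsto_const_nhds (x := (delta y : lp (fun _ : ι => ℂ) 2))).inner
          (𝕜 := ℂ) (ha (delta y))
        simp only [inner_smul_right, inner_delta_left] at h1
        exact h1
      · rw [norm_mul, Complex.norm_real, Real.norm_of_nonneg (hq0 y)]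
        refine mul_le_mul_of_nonneg_left ?_ (hq0 y)
        refine (lp.norm_apply_le_norm (by simp) _ _).trans ?_
        simpa [norm_delta] using (π (a F)).le_of_opNorm_le (hC F) (delta y)
    have h1 := tendsto_nhds_unique (l1.congr fun F => hxφ (a F)) (l2.const_mul (τ : ℂ))
    have h2 : inner ℂ (U (delta w)) (ρ (U (delta z))) =
        ∑' i, inner ℂ (x i) (x i w • delta z) := by
      rw [← hSS, mul_apply_eq_comp, hadj, ← e.tsum_inner_mul_inner]
      refine tsum_congr fun i => ?_
      rw [← hadj, ← hx, U.inner_map_map, inner_delta_left, inner_smul_right, hadj, ← hx,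
        U.inner_map_map]
    rw [h2, h1, U.inner_map_map, inner_delta_left, mul_assoc]
    congr 1
    rw [tsum_eq_single z]
    · by_cases hzw : w = z
      · subst hzw
        simp [delta_apply_self]
      · simp [delta_apply_ne hzw]
    · intro y hy
      rw [delta_apply_ne hy, mul_zero, mul_zero]
  let b : HilbertBasis ι ℂ H := HilbertBasis.ofRepr U.symm
  have hb : ∀ z, b z = U (delta z) := fun z => by
    have h1 : b.repr (b z) = delta z := by
      classical
      rw [b.repr_self, delta]
    have h2 : U (b.repr (b z)) = b z := U.apply_symm_apply _
    rw [← h2, h1]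
  refine ⟨b, τ, fun z => b.ext_inner fun w => ?_⟩
  rw [hb, hb, hmat, inner_smul_right]

/-- By `exists_eigenbasis_of_trace`, `ρ` has eigenvalues proportional to `e^{-βh(z)}`. Since `h ≥ 0`
vanishes at `z₀`, the condition `‖ρ‖ = 1` makes the proportionality factor 1, so every admissible
triple has the eigenvalues `e^{-sh(z)}` for `ρ^{s/β}`. -/
theorem isPartitionFunction_of_diagonal.{v, v'} {A : Type v} [NonUnitalCStarAlgebra A]
    [PartialOrder A] [StarOrderedRing A]
    {π : A →⋆ₙₐ[ℂ] (lp (fun _ : ι => ℂ) 2 →L[ℂ] lp (fun _ : ι => ℂ) 2)}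
    {σ : TimeEvolution A} {h : ι → ℝ} {β k : ℝ} {q : ι → ℝ}
    (hqpos : ∀ z, 0 < q z) (hq : Summable q) (hqh : ∀ z, q z = k * Real.exp (-β * h z))
    (h0 : ∀ z, 0 ≤ h z) {z₀ : ι} (hz₀ : h z₀ = 0) (hπ : HasMatrixUnits π)
    {φ : A →L[ℂ] ℂ} (hφ : IsDiagonalFunctional π q φ) :
    IsPartitionFunction.{v, v'} σ β φ fun s => ∑' z, Complex.exp (-s * h z) := by
  intro H _ _ _ π' ρ had s hs
  have : Nonempty ι := ⟨z₀⟩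
  have hφ0 : φ ≠ 0 := by
    rintro rfl
    have h1 : IsState (0 : A →L[ℂ] ℂ) := had.extremal.1.1
    simpa using h1.2
  have hβ := had.beta_pos
  obtain ⟨b, κ, hb⟩ := exists_eigenbasis_of_trace hqpos hq hπ hφ hφ0 had.irreducible had.isPositive
    had.isTraceClass had.eq_trace
  have hsumβ : Summable fun z => Real.exp (-β * h z) := by
    have hk : k ≠ 0 := by
      rintro rfl
      have h1 := hqpos z₀
      rw [hqh, zero_mul] at h1
      exact lt_irrefl _ h1
    refine (hq.mul_left k⁻¹).congr fun z => ?_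
    rw [hqh, ← mul_assoc, inv_mul_cancel₀ hk, one_mul]
  have hb1 : ∀ z, ρ (b z) = (κ * k * Real.exp (-β * h z)) • b z := fun z => by
    rw [hb, hqh]
    push_cast
    ring_nf
  have hκ0 : 0 ≤ κ * k := by
    have h1 := had.isPositive.inner_nonneg_right (b z₀)
    rw [hb1, hz₀, inner_smul_right, inner_self_eq_norm_sq_to_K, b.orthonormal.1] at h1
    simpa using h1
  obtain ⟨r, hr⟩ : ∃ r : ℝ, (r : ℂ) = κ * k := ⟨(κ * k).re, (Complex.eq_re_of_ofReal_le hκ0).symm⟩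
  have hr0 : 0 ≤ r := by
    rw [← hr] at hκ0
    exact Complex.zero_le_real.1 hκ0
  have hr1 : r = 1 := by
    refine le_antisymm ?_ ?_
    · have h1 := ρ.le_opNorm (b z₀)
      rw [hb1, hz₀, ← hr, had.norm_eq_one, b.orthonormal.1, norm_smul, b.orthonormal.1] at h1
      simpa [abs_of_nonneg hr0] using h1
    · rw [← had.norm_eq_one]
      refine norm_le_of_diagonal b hb1 hr0 fun z => ?_
      rw [← hr, ← Complex.ofReal_mul, Complex.norm_real, Real.norm_of_nonneg (by positivity)]
      refine mul_le_of_le_one_right hr0 (Real.exp_le_one_iff.2 ?_)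
      nlinarith [mul_nonneg hβ.le (h0 z)]
  have hb2 : ∀ z, ρ (b z) = ((Real.exp (-β * h z) : ℝ) : ℂ) • b z := fun z => by
    rw [hb1, ← hr, hr1, Complex.ofReal_one, one_mul]
  have hre : 0 < (s / β).re := by
    rw [Complex.div_ofReal_re]
    exact div_pos (hβ.trans hs) hβ
  have hsa : IsSelfAdjoint ρ := had.isPositive.isSelfAdjoint
  -- On the nonnegative spectrum the power is continuous away from 0 because the branch cut is
  -- avoided, and at 0 because the exponent has positive real part.
  have hcont : ContinuousOn (fun z : ℂ => z ^ (s / β)) (spectrum ℂ ρ) := by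
    intro z hz
    have hz0 : 0 ≤ z := by
      have h1 := (ContinuousLinearMap.nonneg_iff_isPositive ρ).2 had.isPositive
      exact spectrum_nonneg_of_nonneg h1 hz
    rcases eq_or_ne z 0 with rfl | hne
    · exact (Complex.continuousAt_cpow_const_of_re_pos (Or.inl le_rfl) hre).continuousWithinAt
    · refine (Complex.continuousAt_cpow_const_of_re_pos (Or.inl ?_) hre).continuousWithinAt
      exact (Complex.nonneg_iff.1 hz0).1
  have hexp : ∀ z, expHamiltonian β ρ s (b z) = Complex.exp (-s * h z) • b z := fun z => by
    have hb0 : b z ≠ 0 := b.orthonormal.ne_zero z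
    have h1 := cfc_apply_eigenvector hsa.isStarNormal (hb2 z)
      (by rw [hsa.star_eq, Complex.conj_ofReal, hb2]) (mem_spectrum_of_eigenvector hb0 (hb2 z)) hcont
    rw [expHamiltonian, h1]
    congr 1
    have hne : ((Real.exp (-β * h z) : ℝ) : ℂ) ≠ 0 := by exact_mod_cast (Real.exp_pos _).ne'
    have hβ' : (β : ℂ) ≠ 0 := by exact_mod_cast hβ.ne'
    rw [Complex.cpow_def_of_ne_zero hne, ← Complex.ofReal_log (Real.exp_pos _).le, Real.log_exp]
    congr 1
    push_cast
    field_simp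
  refine isTraceClass_of_diagonal b hexp ?_
  simp only [norm_exp_neg_mul]
  refine Summable.of_nonneg_of_le (fun z => (Real.exp_pos _).le) (fun z => ?_) hsumβ
  refine Real.exp_le_exp.2 ?_
  nlinarith [h0 z]

/-- Since `e^{-βh(z)} = k⁻¹ q_z` and `∑ q_z = 1`, the trace of `e^{-βH}` is `k⁻¹`, and dividing by
it turns the diagonal sum for `Tr(π(a) e^{-βH})` into `φ a`. -/
theorem isAdmissibleTriple_of_diagonal [PartialOrder A] [StarOrderedRing A] [Countable ι]
    {σ : TimeEvolution A} {h : ι → ℝ}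
    (hσ : IsDiagonalEvolution π σ h) {β k : ℝ} (hβ : 0 < β) {q : ι → ℝ} (hqpos : ∀ z, 0 < q z)
    (hq : HasSum q 1) (hqh : ∀ z, q z = k * Real.exp (-β * h z))
    (h0 : ∀ z, 0 ≤ h z) {z₀ : ι} (hz₀ : h z₀ = 0) (hπ : HasAnalyticMatrixUnits π σ β)
    {φ : A →L[ℂ] ℂ} (hφ : IsDiagonalFunctional π q φ) :
    IsAdmissibleTriple σ β φ π (expDiagonal h β) := by
  have : Nonempty ι := ⟨z₀⟩
  have hk : k ≠ 0 := by
    rintro rfl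
    have h1 := hqpos z₀
    rw [hqh, zero_mul] at h1
    exact lt_irrefl _ h1
  have hexp : ∀ z, Real.exp (-β * h z) = k⁻¹ * q z := fun z => by
    rw [hqh, ← mul_assoc, inv_mul_cancel₀ hk, one_mul]
  have hsum : Summable fun z => Real.exp (-β * h z) := by
    simpa only [hexp] using hq.summable.mul_left k⁻¹
  have hsum' : Summable fun z => Real.exp (-(β : ℂ).re * h z) := hsum
  have hcexp : ∀ z, Complex.exp (-(β : ℂ) * h z) = (k : ℂ)⁻¹ * q z := fun z => by
    have h1 := congrArg (fun t : ℝ => (t : ℂ)) (hexp z)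
    push_cast at h1
    exact h1
  refine ⟨hβ, isExtremalKMSState_of_diagonal hσ hqpos hq hqh hπ hφ,
    isTypeIFactorState_of_diagonal hqpos hq.summable hπ.hasMatrixUnits hφ, separableSpace_lp,
    hπ.hasMatrixUnits.isIrreducibleRep, isPositive_expDiagonal hsum hβ.le h0,
    (isTraceClass_expDiagonal hsum').1, norm_expDiagonal hsum hβ.le h0 hz₀, fun a => ?_⟩
  have h1 : operatorTrace (expDiagonal h (β : ℂ)) = (k : ℂ)⁻¹ := by
    rw [(isTraceClass_expDiagonal hsum').2]
    simp only [hcexp, tsum_mul_left, ← Complex.ofReal_tsum, hq.tsum_eq]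
    simp
  have h2 := hasSum_inner_of_diagonal (deltaBasis ι) (stdBasis (lp (fun _ : ι => ℂ) 2)) (π a)
    (π a * expDiagonal h (β : ℂ)) (fun z => Complex.exp (-(β : ℂ) * h z))
    (by simpa only [norm_exp_neg_mul] using hsum') fun z => by
      rw [deltaBasis_apply, mul_apply_eq_comp, expDiagonal_delta hsum', map_smul]
  have h3 : operatorTrace (π a * expDiagonal h (β : ℂ)) = (k : ℂ)⁻¹ * φ a := by
    rw [operatorTrace, h2.tsum_eq, hφ, ← tsum_mul_left]
    refine tsum_congr fun z => ?_
    rw [hcexp, deltaBasis_apply, inner_delta_left, matrixCoeff_apply, mul_assoc]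
  have hk' : (k : ℂ)⁻¹ ≠ 0 := inv_ne_zero (by exact_mod_cast hk)
  rw [h3, h1, mul_div_cancel_left₀ _ hk']

end PartitionFunction

/-! ### The Schur test. -/

section Schur

variable {ι : Type*}

/-- A matrix with finitely supported rows and columns, all of `ℓ¹`-norm at most `R`. -/
structure IsSchurMatrix (m : ι → ι → ℂ) (R : ℝ) : Prop where
  nonneg : 0 ≤ R
  finite_row : ∀ i, (Function.support fun j => m i j).Finite
  finite_col : ∀ j, (Function.support fun i => m i j).Finite
  row_le : ∀ i, ∑ᶠ j, ‖m i j‖ ≤ R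
  col_le : ∀ j, ∑ᶠ i, ‖m i j‖ ≤ R

namespace IsSchurMatrix

variable {m : ι → ι → ℂ} {R : ℝ}

theorem sum_row_le (h : IsSchurMatrix m R) (i : ι) (t : Finset ι) : ∑ j ∈ t, ‖m i j‖ ≤ R := by
  classical
  refine le_trans ?_ (h.row_le i)
  have hs : (Function.support fun j => ‖m i j‖) ⊆ ↑(t ∪ (h.finite_row i).toFinset) := by
    intro j hj
    simp only [Finset.coe_union, Set.Finite.coe_toFinset]
    exact Or.inr (norm_ne_zero_iff.1 hj)
  rw [finsum_eq_sum_of_support_subset _ hs]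
  exact Finset.sum_le_sum_of_subset_of_nonneg Finset.subset_union_left fun _ _ _ => norm_nonneg _

theorem transpose (h : IsSchurMatrix m R) : IsSchurMatrix (fun i j => m j i) R :=
  ⟨h.nonneg, h.finite_col, h.finite_row, h.col_le, h.row_le⟩

/-- Cauchy–Schwarz with weights `|m_{ij}|` bounds the square of an entry by the row sum times `∑
|m_{ij}| |v_j|²`. Summing over `i` then brings in the column sums, for a total factor `R²`. -/
theorem sum_norm_sq_le (h : IsSchurMatrix m R) (v : lp (fun _ : ι => ℂ) 2) (t : Finset ι) :
    ∑ i ∈ t, ‖∑ᶠ j, m i j * v j‖ ^ 2 ≤ (R * ‖v‖) ^ 2 := by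
  classical
  set J := t.biUnion fun i => (h.finite_row i).toFinset with hJ
  have hrow : ∀ i ∈ t, ∑ᶠ j, m i j * v j = ∑ j ∈ J, m i j * v j := fun i hi => by
    refine finsum_eq_sum_of_support_subset _ fun j hj => ?_
    rw [hJ, Finset.mem_coe, Finset.mem_biUnion]
    exact ⟨i, hi, (Set.Finite.mem_toFinset _).2 (left_ne_zero_of_mul hj)⟩
  have hcs : ∀ i ∈ t, ‖∑ᶠ j, m i j * v j‖ ^ 2 ≤ R * ∑ j ∈ J, ‖m i j‖ * ‖v j‖ ^ 2 := by
    intro i hi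
    rw [hrow i hi]
    have h1 : ‖∑ j ∈ J, m i j * v j‖ ≤ ∑ j ∈ J, ‖m i j‖ * ‖v j‖ := by
      refine (norm_sum_le _ _).trans (le_of_eq (Finset.sum_congr rfl fun j _ => norm_mul _ _))
    calc ‖∑ j ∈ J, m i j * v j‖ ^ 2 ≤ (∑ j ∈ J, ‖m i j‖ * ‖v j‖) ^ 2 := by gcongr
      _ ≤ (∑ j ∈ J, ‖m i j‖) * ∑ j ∈ J, ‖m i j‖ * ‖v j‖ ^ 2 :=
          Finset.sum_sq_le_sum_mul_sum_of_sq_le_mul J (fun j _ => norm_nonneg _)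
            (fun j _ => by positivity) fun j _ => le_of_eq (by ring)
      _ ≤ _ := by
          gcongr
          exact h.sum_row_le i J
  calc ∑ i ∈ t, ‖∑ᶠ j, m i j * v j‖ ^ 2 ≤ ∑ i ∈ t, R * ∑ j ∈ J, ‖m i j‖ * ‖v j‖ ^ 2 :=
        Finset.sum_le_sum hcs
    _ = R * ∑ j ∈ J, (∑ i ∈ t, ‖m i j‖) * ‖v j‖ ^ 2 := by
        rw [← Finset.mul_sum, Finset.sum_comm]
        simp only [Finset.sum_mul]
    _ ≤ R * ∑ j ∈ J, R * ‖v j‖ ^ 2 := by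
        refine mul_le_mul_of_nonneg_left (Finset.sum_le_sum fun j _ => ?_) h.nonneg
        exact mul_le_mul_of_nonneg_right (h.transpose.sum_row_le j t) (by positivity)
    _ = R ^ 2 * ∑ j ∈ J, ‖v j‖ ^ 2 := by
        rw [← Finset.mul_sum]
        ring
    _ ≤ R ^ 2 * ‖v‖ ^ 2 := by
        refine mul_le_mul_of_nonneg_left ?_ (by positivity)
        have := lp.sum_rpow_le_norm_rpow (p := 2) (by norm_num) v J
        simpa using this
    _ = (R * ‖v‖) ^ 2 := by ring

/-- The bounded operator on `ℓ²(ι)` with matrix `m`. -/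
noncomputable def operator (h : IsSchurMatrix m R) :
    lp (fun _ : ι => ℂ) 2 →L[ℂ] lp (fun _ : ι => ℂ) 2 :=
  LinearMap.mkContinuous
    { toFun := fun v => ⟨fun i => ∑ᶠ j, m i j * v j,
        memℓp_gen' (C := (R * ‖v‖) ^ 2) fun t => by
          simpa using h.sum_norm_sq_le v t⟩
      map_add' := fun v v' => by
        ext i
        simp only [lp.coeFn_add, Pi.add_apply, mul_add]
        exact finsum_add_distrib
          ((h.finite_row i).subset fun j hj => left_ne_zero_of_mul hj)
          ((h.finite_row i).subset fun j hj => left_ne_zero_of_mul hj)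
      map_smul' := fun k v => by
        ext i
        simp only [lp.coeFn_smul, Pi.smul_apply, smul_eq_mul, RingHom.id_apply]
        rw [mul_finsum]
        exact finsum_congr fun j => by ring } R fun v => by
      refine lp.norm_le_of_forall_sum_le (p := 2) (by norm_num)
        (mul_nonneg h.nonneg (norm_nonneg _)) fun t => ?_
      simpa using h.sum_norm_sq_le v t

theorem operator_apply (h : IsSchurMatrix m R) (v : lp (fun _ : ι => ℂ) 2) (i : ι) :
    h.operator v i = ∑ᶠ j, m i j * v j := rfl

theorem operator_delta (h : IsSchurMatrix m R) (i j : ι) : h.operator (delta j) i = m i j := by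
  rw [operator_apply, finsum_eq_single _ j fun k hk => by rw [delta_apply_ne hk, mul_zero],
    delta_apply_self, mul_one]

theorem norm_operator_le (h : IsSchurMatrix m R) : ‖h.operator‖ ≤ R :=
  LinearMap.mkContinuous_norm_le _ h.nonneg _

end IsSchurMatrix

end Schur

namespace EtaleGroupoid

/-! ### Cancellation of arrows and bounds by the `I`-norm. -/

section Arrows

variable {X G : Type u} [TopologicalSpace X] [TopologicalSpace G] (𝒢 : EtaleGroupoid X G)

variable {𝒢} in
theorem mul_mul_inv_cancel {g h : G} (hgh : 𝒢.s g = 𝒢.s h) :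
    𝒢.mul (𝒢.mul g (𝒢.inv h)) h = g := by
  rw [𝒢.mul_assoc g (𝒢.inv h) h (hgh.trans (𝒢.r_inv h).symm) (𝒢.s_inv h), 𝒢.inv_mul, ← hgh,
    𝒢.mul_unit]

variable {𝒢} in
theorem mul_inv_mul_cancel {g h : G} (hgh : 𝒢.s g = 𝒢.r h) :
    𝒢.mul (𝒢.mul g h) (𝒢.inv h) = g := by
  rw [𝒢.mul_assoc g h (𝒢.inv h) hgh (𝒢.r_inv h).symm, 𝒢.mul_inv, ← hgh, 𝒢.mul_unit]

variable {𝒢} in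
theorem inv_mul_mul_cancel {g h : G} (hgh : 𝒢.s g = 𝒢.r h) :
    𝒢.mul (𝒢.inv g) (𝒢.mul g h) = h := by
  rw [← 𝒢.mul_assoc (𝒢.inv g) g h (𝒢.s_inv g) hgh, 𝒢.inv_mul, hgh, 𝒢.unit_mul]

variable {𝒢} in
theorem mul_left_cancel_of {g h k : G} (h₁ : 𝒢.s g = 𝒢.r h) (h₂ : 𝒢.s g = 𝒢.r k)
    (he : 𝒢.mul g h = 𝒢.mul g k) : h = k := by
  rw [← inv_mul_mul_cancel h₁, he, inv_mul_mul_cancel h₂]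

variable {𝒢} in
theorem mul_right_cancel_of {g h k : G} (h₁ : 𝒢.s h = 𝒢.r g) (h₂ : 𝒢.s k = 𝒢.r g)
    (he : 𝒢.mul h g = 𝒢.mul k g) : h = k := by
  rw [← mul_inv_mul_cancel h₁, he, mul_inv_mul_cancel h₂]

variable {𝒢} in
theorem inv_mul_inv {g h : G} (hgh : 𝒢.s g = 𝒢.s h) :
    𝒢.inv (𝒢.mul g (𝒢.inv h)) = 𝒢.mul h (𝒢.inv g) := by
  have h₁ : 𝒢.s g = 𝒢.r (𝒢.inv h) := hgh.trans (𝒢.r_inv h).symm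
  have h₂ : 𝒢.s h = 𝒢.r (𝒢.inv g) := hgh.symm.trans (𝒢.r_inv g).symm
  refine mul_left_cancel_of (𝒢 := 𝒢) (g := 𝒢.mul g (𝒢.inv h)) (𝒢.r_inv _).symm ?_ ?_
  · rw [𝒢.s_mul _ _ h₁, 𝒢.r_mul _ _ h₂, 𝒢.s_inv]
  · rw [𝒢.mul_inv, 𝒢.r_mul _ _ h₁, ← 𝒢.mul_assoc _ h (𝒢.inv g) ?_ h₂, mul_mul_inv_cancel hgh,
      𝒢.mul_inv]
    rw [𝒢.s_mul _ _ h₁, 𝒢.s_inv]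

theorem Cc.finite_fiber_s [T2Space G] {𝒢 : EtaleGroupoid X G} (f : 𝒢.Cc) (x : X) :
    ({η | 𝒢.s η = x} ∩ tsupport f).Finite := by
  have := 𝒢.t2Space_units
  obtain ⟨S, -, h⟩ := exists_finset_localSections 𝒢.isLocalHomeomorph_s f.hasCompactSupport x
  exact (S.finite_toSet.image _).subset h.self_of_nhds.2.2

theorem iNorm_nonneg (f : 𝒢.Cc) : 0 ≤ 𝒢.INorm f :=
  le_max_of_le_left (Real.iSup_nonneg fun _ => finsum_nonneg fun _ => finsum_nonneg fun _ => norm_nonneg _)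

/-- A real supremum dominates its terms only if the family is bounded above. The bound comes from
the uniformly bounded number of points of the compact support in a fibre. -/
theorem finsum_range_fiber_le (f : 𝒢.Cc) (x : X) :
    ∑ᶠ η ∈ {η | 𝒢.r η = x}, ‖f η‖ ≤ 𝒢.INorm f := by
  obtain ⟨N, hN⟩ := exists_fiber_card_le 𝒢.isLocalHomeomorph_r f.hasCompactSupport.isCompact
  obtain ⟨C, hC⟩ := f.hasCompactSupport.exists_bound_of_continuous f.continuous
  refine le_max_of_le_left (le_ciSup (f := fun x => ∑ᶠ η ∈ {η | 𝒢.r η = x}, ‖f η‖) ?_ x)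
  refine ⟨N * |C|, ?_⟩
  rintro _ ⟨y, rfl⟩
  exact fiberSum_le hN (fun η hη => image_eq_zero_of_notMem_tsupport hη) (abs_nonneg C)
    (fun η => (hC η).trans (le_abs_self C)) y

theorem finsum_source_fiber_le (f : 𝒢.Cc) (x : X) :
    ∑ᶠ η ∈ {η | 𝒢.s η = x}, ‖f η‖ ≤ 𝒢.INorm f := by
  obtain ⟨N, hN⟩ := exists_fiber_card_le 𝒢.isLocalHomeomorph_s f.hasCompactSupport.isCompact
  obtain ⟨C, hC⟩ := f.hasCompactSupport.exists_bound_of_continuous f.continuous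
  refine le_max_of_le_right (le_ciSup (f := fun x => ∑ᶠ η ∈ {η | 𝒢.s η = x}, ‖f η‖) ?_ x)
  refine ⟨N * |C|, ?_⟩
  rintro _ ⟨y, rfl⟩
  exact fiberSum_le hN (fun η hη => image_eq_zero_of_notMem_tsupport hη) (abs_nonneg C)
    (fun η => (hC η).trans (le_abs_self C)) y

end Arrows

/-! ### The regular representation on a source fibre. -/

section RegularRepresentation

variable {X G : Type u} [TopologicalSpace X] [TopologicalSpace G] {𝒢 : EtaleGroupoid X G}
  {I : Type u} {y : X} (e : I ≃ {γ : G // 𝒢.s γ = y})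

/-- The arrow `g_i g_j⁻¹`, where `(g_i)` is an enumeration of the arrows with source `y`. -/
def quotArrow (i j : I) : G := 𝒢.mul (e i) (𝒢.inv (e j))

theorem s_eq_r_inv (i j : I) : 𝒢.s (e i) = 𝒢.r (𝒢.inv (e j)) := by
  rw [𝒢.r_inv, (e i).2, (e j).2]

theorem s_eq_s (i j : I) : 𝒢.s (e i : G) = 𝒢.s (e j : G) := (e i).2.trans (e j).2.symm

theorem r_quotArrow (i j : I) : 𝒢.r (quotArrow e i j) = 𝒢.r (e i) :=
  𝒢.r_mul _ _ (s_eq_r_inv e i j)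

theorem s_quotArrow (i j : I) : 𝒢.s (quotArrow e i j) = 𝒢.r (e j) :=
  (𝒢.s_mul _ _ (s_eq_r_inv e i j)).trans (𝒢.s_inv _)

theorem inv_quotArrow (i j : I) : 𝒢.inv (quotArrow e i j) = quotArrow e j i :=
  inv_mul_inv (s_eq_s e i j)

theorem quotArrow_mul (i j k : I) :
    𝒢.mul (quotArrow e i j) (quotArrow e j k) = quotArrow e i k := by
  rw [quotArrow, quotArrow, ← 𝒢.mul_assoc _ (e j : G) _ _ (s_eq_r_inv e j k),
    mul_mul_inv_cancel (s_eq_s e i j), quotArrow]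
  rw [𝒢.s_mul _ _ (s_eq_r_inv e i j), 𝒢.s_inv]

theorem quotArrow_self (i : I) : quotArrow e i i = 𝒢.unit (𝒢.r (e i)) := 𝒢.mul_inv _

/-- The inverse sends `η` to the index of `η g_j`. Thus the columns of the matrix `f(g_i g_j⁻¹)` run
over source fibres, and by inversion its rows run over range fibres. -/
theorem bijOn_quotArrow_left (j : I) :
    Set.BijOn (fun i => quotArrow e i j) Set.univ {η | 𝒢.s η = 𝒢.r (e j)} := by
  refine ⟨fun i _ => s_quotArrow e i j, fun i _ i' _ h => ?_, fun η hη => ?_⟩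
  · exact e.injective (Subtype.ext (mul_right_cancel_of (s_eq_r_inv e i j) (s_eq_r_inv e i' j) h))
  · have hη' : 𝒢.s η = 𝒢.r (e j) := hη
    refine ⟨e.symm ⟨𝒢.mul η (e j), (𝒢.s_mul _ _ hη').trans (e j).2⟩, trivial, ?_⟩
    simp only [quotArrow, Equiv.apply_symm_apply]
    exact mul_inv_mul_cancel hη'

theorem bijOn_quotArrow_right (i : I) :
    Set.BijOn (quotArrow e i) Set.univ {η | 𝒢.r η = 𝒢.r (e i)} := by
  refine ⟨fun j _ => r_quotArrow e i j, fun j _ j' _ h => ?_, fun η hη => ?_⟩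
  · refine (bijOn_quotArrow_left e i).injOn (Set.mem_univ j) (Set.mem_univ j') ?_
    simp only [← inv_quotArrow e i, h]
  · obtain ⟨j, -, hj⟩ := (bijOn_quotArrow_left e i).surjOn
      (show 𝒢.s (𝒢.inv η) = 𝒢.r (e i) from (𝒢.s_inv η).trans hη)
    refine ⟨j, trivial, ?_⟩
    have hj' : quotArrow e j i = 𝒢.inv η := hj
    rw [← inv_quotArrow, hj', 𝒢.inv_inv]

theorem finsum_quotArrow_left {M : Type*} [AddCommMonoid M] (F : G → M) (j : I) :
    ∑ᶠ i, F (quotArrow e i j) = ∑ᶠ η ∈ {η | 𝒢.s η = 𝒢.r (e j)}, F η := by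
  rw [← finsum_mem_univ]
  exact finsum_mem_eq_of_bijOn _ (bijOn_quotArrow_left e j) fun _ _ => rfl

theorem finsum_quotArrow_right {M : Type*} [AddCommMonoid M] (F : G → M) (i : I) :
    ∑ᶠ j, F (quotArrow e i j) = ∑ᶠ η ∈ {η | 𝒢.r η = 𝒢.r (e i)}, F η := by
  rw [← finsum_mem_univ]
  exact finsum_mem_eq_of_bijOn _ (bijOn_quotArrow_right e i) fun _ _ => rfl

variable [T2Space G]

/-- Row and column sums are exactly the range and source fibre sums in the `I`-norm, so the Schur
test gives a representation bounded by it. -/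
theorem isSchurMatrix_quotArrow (f : 𝒢.Cc) :
    IsSchurMatrix (fun i j => f (quotArrow e i j)) (𝒢.INorm f) where
  nonneg := 𝒢.iNorm_nonneg f
  finite_row i := by
    refine ((f.finite_fiber (𝒢.r (e i))).preimage
      ((bijOn_quotArrow_right e i).injOn.mono (Set.subset_univ _))).subset fun j hj => ?_
    exact ⟨r_quotArrow e i j, subset_tsupport _ hj⟩
  finite_col j := by
    refine ((f.finite_fiber_s (𝒢.r (e j))).preimage
      ((bijOn_quotArrow_left e j).injOn.mono (Set.subset_univ _))).subset fun i hi => ?_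
    exact ⟨s_quotArrow e i j, subset_tsupport _ hi⟩
  row_le i := (finsum_quotArrow_right e (fun η => ‖f η‖) i).trans_le (𝒢.finsum_range_fiber_le f _)
  col_le j := (finsum_quotArrow_left e (fun η => ‖f η‖) j).trans_le (𝒢.finsum_source_fiber_le f _)

/-- The regular representation of `C_c(𝒢)` on `ℓ²(s⁻¹(y))`, where `s⁻¹(y)` is enumerated by `I`. -/
noncomputable def regularHom :
    𝒢.Cc →⋆ₙₐ[ℂ] (lp (fun _ : I => ℂ) 2 →L[ℂ] lp (fun _ : I => ℂ) 2) where
  toFun f := (isSchurMatrix_quotArrow e f).operator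
  map_smul' t f := ext_delta fun j => by
    ext i
    simp [IsSchurMatrix.operator_delta]
  map_zero' := ext_delta fun j => by
    ext i
    simp [IsSchurMatrix.operator_delta]
  map_add' f g := ext_delta fun j => by
    ext i
    simp [IsSchurMatrix.operator_delta]
  map_mul' f g := ext_delta fun k => by
    ext i
    rw [IsSchurMatrix.operator_delta, mul_apply_eq_comp, IsSchurMatrix.operator_apply]
    simp only [IsSchurMatrix.operator_delta]
    -- Convolution becomes matrix multiplication through `(g_i g_j⁻¹)(g_j g_k⁻¹) = g_i g_k⁻¹`.
    rw [Cc.mul_apply, r_quotArrow, ← finsum_quotArrow_right]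
    refine finsum_congr fun j => ?_
    rw [inv_quotArrow, quotArrow_mul]
  map_star' f := ext_delta fun j => by
    ext i
    rw [IsSchurMatrix.operator_delta, Cc.star_apply, inv_quotArrow, ← inner_delta_left i,
      ContinuousLinearMap.star_eq_adjoint, ContinuousLinearMap.adjoint_inner_right,
      ← inner_conj_symm, inner_delta_left, IsSchurMatrix.operator_delta]

theorem regularHom_delta (f : 𝒢.Cc) (i j : I) :
    regularHom e f (delta j) i = f (quotArrow e i j) :=
  (isSchurMatrix_quotArrow e f).operator_delta i j

/-- The regular representation on `ℓ²(s⁻¹(y))`, as a bounded representation. -/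
noncomputable def regularRep : 𝒢.Rep where
  H := lp (fun _ : I => ℂ) 2
  toHom := regularHom e
  norm_le f := (isSchurMatrix_quotArrow e f).norm_operator_le

/-- The extension to `C*(𝒢)` of a bounded representation of `C_c(𝒢)`. -/
noncomputable def Rep.extend (π : 𝒢.Rep) : 𝒢.FullCStar →⋆ₙₐ[ℂ] (π.H →L[ℂ] π.H) where
  toFun a := (𝒢.inclusion a).component π
  map_smul' _ _ := rfl
  map_zero' := rfl
  map_add' _ _ := rfl
  map_mul' _ _ := rfl
  map_star' _ := rfl

/-- The representation of `C*(𝒢)` on `ℓ²(s⁻¹(y))`. -/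
noncomputable def regular :
    𝒢.FullCStar →⋆ₙₐ[ℂ] (lp (fun _ : I => ℂ) 2 →L[ℂ] lp (fun _ : I => ℂ) 2) :=
  (regularRep e).extend

theorem matrixCoeff_regular (f : 𝒢.Cc) (i j : I) :
    matrixCoeff (regular e) i j (𝒢.toFullCStar f) = f (quotArrow e i j) :=
  regularHom_delta e f i j

theorem ext_of_toFullCStar {H : Type*} [NormedAddCommGroup H] [InnerProductSpace ℂ H]
    [CompleteSpace H] {π π' : 𝒢.FullCStar →⋆ₙₐ[ℂ] (H →L[ℂ] H)}
    (h : ∀ f, π (𝒢.toFullCStar f) = π' (𝒢.toFullCStar f)) : π = π' := by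
  have hc : ∀ ρ : 𝒢.FullCStar →⋆ₙₐ[ℂ] (H →L[ℂ] H), Continuous ρ := fun ρ =>
    AddMonoidHomClass.continuous_of_bound ρ 1 fun a => by
      rw [one_mul]
      exact NonUnitalStarAlgHom.norm_apply_le ρ a
  exact NonUnitalStarAlgHom.ext fun a =>
    𝒢.denseRange_toFullCStar.induction_on a (isClosed_eq (hc π) (hc π')) h

/-- The value at a unit is a diagonal entry of the regular representation on that fibre. Hence
restriction to units is contractive for the full norm, so that `condExp` really extends it. -/
theorem norm_apply_unit_le (f : 𝒢.Cc) (y : X) : ‖f (𝒢.unit y)‖ ≤ ‖𝒢.toFullCStar f‖ := by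
  set i : {γ : G // 𝒢.s γ = y} := ⟨𝒢.unit y, 𝒢.s_unit y⟩
  have h := norm_matrixCoeff_apply_le (π := regular (𝒢 := 𝒢) (Equiv.refl {γ : G // 𝒢.s γ = y})) i i
    (𝒢.toFullCStar f)
  rwa [matrixCoeff_regular, quotArrow_self, Equiv.refl_apply, 𝒢.r_unit] at h

end RegularRepresentation

end EtaleGroupoid

theorem norm_matrixCoeff_le {A ι : Type*} [NonUnitalCStarAlgebra A]
    (π : A →⋆ₙₐ[ℂ] (lp (fun _ : ι => ℂ) 2 →L[ℂ] lp (fun _ : ι => ℂ) 2)) (w z : ι) :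
    ‖matrixCoeff π w z‖ ≤ 1 :=
  ContinuousLinearMap.opNorm_le_bound _ zero_le_one fun a => by
    rw [one_mul]
    exact norm_matrixCoeff_apply_le (π := π) w z a

/-- Diagonality of a functional can be checked on a dense set. -/
theorem isDiagonalFunctional_of_dense {A ι κ : Type*} [NonUnitalCStarAlgebra A]
    (π : A →⋆ₙₐ[ℂ] (lp (fun _ : ι => ℂ) 2 →L[ℂ] lp (fun _ : ι => ℂ) 2)) {q : ι → ℝ}
    (hq0 : ∀ z, 0 ≤ q z) (hq : Summable q) {φ : A →L[ℂ] ℂ} {j : κ → A} (hj : DenseRange j)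
    (h : ∀ f, φ (j f) = ∑' z, (q z : ℂ) * matrixCoeff π z z (j f)) :
    IsDiagonalFunctional π q φ := by
  -- The series of functionals converges in norm, so its sum is continuous and comparison on the
  -- dense range suffices.
  have hs : Summable fun z => (q z : ℂ) • matrixCoeff π z z := by
    refine Summable.of_norm_bounded hq fun z => ?_
    rw [norm_smul, Complex.norm_real, Real.norm_of_nonneg (hq0 z)]
    exact mul_le_of_le_one_right (hq0 z) (norm_matrixCoeff_le π z z)
  have happ : ∀ a, (∑' z, (q z : ℂ) • matrixCoeff π z z) a =
      ∑' z, (q z : ℂ) * matrixCoeff π z z a := fun a =>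
    ContinuousLinearMap.map_tsum (ContinuousLinearMap.apply ℂ ℂ a) hs
  intro a
  rw [← happ]
  refine hj.induction_on a (isClosed_eq φ.continuous (ContinuousLinearMap.continuous _)) fun f => ?_
  rw [happ, h]

namespace EtaleGroupoid

/-! ### The conditional expectation and the orbit state on `C_c(𝒢)`. -/

section ConditionalExpectation

variable {X G : Type u} [TopologicalSpace X] [TopologicalSpace G] [T2Space G]
  (𝒢 : EtaleGroupoid X G)

theorem norm_restrictUnits_le (f : 𝒢.Cc) : ‖𝒢.restrictUnits f‖ ≤ ‖𝒢.toFullCStar f‖ := by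
  rw [← ZeroAtInftyContinuousMap.norm_toBCF_eq_norm]
  exact (BoundedContinuousFunction.norm_le (norm_nonneg _)).2 fun y => norm_apply_unit_le f y

theorem condExp_toFullCStar (f : 𝒢.Cc) : 𝒢.condExp (𝒢.toFullCStar f) = 𝒢.restrictUnits f :=
  LinearMap.extendOfNorm_eq (f := 𝒢.restrictUnits)
    (e := ({ toFun := 𝒢.toFullCStar
             map_add' := map_add 𝒢.toFullCStar
             map_smul' := map_smul 𝒢.toFullCStar } : 𝒢.Cc →ₗ[ℂ] 𝒢.FullCStar))
    𝒢.denseRange_toFullCStar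
    ⟨1, fun g => by
      rw [one_mul]
      exact 𝒢.norm_restrictUnits_le g⟩ f

theorem orbitState_toFullCStar [MeasurableSpace X] [BorelSpace X] (c : 𝒢.Cocycle) {β : ℝ} {x : X}
    (hs : Summable fun z : 𝒢.orbit x => 𝒢.orbitWeight c x z ^ β) (f : 𝒢.Cc) :
    𝒢.orbitState c β x (𝒢.toFullCStar f) =
      ∑' z : 𝒢.orbit x, ((𝒢.orbitWeight c x z ^ β / ∑' w, 𝒢.orbitWeight c x w ^ β : ℝ) : ℂ) *
        f (𝒢.unit z) := by
  have := 𝒢.t2Space_units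
  have h0 : ∀ z, 0 ≤ 𝒢.orbitWeight c x z ^ β := fun z =>
    Real.rpow_nonneg (Real.exp_pos _).le β
  -- Summability of the weights makes the unnormalised atomic measure finite, which gives the
  -- integrability needed to integrate atom by atom.
  have hfin : MeasureTheory.IsFiniteMeasure (𝒢.orbitSumMeasure c β x) := by
    refine ⟨?_⟩
    simp only [orbitSumMeasure, MeasureTheory.Measure.sum_apply _ MeasurableSet.univ,
      MeasureTheory.Measure.smul_apply, MeasureTheory.measure_univ, smul_eq_mul, mul_one]
    rw [← ENNReal.ofReal_tsum_of_nonneg h0 hs]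
    exact ENNReal.ofReal_lt_top
  have hint : MeasureTheory.Integrable (fun y => f (𝒢.unit y)) (𝒢.orbitSumMeasure c β x) :=
    (𝒢.restrictUnits f).toBCF.integrable _
  show integralC₀ (𝒢.orbitMeasure c β x) (𝒢.condExp (𝒢.toFullCStar f)) = _
  rw [condExp_toFullCStar]
  show ∫ y, f (𝒢.unit y) ∂𝒢.orbitMeasure c β x = _
  rw [orbitMeasure, MeasureTheory.integral_smul_measure, ENNReal.toReal_inv,
    ← ENNReal.ofReal_tsum_of_nonneg h0 hs, ENNReal.toReal_ofReal (tsum_nonneg h0),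
    orbitSumMeasure, MeasureTheory.integral_sum_measure hint, Complex.real_smul, ← tsum_mul_left]
  refine tsum_congr fun z => ?_
  rw [MeasureTheory.integral_smul_measure, MeasureTheory.integral_dirac,
    ENNReal.toReal_ofReal (h0 z), Complex.real_smul]
  push_cast
  ring

end ConditionalExpectation

/-! ### The orbit representation as a regular representation. -/

section OrbitRepresentation

variable {X G : Type u} [TopologicalSpace X] [TopologicalSpace G] {𝒢 : EtaleGroupoid X G} {x : X}

/-- `h⁻¹ g` lies in the trivial isotropy group of `x`, so it is the unit. -/
theorem eq_of_arrows_eq_unit (hiso : 𝒢.arrows x x = {𝒢.unit x}) {g h : G} (hg : 𝒢.s g = x)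
    (hh : 𝒢.s h = x) (hr : 𝒢.r g = 𝒢.r h) : g = h := by
  have hm : 𝒢.s (𝒢.inv h) = 𝒢.r g := (𝒢.s_inv h).trans hr.symm
  have h1 : 𝒢.mul (𝒢.inv h) g ∈ 𝒢.arrows x x :=
    ⟨(𝒢.s_mul _ _ hm).trans hg, (𝒢.r_mul _ _ hm).trans ((𝒢.r_inv h).trans hh)⟩
  rw [hiso, Set.mem_singleton_iff, ← hh, ← 𝒢.inv_mul] at h1
  exact mul_left_cancel_of hm (𝒢.s_inv h) h1

variable (hiso : 𝒢.arrows x x = {𝒢.unit x}) {γ : 𝒢.orbit x → G}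
  (hγ : ∀ z : 𝒢.orbit x, γ z ∈ 𝒢.arrows x z)

/-- The points of an orbit with trivial isotropy enumerate the arrows with source `x`. -/
noncomputable def orbitEquiv : 𝒢.orbit x ≃ {η : G // 𝒢.s η = x} :=
  Equiv.ofBijective (fun z => ⟨γ z, (hγ z).1⟩) ⟨fun z w h => Subtype.ext (by
      rw [← (hγ z).2, ← (hγ w).2, show γ z = γ w from congrArg Subtype.val h]),
    fun η => ⟨⟨𝒢.r η, η, η.2, rfl⟩,
      Subtype.ext (eq_of_arrows_eq_unit hiso (hγ _).1 η.2 (hγ _).2)⟩⟩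

theorem r_orbitEquiv (z : 𝒢.orbit x) : 𝒢.r (orbitEquiv hiso hγ z) = z := (hγ z).2

theorem eq_quotArrow {η : G} {z w : 𝒢.orbit x} (hs : 𝒢.s η = z) (hr : 𝒢.r η = w) :
    η = quotArrow (orbitEquiv hiso hγ) w z := by
  obtain ⟨i, -, hi⟩ := (bijOn_quotArrow_left (orbitEquiv hiso hγ) z).surjOn
    (show 𝒢.s η = 𝒢.r (orbitEquiv hiso hγ z) from hs.trans (r_orbitEquiv hiso hγ z).symm)
  have hi' : quotArrow (orbitEquiv hiso hγ) i z = η := hi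
  have : i = w := Subtype.ext (by rw [← hr, ← hi', r_quotArrow, r_orbitEquiv])
  rw [← hi', this]

theorem cocycle_quotArrow (c : 𝒢.Cocycle) (w z : 𝒢.orbit x) :
    c (quotArrow (orbitEquiv hiso hγ) w z) = c (γ w) - c (γ z) := by
  rw [quotArrow, c.map_mul' _ _ (s_eq_r_inv _ w z), c.map_inv]
  rfl

variable [T2Space G]

/-- The arrows with source `z` are `g_w g_z⁻¹`, one for each `w` in the orbit; reindexing by `w`
gives column `z` of the regular representation, which is finitely supported. -/
theorem finsum_delta_eq (f : 𝒢.Cc) (z : 𝒢.orbit x) :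
    ∑ᶠ η : {η : G // 𝒢.s η = z}, f η • delta (⟨𝒢.r η, 𝒢.r_mem_orbit z η.2⟩ : 𝒢.orbit x) =
      regular (orbitEquiv hiso hγ) (𝒢.toFullCStar f) (delta z) := by
  set e := orbitEquiv hiso hγ with he
  have hv : ∀ w, regular e (𝒢.toFullCStar f) (delta z) w = f (quotArrow e w z) := fun w =>
    matrixCoeff_regular e f w z
  rw [← (hasSum_delta (regular e (𝒢.toFullCStar f) (delta z))).tsum_eq]
  simp only [hv]
  rw [tsum_eq_finsum]
  swap
  · exact ((isSchurMatrix_quotArrow e f).finite_col z).subset fun w hw => left_ne_zero_of_smul hw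
  have hsrc : ∀ w, 𝒢.s (quotArrow e w z) = z := fun w =>
    (s_quotArrow e w z).trans (r_orbitEquiv hiso hγ z)
  have hrange : ∀ w, 𝒢.r (quotArrow e w z) = w := fun w =>
    (r_quotArrow e w z).trans (r_orbitEquiv hiso hγ w)
  refine (finsum_eq_of_bijective (fun w => (⟨quotArrow e w z, hsrc w⟩ : {η : G // 𝒢.s η = z}))
    ⟨fun w w' h => ?_, fun η => ?_⟩ fun w => ?_).symm
  · have h' : quotArrow e w z = quotArrow e w' z := congrArg Subtype.val h
    exact Subtype.ext (by rw [← hrange w, ← hrange w', h'])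
  · exact ⟨⟨𝒢.r η, 𝒢.r_mem_orbit z η.2⟩, Subtype.ext (eq_quotArrow hiso hγ η.2 rfl).symm⟩
  · have : (⟨𝒢.r (quotArrow e w z), 𝒢.r_mem_orbit z (hsrc w)⟩ : 𝒢.orbit x) = w :=
      Subtype.ext (hrange w)
    rw [this]

theorem isOrbitRep_iff (π : 𝒢.FullCStar →⋆ₙₐ[ℂ]
      (lp (fun _ : 𝒢.orbit x => ℂ) 2 →L[ℂ] lp (fun _ : 𝒢.orbit x => ℂ) 2)) :
    𝒢.IsOrbitRep x π ↔ π = regular (orbitEquiv hiso hγ) := by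
  constructor
  · intro h
    refine ext_of_toFullCStar fun f => ext_delta fun z => ?_
    rw [h, finsum_delta_eq hiso hγ]
  · rintro rfl f z
    exact (finsum_delta_eq hiso hγ f z).symm

theorem matrixCoeff_orbit_self (f : 𝒢.Cc) (z : 𝒢.orbit x) :
    matrixCoeff (regular (orbitEquiv hiso hγ)) z z (𝒢.toFullCStar f) = f (𝒢.unit z) := by
  rw [matrixCoeff_regular, quotArrow_self, r_orbitEquiv]

theorem isDiagonalFunctional_orbitState [MeasurableSpace X] [BorelSpace X] (c : 𝒢.Cocycle) {β : ℝ}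
    (hs : Summable fun z : 𝒢.orbit x => 𝒢.orbitWeight c x z ^ β) :
    IsDiagonalFunctional (regular (orbitEquiv hiso hγ))
      (fun z => 𝒢.orbitWeight c x z ^ β / ∑' w, 𝒢.orbitWeight c x w ^ β)
      (𝒢.orbitState c β x) := by
  have h0 : ∀ z : 𝒢.orbit x, 0 ≤ 𝒢.orbitWeight c x z ^ β := fun z =>
    Real.rpow_nonneg (Real.exp_pos _).le β
  have h1 : ∀ z : 𝒢.orbit x, 0 ≤ 𝒢.orbitWeight c x z ^ β / ∑' w, 𝒢.orbitWeight c x w ^ β :=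
    fun z => div_nonneg (h0 z) (tsum_nonneg h0)
  refine isDiagonalFunctional_of_dense (regular (orbitEquiv hiso hγ)) h1 (hs.div_const _)
    𝒢.denseRange_toFullCStar fun f => ?_
  rw [orbitState_toFullCStar 𝒢 c hs]
  refine tsum_congr fun z => ?_
  rw [matrixCoeff_orbit_self]

/-- On `C_c(𝒢)` the entry at `(w, z)` is a value at an arrow with cocycle `c(γ w) - c(γ z)`. Only
differences matter, so the shift by `lam` is harmless. -/
theorem isDiagonalEvolution_orbit (c : 𝒢.Cocycle) (lam : ℝ) :
    IsDiagonalEvolution (regular (orbitEquiv hiso hγ)) (𝒢.timeEvolution c)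
      fun z => c (γ z) - lam := by
  intro t a w z
  refine 𝒢.denseRange_toFullCStar.induction_on a (isClosed_eq
    ((ContinuousLinearMap.continuous _).comp (𝒢.continuous_timeHom c t))
    (continuous_const.mul (ContinuousLinearMap.continuous _))) fun f => ?_
  show matrixCoeff _ w z (𝒢.timeHom c t (𝒢.toFullCStar f)) = _
  rw [timeHom_toFullCStar, matrixCoeff_regular, matrixCoeff_regular, twistCc_apply,
    cocycle_quotArrow]
  push_cast
  ring_nf

end OrbitRepresentation

end EtaleGroupoid

namespace EtaleGroupoid

/-! ### Analytic elements in `C_c(𝒢)`. -/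

section AnalyticElements

variable {X G : Type u} [TopologicalSpace X] [TopologicalSpace G] (𝒢 : EtaleGroupoid X G)

/-- A set on which source and range are injective meets each fibre in at most one point, so the
`I`-norm is at most the sup norm. This keeps the norms of bump functions bounded as their supports
shrink. -/
theorem iNorm_le_of_injOn {K : Set G} (hs : Set.InjOn 𝒢.s K) (hr : Set.InjOn 𝒢.r K) {f : 𝒢.Cc}
    (hf : ∀ η ∉ K, f η = 0) {C : ℝ} (h0 : 0 ≤ C) (hC : ∀ η, ‖f η‖ ≤ C) : 𝒢.INorm f ≤ C := by
  have key : ∀ p : G → X, Set.InjOn p K → ∀ x, (p ⁻¹' {x} ∩ K).encard ≤ (1 : ℕ) := by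
    intro p hp x
    rw [Nat.cast_one, Set.encard_le_one_iff]
    exact fun a b ha hb => hp ha.2 hb.2 (ha.1.trans hb.1.symm)
  refine max_le (Real.iSup_le (fun x => ?_) h0) (Real.iSup_le (fun x => ?_) h0)
  · simpa using fiberSum_le (key _ hr) hf h0 hC x
  · simpa using fiberSum_le (key _ hs) hf h0 hC x

variable {𝒢}

/-- The function `e^{iζc} f` for a complex number `ζ`. -/
noncomputable def cplxTwist (c : 𝒢.Cocycle) (ζ : ℂ) (f : 𝒢.Cc) : 𝒢.Cc :=
  Cc.mk (fun γ => Complex.exp (Complex.I * ζ * c γ) * f γ)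
    ((Complex.continuous_exp.comp (continuous_const.mul
      (Complex.continuous_ofReal.comp c.continuous_toFun))).mul f.continuous)
    f.hasCompactSupport.mul_left

theorem cplxTwist_apply (c : 𝒢.Cocycle) (ζ : ℂ) (f : 𝒢.Cc) (γ : G) :
    cplxTwist c ζ f γ = Complex.exp (Complex.I * ζ * c γ) * f γ := rfl

/-- The pointwise product of a function in `C_c(𝒢)` with `ic`. -/
noncomputable def mulCocycle (c : 𝒢.Cocycle) (f : 𝒢.Cc) : 𝒢.Cc :=
  Cc.mk (fun γ => Complex.I * c γ * f γ)
    ((continuous_const.mul (Complex.continuous_ofReal.comp c.continuous_toFun)).mul f.continuous)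
    f.hasCompactSupport.mul_left

theorem mulCocycle_apply (c : 𝒢.Cocycle) (f : 𝒢.Cc) (γ : G) :
    mulCocycle c f γ = Complex.I * c γ * f γ := rfl

variable [T2Space G]

/-- On the support of `f` the cocycle is bounded, so `|e^{ikc} - 1 - ikc| ≤ |kc|²` for small `k`
makes the remainder `O(|k|²)` in sup norm. Its support stays in a fixed compact set, so the same
holds for the `I`-norm. -/
theorem hasDerivAt_cplxTwist (c : 𝒢.Cocycle) (f : 𝒢.Cc) (ζ : ℂ) :
    HasDerivAt (fun ζ => 𝒢.toFullCStar (cplxTwist c ζ f))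
      (𝒢.toFullCStar (mulCocycle c (cplxTwist c ζ f))) ζ := by
  obtain ⟨N, hN⟩ := 𝒢.iNorm_le f.hasCompactSupport.isCompact
  obtain ⟨B, hB⟩ := (cplxTwist c ζ f).hasCompactSupport.exists_bound_of_continuous
    (cplxTwist c ζ f).continuous
  obtain ⟨M, hM⟩ := f.hasCompactSupport.isCompact.exists_bound_of_continuousOn
    c.continuous_toFun.continuousOn
  have hM' : ∀ η ∈ tsupport f, ‖(c η : ℂ)‖ ≤ |M| + 1 := fun η hη => by
    rw [Complex.norm_real]
    exact (hM η hη).trans ((le_abs_self M).trans (le_add_of_nonneg_right zero_le_one))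
  rw [hasDerivAt_iff_isLittleO_nhds_zero]
  have hsq : (fun k : ℂ => ‖k‖ ^ 2) =o[𝓝 0] fun k : ℂ => k := by
    have := Asymptotics.isLittleO_pow_id (𝕜 := ℂ) (n := 2) (by norm_num)
    exact this.norm_left.congr_left fun k => by simp
  refine Asymptotics.IsBigO.trans_isLittleO ?_ hsq
  refine Asymptotics.IsBigO.of_bound (N * (|B| * (|M| + 1) ^ 2)) ?_
  have hnear : ∀ᶠ k : ℂ in 𝓝 0, ‖k‖ * (|M| + 1) < 1 := by
    have : Filter.Tendsto (fun k : ℂ => ‖k‖ * (|M| + 1)) (𝓝 0) (𝓝 (‖(0 : ℂ)‖ * (|M| + 1))) :=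
      (continuous_norm.mul continuous_const).tendsto 0
    exact this.eventually_lt_const (by simp)
  filter_upwards [hnear] with k hk
  rw [← map_smul, ← map_sub, ← map_sub]
  refine (𝒢.norm_toFullCStar_le _).trans (max_le (by positivity) ?_)
  have h0 : 0 ≤ |B| * ((|M| + 1) ^ 2 * ‖k‖ ^ 2) := by positivity
  refine (hN _ (fun η hη => ?_) (|B| * ((|M| + 1) ^ 2 * ‖k‖ ^ 2)) h0 fun η => ?_).trans (le_of_eq ?_)
  · simp [cplxTwist_apply, mulCocycle_apply, image_eq_zero_of_notMem_tsupport hη]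
  · by_cases hη : η ∈ tsupport f
    swap
    · simpa [cplxTwist_apply, mulCocycle_apply, image_eq_zero_of_notMem_tsupport hη] using h0
    have hle : ‖Complex.I * k * c η‖ ≤ (|M| + 1) * ‖k‖ := by
      rw [norm_mul, norm_mul, Complex.norm_I, one_mul, mul_comm]
      gcongr
      exact hM' η hη
    have he : (cplxTwist c (ζ + k) f - cplxTwist c ζ f - k • mulCocycle c (cplxTwist c ζ f)) η =
        cplxTwist c ζ f η *
          (Complex.exp (Complex.I * k * c η) - 1 - Complex.I * k * c η) := by
      have hsplit : Complex.I * (ζ + k) * c η = Complex.I * ζ * c η + Complex.I * k * c η := by ring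
      simp only [Cc.sub_apply, Cc.smul_apply, mulCocycle_apply, cplxTwist_apply, hsplit,
        Complex.exp_add]
      ring
    rw [he, norm_mul]
    refine mul_le_mul ((hB η).trans (le_abs_self B)) ?_ (norm_nonneg _) (abs_nonneg B)
    refine (Complex.norm_exp_sub_one_sub_id_le (hle.trans (by linarith))).trans ?_
    rw [← mul_pow]
    gcongr
  · rw [norm_pow, norm_norm]
    ring

theorem isEntireExtension_cplxTwist (c : 𝒢.Cocycle) (f : 𝒢.Cc) :
    (𝒢.timeEvolution c).IsEntireExtension (𝒢.toFullCStar f)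
      fun ζ => 𝒢.toFullCStar (cplxTwist c ζ f) :=
  ⟨fun ζ => (hasDerivAt_cplxTwist c f ζ).differentiableAt, fun _ => rfl⟩

variable (𝒢) in
/-- Functions in `C_c(𝒢)` peaking at a given arrow, supported in a given neighbourhood. -/
theorem exists_bump [LocallyCompactSpace G] {U : Set G} (hU : IsOpen U) {η : G} (hη : η ∈ U) :
    ∃ f : 𝒢.Cc, f η = 1 ∧ (∀ γ, ‖f γ‖ ≤ 1) ∧ ∀ γ ∉ U, f γ = 0 := by
  obtain ⟨g, hg1, hg0, hgc, hg⟩ := exists_continuous_one_zero_of_isCompact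
    (isCompact_singleton (x := η)) hU.isClosed_compl (by simpa using hη)
  refine ⟨Cc.mk (fun γ => (g γ : ℂ)) (Complex.continuous_ofReal.comp g.continuous)
    (hgc.comp_left Complex.ofReal_zero), ?_, fun γ => ?_, fun γ hγ => ?_⟩
  · have : g η = 1 := hg1 (Set.mem_singleton η)
    simp [this]
  · rw [Cc.mk_apply, Complex.norm_real, Real.norm_of_nonneg (hg γ).1]
    exact (hg γ).2
  · have : g γ = 0 := hg0 hγ
    simp [this]

end AnalyticElements

/-! ### Matrix units from bump functions on bisections. -/

section AnalyticMatrixUnits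

variable {X G : Type u} [TopologicalSpace X] [TopologicalSpace G] {𝒢 : EtaleGroupoid X G} {x : X}
  (hiso : 𝒢.arrows x x = {𝒢.unit x}) {γ : 𝒢.orbit x → G}
  (hγ : ∀ z : 𝒢.orbit x, γ z ∈ 𝒢.arrows x z) [T2Space G] [LocallyCompactSpace G]

/-- A bump function at `η = g_w g_z⁻¹` supported in a bisection has at most one nonzero entry in
column `z` and in row `w`. Shrinking the support away from the other sources and ranges listed in
`S` kills the remaining listed vectors, without enlarging the norm. -/
theorem hasAnalyticMatrixUnits_orbit (c : 𝒢.Cocycle) {β : ℝ} (hβ : 0 ≤ β) :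
    HasAnalyticMatrixUnits (regular (orbitEquiv hiso hγ)) (𝒢.timeEvolution c) β := by
  have := 𝒢.t2Space_units
  intro z w
  set e := orbitEquiv hiso hγ with he
  have hr : ∀ i j, 𝒢.r (quotArrow e i j) = i := fun i j =>
    (r_quotArrow e i j).trans (r_orbitEquiv hiso hγ i)
  have hs : ∀ i j, 𝒢.s (quotArrow e i j) = j := fun i j =>
    (s_quotArrow e i j).trans (r_orbitEquiv hiso hγ j)
  set η := quotArrow e w z with hη
  have hC1 : 1 ≤ Real.exp (β * (|c η| + 1)) := Real.one_le_exp (by positivity)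
  -- The bound must not depend on `S`; this one works because `c` stays within 1 of `c η` on the
  -- support, however small that is.
  refine ⟨Real.exp (β * (|c η| + 1)), fun S => ?_⟩
  set Us := (𝒢.isLocalHomeomorph_s.localInverseAt η).target with hUs
  set Ur := (𝒢.isLocalHomeomorph_r.localInverseAt η).target with hUr
  set Fs : Set X := (↑) '' ((S : Set (𝒢.orbit x)) \ {z}) with hFs
  set Fr : Set X := (↑) '' ((S : Set (𝒢.orbit x)) \ {w}) with hFr
  have hFs' : Fs.Finite := (S.finite_toSet.subset Set.sdiff_subset).image _
  have hFr' : Fr.Finite := (S.finite_toSet.subset Set.sdiff_subset).image _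
  set U : Set G := Us ∩ Ur ∩ {ξ | |c ξ - c η| < 1} ∩ 𝒢.s ⁻¹' Fsᶜ ∩ 𝒢.r ⁻¹' Frᶜ with hU
  have hUo : IsOpen U :=
    (((((𝒢.isLocalHomeomorph_s.localInverseAt η).open_target.inter
      (𝒢.isLocalHomeomorph_r.localInverseAt η).open_target).inter
      (isOpen_lt ((c.continuous_toFun.sub continuous_const).abs) continuous_const)).inter
      (hFs'.isClosed.isOpen_compl.preimage 𝒢.isLocalHomeomorph_s.continuous))).inter
      (hFr'.isClosed.isOpen_compl.preimage 𝒢.isLocalHomeomorph_r.continuous)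
  have hηU : η ∈ U := by
    refine ⟨⟨⟨⟨𝒢.isLocalHomeomorph_s.self_mem_localInverseAt_target,
      𝒢.isLocalHomeomorph_r.self_mem_localInverseAt_target⟩, by simp⟩, ?_⟩, ?_⟩
    · rintro ⟨y, ⟨-, hy⟩, hyz⟩
      exact hy (Subtype.ext (hyz.trans (hs w z)))
    · rintro ⟨y, ⟨-, hy⟩, hyz⟩
      exact hy (Subtype.ext (hyz.trans (hr w z)))
  have hsinj : Set.InjOn 𝒢.s U := fun a ha b hb hab =>
    𝒢.isLocalHomeomorph_s.injOn_localInverseAt_target ha.1.1.1.1 hb.1.1.1.1 hab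
  have hrinj : Set.InjOn 𝒢.r U := fun a ha b hb hab =>
    𝒢.isLocalHomeomorph_r.injOn_localInverseAt_target ha.1.1.1.2 hb.1.1.1.2 hab
  obtain ⟨f, hf1, hfn, hf0⟩ := 𝒢.exists_bump hUo hηU
  have hcoef : ∀ i j, regular e (𝒢.toFullCStar f) (delta j) i = f (quotArrow e i j) := fun i j =>
    matrixCoeff_regular e f i j
  have hcoef' : ∀ i j, regular e (star (𝒢.toFullCStar f)) (delta j) i =
      conj (f (quotArrow e j i)) := fun i j => by
    rw [← map_star, ← inv_quotArrow e i j]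
    exact matrixCoeff_regular e (star f) i j
  refine ⟨𝒢.toFullCStar f, fun ζ => 𝒢.toFullCStar (cplxTwist c ζ f),
    fun ζ => 𝒢.toFullCStar (cplxTwist c ζ (star f)), isEntireExtension_cplxTwist c f, ?_, ?_, ?_,
    ?_, ?_, fun y hy hyz => ?_, fun y hy hyw => ?_⟩
  · rw [← map_star]
    exact isEntireExtension_cplxTwist c (star f)
  · refine (𝒢.norm_toFullCStar_le f).trans (max_le (by positivity) ?_)
    exact (𝒢.iNorm_le_of_injOn hsinj hrinj hf0 zero_le_one hfn).trans hC1
  · refine (𝒢.norm_toFullCStar_le _).trans (max_le (by positivity) ?_)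
    -- The adjoint lives on the inverse bisection, where source and range exchange roles.
    refine 𝒢.iNorm_le_of_injOn (K := 𝒢.inv ⁻¹' U) ?_ ?_ (fun ξ hξ => ?_) (Real.exp_pos _).le
      fun ξ => ?_
    · intro a ha b hb hab
      rw [← 𝒢.r_inv, ← 𝒢.r_inv] at hab
      rw [← 𝒢.inv_inv a, hrinj ha hb hab, 𝒢.inv_inv]
    · intro a ha b hb hab
      rw [← 𝒢.s_inv, ← 𝒢.s_inv] at hab
      rw [← 𝒢.inv_inv a, hsinj ha hb hab, 𝒢.inv_inv]
    · rw [cplxTwist_apply, Cc.star_apply, hf0 _ hξ, map_zero, mul_zero]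
    · rw [cplxTwist_apply, Cc.star_apply, norm_mul, RCLike.norm_conj]
      by_cases hξ : 𝒢.inv ξ ∈ U
      swap
      · rw [hf0 _ hξ, norm_zero, mul_zero]
        positivity
      have h1 : ‖Complex.exp (Complex.I * (Complex.I * β) * c ξ)‖ ≤
          Real.exp (β * (|c η| + 1)) := by
        -- The factor at `iβ` is `e^{-βc(ξ)}`, and `-c(ξ) = c(ξ⁻¹) < c(η) + 1`.
        have h2 : |c (𝒢.inv ξ) - c η| < 1 := hξ.1.1.2
        rw [c.map_inv] at h2
        have h3 : Complex.I * (Complex.I * β) * c ξ = ((β * -c ξ : ℝ) : ℂ) := by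
          rw [← _root_.mul_assoc, Complex.I_mul_I]
          push_cast
          ring
        rw [h3, Complex.norm_exp_ofReal, Real.exp_le_exp]
        refine mul_le_mul_of_nonneg_left ?_ hβ
        have := (abs_lt.1 h2).2
        linarith [le_abs_self (c η)]
      calc _ ≤ Real.exp (β * (|c η| + 1)) * 1 := by
            gcongr
            exact hfn _
        _ = _ := mul_one _
  · ext i
    rw [hcoef]
    rcases eq_or_ne i w with rfl | hi
    · rw [delta_apply_self, hf1]
    · rw [delta_apply_ne hi]
      by_contra hne
      have hmem : quotArrow e i z ∈ U := by
        by_contra h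
        exact hne (hf0 _ h)
      have := hsinj hmem hηU ((hs i z).trans (hs w z).symm)
      exact hi (Subtype.ext (by rw [← hr i z, this, hr w z]))
  · ext i
    rw [hcoef']
    rcases eq_or_ne i z with rfl | hi
    · rw [delta_apply_self, hf1, map_one]
    · rw [delta_apply_ne hi]
      by_contra hne
      have hmem : quotArrow e w i ∈ U := by
        by_contra h
        exact hne (by rw [hf0 _ h, map_zero])
      have := hrinj hmem hηU ((hr w i).trans (hr w z).symm)
      exact hi (Subtype.ext (by rw [← hs w i, this, hs w z]))
  · ext i
    rw [hcoef, hf0]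
    · rfl
    · intro hmem
      exact hmem.1.2 ⟨y, ⟨hy, hyz⟩, (hs i y).symm⟩
  · ext i
    rw [hcoef', hf0, map_zero]
    · rfl
    · intro hmem
      exact hmem.2 ⟨y, ⟨hy, hyw⟩, (hr y i).symm⟩

end AnalyticMatrixUnits

end EtaleGroupoid

/-! ### Increasing listings of locally finite sets of reals, and regrouping of sums. -/

section Listing

/-- The hypotheses give `S` a least element, finite intervals and no maximum, so it is order
isomorphic to `ℕ`. -/
theorem exists_strictMono_range_eq {S : Set ℝ} (hS : S.Infinite)
    (hfin : ∀ t, (S ∩ Set.Iic t).Finite) :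
    ∃ l : ℕ → ℝ, StrictMono l ∧ Filter.Tendsto l Filter.atTop Filter.atTop ∧ Set.range l = S := by
  obtain ⟨a, ha⟩ := hS.nonempty
  obtain ⟨m, ⟨hmS, hma⟩, hm⟩ := Set.exists_min_image _ id (hfin a) ⟨a, ha, Set.mem_Iic.2 le_rfl⟩
  have hmin : ∀ b ∈ S, m ≤ b := fun b hb => by
    rcases le_total b a with h | h
    · exact hm b ⟨hb, h⟩
    · exact le_trans hma h
  let : LocallyFiniteOrder S := LocallyFiniteOrder.ofFiniteIcc fun a b =>
    Set.Finite.of_injOn (f := ((↑) : S → ℝ)) (t := S ∩ Set.Iic (b : ℝ))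
      (fun c hc => ⟨c.2, hc.2⟩) Subtype.val_injective.injOn (hfin b)
  let : OrderBot S := { bot := ⟨m, hmS⟩, bot_le := fun b => hmin b b.2 }
  let : SuccOrder S := LinearLocallyFiniteOrder.succOrder S
  let : PredOrder S := LinearLocallyFiniteOrder.predOrder S
  have : NoMaxOrder S := ⟨fun b => by
    obtain ⟨d, hd, hbd⟩ := (hS.sdiff (hfin b)).nonempty
    exact ⟨⟨d, hd⟩, lt_of_not_ge fun h => hbd ⟨hd, h⟩⟩⟩
  have e : S ≃o ℕ := orderIsoNatOfLinearSuccPredArch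
  have hmono : StrictMono fun n => (e.symm n : ℝ) := fun i j hij => e.symm.strictMono hij
  have hrange : Set.range (fun n => (e.symm n : ℝ)) = S := by
    ext b
    constructor
    · rintro ⟨n, rfl⟩
      exact (e.symm n).2
    · intro hb
      exact ⟨e ⟨b, hb⟩, by simp⟩
  refine ⟨_, hmono, Filter.tendsto_atTop_atTop_of_monotone hmono.monotone fun t => ?_, hrange⟩
  by_contra! h
  refine hS ((hfin t).subset fun b hb => ⟨hb, ?_⟩)
  rw [← hrange] at hb
  obtain ⟨n, rfl⟩ := hb
  exact (h n).le

/-- A lower set of `ℕ` is either an initial segment, determined by its cardinality, or all of `ℕ`.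
-/
theorem setOf_lt_encard_of_isLowerSet {T : Set ℕ} (hT : IsLowerSet T) :
    {i : ℕ | (i : ℕ∞) < T.encard} = T := by
  by_cases hfin : T.Finite
  · have hex : ∃ n, n ∉ T := by
      by_contra! h
      exact Set.infinite_univ (hfin.subset fun i _ => h i)
    classical
    obtain ⟨k, hIio⟩ : ∃ k, T = Set.Iio k := by
      refine ⟨Nat.find hex, Set.ext fun i => ⟨fun hi => ?_, fun hi => ?_⟩⟩
      · by_contra h
        exact Nat.find_spec hex (hT (not_lt.1 h) hi)
      · by_contra h
        exact Nat.find_min hex hi h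
    have hcard : T.encard = k := by
      rw [hIio, ← Finset.coe_Iio, Set.encard_coe_eq_coe_finsetCard, Nat.card_Iio]
    ext i
    rw [hcard, hIio]
    simp
  · have huniv : T = Set.univ := by
      refine Set.eq_univ_of_forall fun n => ?_
      obtain ⟨i, hi, hni⟩ := Set.Infinite.exists_gt hfin n
      exact hT hni.le hi
    rw [huniv]
    ext i
    simp

theorem exists_isIncreasingListing {S : Set ℝ} (hfin : ∀ t, (S ∩ Set.Iic t).Finite) :
    ∃ l, IsIncreasingListing S l := by
  -- A finite `S` is padded by points `M + 1, M + 2, …` beyond an upper bound `M`; this makes it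
  -- infinite, and `S` remains an initial part of the listing.
  obtain ⟨S', hsub, hlow, hinf, hfin'⟩ : ∃ S' : Set ℝ, S ⊆ S' ∧ (∀ a ∈ S', ∀ b ∈ S, a ≤ b → a ∈ S) ∧
      S'.Infinite ∧ ∀ t, (S' ∩ Set.Iic t).Finite := by
    by_cases hS : S.Finite
    · obtain ⟨M, hM⟩ := hS.bddAbove
      refine ⟨S ∪ Set.range fun n : ℕ => M + (n + 1), Set.subset_union_left, ?_, ?_, fun t => ?_⟩
      · rintro a (ha | ⟨n, rfl⟩) b hb hab
        · exact ha
        · have h1 := hM hb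
          have h2 : (0 : ℝ) ≤ n := n.cast_nonneg
          simp only at hab
          linarith
      · refine (Set.infinite_range_of_injective fun i j h => ?_).mono Set.subset_union_right
        simpa using h
      · rw [Set.union_inter_distrib_right]
        refine (hfin t).union ?_
        refine ((Set.finite_Iic ⌈t - M⌉₊).image fun n : ℕ => M + ((n : ℝ) + 1)).subset ?_
        rintro _ ⟨⟨n, rfl⟩, hn⟩
        refine ⟨n, ?_, rfl⟩
        have hn' : M + ((n : ℝ) + 1) ≤ t := hn
        have h1 := Nat.le_ceil (t - M)
        have h2 : (n : ℝ) ≤ ⌈t - M⌉₊ := by linarith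
        exact_mod_cast h2
    · exact ⟨S, subset_rfl, fun a ha _ _ _ => ha, hS, hfin⟩
  obtain ⟨l, hmono, hlim, hrange⟩ := exists_strictMono_range_eq hinf hfin'
  refine ⟨l, hmono, hlim, ?_⟩
  have himage : l '' (l ⁻¹' S) = S := Set.image_preimage_eq_of_subset (hrange ▸ hsub)
  have hT : IsLowerSet (l ⁻¹' S) := fun i j hji hi =>
    hlow _ (hrange ▸ ⟨j, rfl⟩) _ hi (hmono.monotone hji)
  have h := setOf_lt_encard_of_isLowerSet hT
  rw [← hmono.injective.encard_image, himage] at h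
  rw [h, himage]

/-- Grouping the terms of a sum according to the value of a function that is listed injectively. -/
theorem HasSum.ncard_fiber_mul {ι : Type*} {h : ι → ℝ} (hfin : ∀ t, {z | h z ≤ t}.Finite)
    {l : ℕ → ℝ} (hl : Function.Injective l) (hrange : Set.range h ⊆ Set.range l) {F : ℝ → ℂ} {a : ℂ}
    (ha : HasSum (fun z => F (h z)) a) : HasSum (fun i => ({z | h z = l i}.ncard : ℂ) * F (l i)) a := by
  choose i hi using fun z => hrange ⟨z, rfl⟩
  have hiff : ∀ z n, i z = n ↔ h z = l n := fun z n =>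
    ⟨fun e => by rw [← e, hi], fun e => hl (by rw [hi, e])⟩
  -- Split the index set into the fibres of `i`; they are finite and the summand is constant on
  -- each, so its inner sum is the cardinality times the common value.
  refine ((Equiv.sigmaFiberEquiv i).hasSum_iff.2 ha).sigma fun n => ?_
  have hset : {z | i z = n} = {z | h z = l n} := Set.ext fun z => hiff z n
  have hf : {z | i z = n}.Finite := (hfin (l n)).subset fun z hz => ((hiff z n).1 hz).le
  have : Finite {z // i z = n} := hf
  have := Fintype.ofFinite {z // i z = n}
  have hterm : ∀ z : {z // i z = n},
      ((fun z => F (h z)) ∘ Equiv.sigmaFiberEquiv i) ⟨n, z⟩ = F (l n) := fun z =>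
    congrArg F ((hiff z.1 n).1 z.2)
  simp only [hterm]
  convert hasSum_fintype fun _ : {z // i z = n} => F (l n) using 1
  rw [Finset.sum_const, Finset.card_univ, nsmul_eq_mul, ← Nat.card_eq_fintype_card, ← hset]
  rfl

end Listing

namespace EtaleGroupoid

/-! ### The orbit weights, their abscissa, and the zeta function. -/

section OrbitZeta

variable {X G : Type u} [TopologicalSpace X] [TopologicalSpace G] {𝒢 : EtaleGroupoid X G} {x : X}
  (hiso : 𝒢.arrows x x = {𝒢.unit x}) {γ : 𝒢.orbit x → G}
  (hγ : ∀ z : 𝒢.orbit x, γ z ∈ 𝒢.arrows x z) (c : 𝒢.Cocycle)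

include hiso hγ

theorem orbitWeight_eq (z : 𝒢.orbit x) : 𝒢.orbitWeight c x z = Real.exp (-c (γ z)) := by
  rw [orbitWeight, eq_of_arrows_eq_unit hiso z.2.choose_spec.1 (hγ z).1
    (z.2.choose_spec.2.trans (hγ z).2.symm)]

theorem orbitWeight_rpow (z : 𝒢.orbit x) (b lam : ℝ) :
    𝒢.orbitWeight c x z ^ b = Real.exp (-b * lam) * Real.exp (-b * (c (γ z) - lam)) := by
  rw [orbitWeight_eq hiso hγ, ← Real.exp_mul, ← Real.exp_add]
  ring_nf

theorem orbitZeta_eq_tsum (lam : ℝ) (s : ℂ) :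
    𝒢.orbitZeta c x lam s = ∑' z, Complex.exp (-s * ((c (γ z) - lam : ℝ) : ℂ)) := by
  rw [orbitZeta, ← tsum_mul_left]
  refine tsum_congr fun z => ?_
  rw [orbitWeight_eq hiso hγ, Complex.cpow_def_of_ne_zero
    (Complex.ofReal_ne_zero.2 (Real.exp_ne_zero _)), ← Complex.ofReal_log (Real.exp_pos _).le,
    Real.log_exp, ← Complex.exp_add]
  push_cast
  ring_nf

theorem summable_exp_of_orbitWeight {b : ℝ}
    (hb : Summable fun z : 𝒢.orbit x => 𝒢.orbitWeight c x z ^ b) (lam : ℝ) :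
    Summable fun z => Real.exp (-b * (c (γ z) - lam)) := by
  simp only [orbitWeight_rpow hiso hγ c _ b lam] at hb
  exact (summable_mul_left_iff (Real.exp_ne_zero _)).1 hb

/-- Some exponent `b < t` is summable, and `e^{-th} ≤ e^{-bh}` because `h = c(γ z) - lam` is
nonnegative; neither exponent needs to be positive. -/
theorem summable_exp_of_orbitAbscissa_lt {lam : ℝ} (hlam : ∀ z, lam ≤ c (γ z)) {t : ℝ}
    (ht : 𝒢.orbitAbscissa c x < (t : EReal)) :
    Summable fun z => Real.exp (-t * (c (γ z) - lam)) := by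
  obtain ⟨_, ⟨b, hb, rfl⟩, hbt⟩ := sInf_lt_iff.1 ht
  have hbt' : b < t := EReal.coe_lt_coe_iff.1 hbt
  refine (summable_exp_of_orbitWeight hiso hγ c hb lam).of_nonneg_of_le
    (fun z => (Real.exp_pos _).le) fun z => Real.exp_le_exp.2 ?_
  exact mul_le_mul_of_nonneg_right (neg_le_neg hbt'.le) (sub_nonneg.2 (hlam z))

/-- The terms of a convergent series tend to 0 along the cofinite filter, while `c(γ z) ≤ t` keeps
the term at least `e^{-βt}`. -/
theorem finite_cocycle_le {β : ℝ} (hβ : 0 < β)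
    (hs : Summable fun z : 𝒢.orbit x => 𝒢.orbitWeight c x z ^ β) (t : ℝ) :
    {z | c (γ z) ≤ t}.Finite := by
  have h := (summable_exp_of_orbitWeight hiso hγ c hs 0).tendsto_cofinite_zero.eventually_lt_const
    (Real.exp_pos (-β * t))
  refine (Filter.eventually_cofinite.1 h).subset fun z hz => ?_
  have hz' : c (γ z) ≤ t := hz
  rw [Set.mem_ofPred_eq, not_lt, Real.exp_le_exp, sub_zero]
  exact mul_le_mul_of_nonpos_left hz' (neg_nonpos.2 hβ.le)

end OrbitZeta

end EtaleGroupoid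

/-! ### The theorem on orbits with trivial isotropy. -/

theorem theorem3p6 {X G : Type u} [TopologicalSpace X] [MeasurableSpace X] [BorelSpace X]
    [TopologicalSpace G] [T2Space G] [LocallyCompactSpace G] [SecondCountableTopology G]
    (𝒢 : EtaleGroupoid X G) (c : 𝒢.Cocycle) (β : ℝ) (hβ : 0 < β) (x : X)
    (hsum : 𝒢.IsSummableOrbit c β x) (hiso : 𝒢.arrows x x = {𝒢.unit x})
    (γ : 𝒢.orbit x → G) (hγ : ∀ z : 𝒢.orbit x, γ z ∈ 𝒢.arrows x z) :
    ∃ lam₁ : ℝ, IsLeast (Set.range fun z => c (γ z)) lam₁ ∧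
      (∃! π : 𝒢.FullCStar →⋆ₙₐ[ℂ]
          (lp (fun _ : 𝒢.orbit x => ℂ) 2 →L[ℂ] lp (fun _ : 𝒢.orbit x => ℂ) 2),
        𝒢.IsOrbitRep x π) ∧
      (∀ π, 𝒢.IsOrbitRep x π →
        IsAdmissibleTriple (𝒢.timeEvolution c) β (𝒢.orbitState c β x) π
          (expDiagonal (fun z => c (γ z) - lam₁) β)) ∧
      IsPartitionFunction.{u + 1, w} (𝒢.timeEvolution c) β (𝒢.orbitState c β x)
        (𝒢.orbitZeta c x lam₁) ∧
      (∀ s : ℂ, 𝒢.orbitAbscissa c x < (s.re : EReal) →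
        IsTraceClass (expDiagonal (fun z => c (γ z) - lam₁) s) ∧
        operatorTrace (expDiagonal (fun z => c (γ z) - lam₁) s) = 𝒢.orbitZeta c x lam₁ s) ∧
      (∀ t : ℝ, {z | c (γ z) ≤ t}.Finite) ∧
      ∃ lam : ℕ → ℝ, IsIncreasingListing (Set.range fun z => c (γ z)) lam ∧
        ∀ s : ℂ, 𝒢.orbitAbscissa c x < (s.re : EReal) →
          HasSum (fun i => ({z | c (γ z) = lam i}.ncard : ℂ) *
            Complex.exp (-s * ((lam i - lam₁ : ℝ) : ℂ))) (𝒢.orbitZeta c x lam₁ s) := by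
  have hs := hsum.2
  have hfin := EtaleGroupoid.finite_cocycle_le hiso hγ c hβ hs
  obtain ⟨z₀, hz₀⟩ : ∃ z₀, ∀ z, c (γ z₀) ≤ c (γ z) := by
    -- The point `x` itself provides a nonempty finite sublevel set, on which the minimum is taken.
    let y : 𝒢.orbit x := ⟨x, 𝒢.unit x, 𝒢.s_unit x, 𝒢.r_unit x⟩
    obtain ⟨z₀, hz₀, hmin⟩ := Set.exists_min_image _ (fun z => c (γ z)) (hfin (c (γ y)))
      ⟨y, le_refl (c (γ y))⟩
    refine ⟨z₀, fun z => ?_⟩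
    rcases le_total (c (γ z)) (c (γ y)) with h | h
    · exact hmin z h
    · exact le_trans hz₀ h
  set lam₁ := c (γ z₀) with hlam
  have h0 : ∀ z, 0 ≤ c (γ z) - lam₁ := fun z => sub_nonneg.2 (hz₀ z)
  have hpos : ∀ z, 0 < 𝒢.orbitWeight c x z ^ β := fun z => Real.rpow_pos_of_pos (Real.exp_pos _) β
  have htot : 0 < ∑' z, 𝒢.orbitWeight c x z ^ β := hs.tsum_pos (fun z => (hpos z).le) z₀ (hpos z₀)
  -- A summable family of strictly positive numbers has a countable index set; separability of
  -- `ℓ²(O)` rests on this.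
  have hcount : Countable (𝒢.orbit x) :=
    Set.countable_univ_iff.1 (hs.countable_support.mono fun z _ => (hpos z).ne')
  have hqpos : ∀ z, 0 < 𝒢.orbitWeight c x z ^ β / ∑' w, 𝒢.orbitWeight c x w ^ β :=
    fun z => div_pos (hpos z) htot
  have hq : HasSum (fun z => 𝒢.orbitWeight c x z ^ β / ∑' w, 𝒢.orbitWeight c x w ^ β) 1 := by
    have h := hs.hasSum.div_const (∑' w, 𝒢.orbitWeight c x w ^ β)
    rwa [div_self htot.ne'] at h
  -- The shift by `lam₁` is absorbed into the constant, which puts the normalised weights in Gibbs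
  -- form for a Hamiltonian with minimum 0.
  have hqh : ∀ z, 𝒢.orbitWeight c x z ^ β / ∑' w, 𝒢.orbitWeight c x w ^ β =
      (Real.exp (-β * lam₁) / ∑' w, 𝒢.orbitWeight c x w ^ β) *
        Real.exp (-β * (c (γ z) - lam₁)) := fun z => by
    rw [EtaleGroupoid.orbitWeight_rpow hiso hγ c z β lam₁]
    ring
  have hunits := EtaleGroupoid.hasAnalyticMatrixUnits_orbit hiso hγ c hβ.le
  have hdiag := EtaleGroupoid.isDiagonalFunctional_orbitState hiso hγ c hs
  have hzeta : ∀ s, 𝒢.orbitZeta c x lam₁ s = _ :=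
    EtaleGroupoid.orbitZeta_eq_tsum hiso hγ c lam₁
  refine ⟨lam₁, ⟨⟨z₀, rfl⟩, ?_⟩, ?_, ?_, ?_, fun s hsre => ?_, hfin, ?_⟩
  · rintro _ ⟨z, rfl⟩
    exact hz₀ z
  · exact ⟨_, (EtaleGroupoid.isOrbitRep_iff hiso hγ _).2 rfl,
      fun π hπ => (EtaleGroupoid.isOrbitRep_iff hiso hγ π).1 hπ⟩
  · intro π hπ
    rw [(EtaleGroupoid.isOrbitRep_iff hiso hγ π).1 hπ]
    exact isAdmissibleTriple_of_diagonal (EtaleGroupoid.isDiagonalEvolution_orbit hiso hγ c lam₁) hβ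
      hqpos hq hqh h0 (sub_self lam₁) hunits hdiag
  · rw [show 𝒢.orbitZeta c x lam₁ = _ from funext hzeta]
    exact isPartitionFunction_of_diagonal hqpos hq.summable hqh h0 (sub_self lam₁)
      hunits.hasMatrixUnits hdiag
  · rw [hzeta]
    exact isTraceClass_expDiagonal
      (EtaleGroupoid.summable_exp_of_orbitAbscissa_lt hiso hγ c hz₀ hsre)
  · obtain ⟨lam, hlist⟩ := exists_isIncreasingListing (S := Set.range fun z => c (γ z)) fun t => by
      refine ((hfin t).image fun z => c (γ z)).subset ?_
      rintro _ ⟨⟨z, rfl⟩, hz⟩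
      exact ⟨z, hz, rfl⟩
    refine ⟨lam, hlist, fun s hsre => ?_⟩
    refine HasSum.ncard_fiber_mul (F := fun t => Complex.exp (-s * ((t - lam₁ : ℝ) : ℂ))) hfin
      hlist.1.injective (hlist.2.2 ▸ Set.image_subset_range _ _) ?_
    rw [hzeta]
    refine Summable.hasSum (Summable.of_norm ?_)
    simp only [norm_exp_neg_mul]
    exact EtaleGroupoid.summable_exp_of_orbitAbscissa_lt hiso hγ c hz₀ hsre
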